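/- Let $d\ge 2$, let $\mathbb S^d$ be the unit sphere of $\mathbb R^{d+1}$, let $e\in\mathbb S^d$, and let $\mathbb S_e^+=\{u\in\mathbb S^d:\langle u,e\rangle\ge 0\}$ be the closed halfsphere with centre $e$. For $n\ge d+1$ let $X_1,\dots,X_n$ be stochastically independent random points, each uniformly distributed in $\mathbb S_e^+$ (with respect to spherical Lebesgue measure), and let $$P_n=\mathbb S^d\cap\operatorname{pos}\{X_1,\dots,X_n\}$$ be their spherical convex hull, where $\operatorname{pos}$ denotes the positive hull in $\mathbb R^{d+1}$. The surface area $S(P)$ of a spherical polytope $P\subset\mathbb S^d$ is the sum, over the facets ($(d-1)$-dimensional faces) $F$ of $P$, of the $(d-1)$-dimensional spherical Lebesgue measure of $F$ in the great subsphere spanned by $F$. Put $\omega_d=2\pi^{d/2}/\Gamma(d/2)$. Then for every $n\ge d+1$ $$\mathbb E\,S(P_n)=\frac{d\,\omega_d}{\pi^d}\binom nd\int_0^\pi\Bigl(1-\frac x\pi\Bigr)^{n-d}\sin^{d-1}x\,\mathrm dx .$$ Further, as $n\to\infty$, $$\mathbb E\,S(P_n)=\omega_d\left(1-\binom{d+1}{3}\pi^2\,n^{-2}+O(n^{-3})\right),$$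 where the implied constant depends only on $d$. -/

import Mathlib

open MeasureTheory ProbabilityTheory

open scoped ENNReal

namespace RandomSphericalPolytope

/-- The ambient Euclidean space `ℝ^{d+1}` of the sphere `S^d`. -/
abbrev Ambient (d : ℕ) : Type := EuclideanSpace ℝ (Fin (d + 1))

/-- The unit sphere `S^d` of `ℝ^{d+1}`. -/
abbrev Sph (d : ℕ) : Set (Ambient d) := Metric.sphere (0 : Ambient d) 1

/-- `ω_k = 2 π^{k/2} / Γ(k/2)`, the total measure of the unit sphere of `ℝ^k`. -/
noncomputable def omega (k : ℕ) : ℝ :=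
  2 * Real.pi ^ ((k : ℝ) / 2) / Real.Gamma ((k : ℝ) / 2)

/-- Spherical Lebesgue measure `σ` on `S^d`. -/
noncomputable def sigma (d : ℕ) : Measure (Sph d) :=
  (volume : Measure (Ambient d)).toSphere

/-- The closed halfsphere `{u ∈ S^d : ⟨u, e⟩ ≥ 0}`. -/
def halfsphere {d : ℕ} (e : Sph d) : Set (Sph d) :=
  {u | 0 ≤ inner ℝ (u : Ambient d) (e : Ambient d)}

/-- The uniform probability measure on the closed halfsphere: `σ` restricted to the halfsphere,
divided by the total mass of the halfsphere. -/
noncomputable def uniformHalfsphere {d : ℕ} (e : Sph d) : Measure (Sph d) :=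
  (sigma d)[|halfsphere e]

/-- The spherical convex hull `conv_s A = S^d ∩ pos A`, where `pos A` is the positive hull
(the set of all finite linear combinations of points of `A` with nonnegative coefficients). -/
def sphericalHull {d : ℕ} (A : Set (Ambient d)) : Set (Ambient d) :=
  Sph d ∩ (PointedCone.hull ℝ A : Set (Ambient d))

/-- `F` is a facet (a `(d-1)`-dimensional face) of the spherical polytope `P ⊆ S^d`: it is the
intersection of `P` with a hyperplane through `0` that has `P` on one side, and its linear hull
has dimension `d`. -/
def IsFacet {d : ℕ} (P F : Set (Ambient d)) : Prop :=
  (∃ v : Ambient d, (∀ x ∈ P, inner ℝ v x ≤ 0) ∧ F = {x ∈ P | inner ℝ v x = 0}) ∧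
    Module.finrank ℝ (Submodule.span ℝ F) = d

/-- Spherical Lebesgue measure on the great subsphere `L ∩ S^d`, for a linear subspace `L`, as a
measure on `ℝ^{d+1}`. It is induced by Lebesgue measure of the Euclidean space `L`. -/
noncomputable def greatSubsphereMeasure {d : ℕ} (L : Submodule ℝ (Ambient d)) :
    Measure (Ambient d) :=
  ((volume : Measure L).toSphere).map
    (fun x : Metric.sphere (0 : L) 1 => ((x : L) : Ambient d))

/-- The surface area of a spherical polytope `P`: the sum over its facets `F` of the
`(d-1)`-dimensional spherical Lebesgue measure of `F` in the great subsphere spanned by `F`. -/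
noncomputable def surfaceArea {d : ℕ} (P : Set (Ambient d)) : ℝ≥0∞ :=
  ∑' F : {F : Set (Ambient d) // IsFacet P F},
    greatSubsphereMeasure (Submodule.span ℝ F.1) F.1

/-- The spherical polytope spanned by `n` points of `S^d`. -/
def polytope {d n : ℕ} (x : Fin n → Sph d) : Set (Ambient d) :=
  sphericalHull (Set.range fun i => (x i : Ambient d))

end RandomSphericalPolytope

/-!
A uniform random point of the halfsphere is the direction of a standard Gaussian point of `ℝ × ℝ^d`
conditioned to have nonnegative first coordinate, and the hull depends only on the directions.
Almost surely every facet has exactly `d` of the points as vertices, and `d` of the points span a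
facet if and only if their hyperplane through the origin has all the other points on one side. This
hyperplane is a graph `h = ⟨a, z⟩`; if `x = arctan |a|` is its angle with `h = 0`, the other points
lie on one side with probability `(1 - x / π) ^ (n - d) + (x / π) ^ (n - d)`.

It remains to find the law of the slope `a` under the weight given by the measure of the facet,
which is proportional to the Gaussian integral over the cone of its vertices. In the parametrisation
`(⟨a, Z i⟩, Z i)` of the vertices, whose Jacobian is `|det Z|`, whitening the Gaussian form shows
that the density of `a` is proportional to `(1 + |a|²) ^ (-(d + 1) / 2)`. The weight contributes
another factor `|det Z|`, so the constant comes from the second moment of a Gaussian determinant. In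
polar coordinates for `a` the density of `x` becomes `sin x ^ (d - 1)` on `(0, π / 2)`, and the
reflection `x ↦ π - x` merges the two sides into one integral over `(0, π)`.

For the asymptotics, expand `sin x ^ (d - 1) = x ^ (d - 1) - (d - 1) / 6 * x ^ (d + 1) +
O(x ^ (d + 2))`; the moments of `(1 - x / π) ^ (n - d)` are Beta integrals.
-/

namespace RandomSphericalPolytope

open Set Filter

open scoped Matrix Real Topology

section LinearChangeOfVariables

theorem lintegral_comp_linearMap {E : Type*} [NormedAddCommGroup E] [NormedSpace ℝ E]
    [MeasurableSpace E] [BorelSpace E] [FiniteDimensional ℝ E] (μ : Measure E)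
    [μ.IsAddHaarMeasure] {f : E →ₗ[ℝ] E} (hf : LinearMap.det f ≠ 0) {F : E → ℝ≥0∞}
    (hF : Measurable F) :
    ∫⁻ x, F x ∂μ = ENNReal.ofReal |LinearMap.det f| * ∫⁻ x, F (f x) ∂μ := by
  have hc : Measurable f := f.continuous_of_finiteDimensional.measurable
  rw [← lintegral_map hF hc, Measure.map_linearMap_addHaar_eq_smul_addHaar μ hf,
    lintegral_smul_measure, smul_eq_mul, ← mul_assoc, ← ENNReal.ofReal_mul (abs_nonneg _),
    ← abs_mul, mul_inv_cancel₀ hf, abs_one, ENNReal.ofReal_one, one_mul]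

variable {ι κ : Type*} [Fintype ι] [Fintype κ]

theorem lintegral_comp_mulVec [DecidableEq ι] {M : Matrix ι ι ℝ} (hM : M.det ≠ 0)
    {F : (ι → ℝ) → ℝ≥0∞} (hF : Measurable F) :
    ∫⁻ x, F x = ENNReal.ofReal |M.det| * ∫⁻ x, F (M *ᵥ x) := by
  simpa using lintegral_comp_linearMap volume (f := Matrix.toLin' M) (by simpa using hM) hF

theorem lintegral_comp_mulVec_pi [DecidableEq ι] {M : Matrix ι ι ℝ} (hM : M.det ≠ 0)
    {F : (κ → ι → ℝ) → ℝ≥0∞} (hF : Measurable F) :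
    ∫⁻ Z, F Z = ENNReal.ofReal |M.det| ^ Fintype.card κ *
      ∫⁻ Z : κ → ι → ℝ, F fun k => M *ᵥ Z k := by
  have hdet : LinearMap.det (LinearMap.pi fun k : κ =>
      Matrix.toLin' M ∘ₗ (LinearMap.proj k : (κ → ι → ℝ) →ₗ[ℝ] (ι → ℝ))) =
      M.det ^ Fintype.card κ := by
    rw [LinearMap.det_pi]
    simp
  have h := lintegral_comp_linearMap volume (by rw [hdet]; exact pow_ne_zero _ hM) hF
  rwa [hdet, abs_pow, ENNReal.ofReal_pow (abs_nonneg _)] at h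

theorem lintegral_comp_transpose {F : (ι → ι → ℝ) → ℝ≥0∞} (hF : Measurable F) :
    ∫⁻ Z, F Z = ∫⁻ Z : ι → ι → ℝ, F fun i j => Z j i := by
  let f : (ι → ι → ℝ) →ₗ[ℝ] (ι → ι → ℝ) :=
    { toFun := fun Z i j => Z j i, map_add' := fun _ _ => rfl, map_smul' := fun _ _ => rfl }
  have hsq : LinearMap.det f * LinearMap.det f = 1 := by
    rw [← LinearMap.det_comp]
    exact LinearMap.det_id
  have habs : |LinearMap.det f| = 1 := by
    rcases mul_self_eq_one_iff.1 hsq with h | h <;> simp [h]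
  have h := lintegral_comp_linearMap volume (left_ne_zero_of_mul_eq_one hsq) hF
  rwa [habs, ENNReal.ofReal_one, one_mul] at h

theorem setLIntegral_Ici_comp_smul {s : ℝ} (hs : 0 < s) {F : (κ → ℝ) → ℝ≥0∞}
    (hF : Measurable F) :
    ∫⁻ x in Ici 0, F x =
      ENNReal.ofReal (s ^ Fintype.card κ) * ∫⁻ x in Ici 0, F (s • x) := by
  have hdet : LinearMap.det (s • (LinearMap.id : (κ → ℝ) →ₗ[ℝ] _)) = s ^ Fintype.card κ := by
    simp [LinearMap.det_smul]
  have hIci (x : κ → ℝ) : s • x ∈ Ici 0 ↔ x ∈ Ici 0 := by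
    simp only [mem_Ici, Pi.le_def, Pi.zero_apply, Pi.smul_apply, smul_eq_mul,
      mul_nonneg_iff_of_pos_left hs]
  rw [← lintegral_indicator measurableSet_Ici, ← lintegral_indicator measurableSet_Ici,
    lintegral_comp_linearMap volume (by rw [hdet]; positivity) (hF.indicator measurableSet_Ici),
    hdet, abs_of_pos (by positivity)]
  refine congrArg _ (lintegral_congr fun x => ?_)
  by_cases hx : x ∈ Ici 0
  · exact (indicator_of_mem ((hIci x).2 hx) F).trans (indicator_of_mem hx fun x => F (s • x)).symm
  · exact (indicator_of_notMem (mt (hIci x).1 hx) F).trans (indicator_of_notMem hx _).symm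

end LinearChangeOfVariables

section FinitePowers

theorem indicator_univ_pi_prod {ι α M : Type*} [Fintype ι] [CommMonoidWithZero M]
    (s : ι → Set α) (f : ι → α → M) (x : ι → α) :
    (univ.pi s).indicator (fun x => ∏ i, f i (x i)) x = ∏ i, (s i).indicator (f i) (x i) := by
  by_cases hx : ∀ i, x i ∈ s i
  · rw [indicator_of_mem (mem_univ_pi.2 hx)]
    exact Finset.prod_congr rfl fun i _ => (indicator_of_mem (hx i) _).symm
  · rw [indicator_of_notMem (mt mem_univ_pi.1 hx)]
    push Not at hx
    obtain ⟨i, hi⟩ := hx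
    exact (Finset.prod_eq_zero (Finset.mem_univ i) (indicator_of_notMem hi _)).symm

variable {k : ℕ} {α : Type*} [MeasurableSpace α] (μ : Measure α) [SigmaFinite μ]

theorem lintegral_pi_cons {F : (Fin (k + 1) → α) → ℝ≥0∞} (hF : Measurable F) :
    ∫⁻ x, F x ∂(Measure.pi fun _ => μ) =
      ∫⁻ r, ∫⁻ S : Fin k → α, F (Fin.cons r S) ∂(Measure.pi fun _ => μ) ∂μ := by
  have hmp := (measurePreserving_piFinSuccAbove (fun _ : Fin (k + 1) => μ) 0).symm
  rw [← hmp.lintegral_comp hF]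
  refine (lintegral_prod (ν := Measure.pi fun _ : Fin k => μ) _
    (hF.comp hmp.measurable).aemeasurable).trans ?_
  simp [MeasurableEquiv.piFinSuccAbove_symm_apply, Fin.insertNthEquiv]

theorem setLIntegral_pi_cons {F : (Fin (k + 1) → α) → ℝ≥0∞} (hF : Measurable F) {s : Set α}
    (hs : MeasurableSet s) :
    ∫⁻ x in {x | x 0 ∈ s}, F x ∂(Measure.pi fun _ => μ) =
      ∫⁻ r in s, ∫⁻ S : Fin k → α, F (Fin.cons r S) ∂(Measure.pi fun _ => μ) ∂μ := by
  have hs' : MeasurableSet {x : Fin (k + 1) → α | x 0 ∈ s} := hs.preimage (measurable_pi_apply 0)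
  rw [← lintegral_indicator hs', ← lintegral_indicator hs, lintegral_pi_cons μ (hF.indicator hs')]
  refine lintegral_congr fun r => ?_
  by_cases hr : r ∈ s <;> simp [indicator, hr]

theorem lintegral_pi_prod {f : Fin k → α → ℝ≥0∞} (hf : ∀ i, Measurable (f i)) :
    ∫⁻ x : Fin k → α, ∏ i, f i (x i) ∂(Measure.pi fun _ => μ) = ∏ i, ∫⁻ x, f i x ∂μ := by
  induction k with
  | zero => simp
  | succ k ih =>
    rw [lintegral_pi_cons μ (by fun_prop), Fin.prod_univ_succ, ← ih fun i => hf i.succ,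
      ← lintegral_mul_const _ (hf 0)]
    refine lintegral_congr fun r => ?_
    simp only [Fin.prod_univ_succ, Fin.cons_zero, Fin.cons_succ]
    exact lintegral_const_mul _ (by fun_prop)

theorem pi_withDensity {f : α → ℝ≥0∞} (hf : Measurable f) [SigmaFinite (μ.withDensity f)] :
    Measure.pi (fun _ : Fin k => μ.withDensity f) =
      (Measure.pi fun _ : Fin k => μ).withDensity fun x => ∏ i, f (x i) := by
  refine Measure.pi_eq fun s hs => ?_
  have hs' := MeasurableSet.univ_pi hs
  simp_rw [withDensity_apply _ hs', ← lintegral_indicator hs', indicator_univ_pi_prod,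
    withDensity_apply _ (hs _), ← lintegral_indicator (hs _)]
  exact lintegral_pi_prod μ fun i => hf.indicator (hs i)

end FinitePowers

section Whitening

variable {m : ℕ}

theorem dotProduct_self_nonneg {ι : Type*} [Fintype ι] (x : ι → ℝ) : 0 ≤ x ⬝ᵥ x := by
  simpa using dotProduct_self_star_nonneg x

@[fun_prop]
theorem measurable_dotProduct {α ι : Type*} [MeasurableSpace α] [Fintype ι] {f g : α → ι → ℝ}
    (hf : Measurable f) (hg : Measurable g) : Measurable fun x => f x ⬝ᵥ g x := by
  simp only [dotProduct]
  fun_prop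

theorem exists_orthonormalBasis_zero_eq {e : EuclideanSpace ℝ (Fin (m + 1))} (he : ‖e‖ = 1) :
    ∃ b : OrthonormalBasis (Fin (m + 1)) ℝ (EuclideanSpace ℝ (Fin (m + 1))), b 0 = e := by
  have h : Orthonormal ℝ (({0} : Set (Fin (m + 1))).domRestrict fun _ => e) :=
    ⟨fun _ => he, fun i j hij => absurd (Subsingleton.elim i j) hij⟩
  obtain ⟨b, hb⟩ := h.exists_orthonormalBasis_extension_of_card_eq (by simp)
  exact ⟨b, hb 0 (mem_singleton 0)⟩

theorem exists_rotation (a : Fin (m + 1) → ℝ) :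
    ∃ R : Matrix (Fin (m + 1)) (Fin (m + 1)) ℝ,
      R * Rᵀ = 1 ∧ R *ᵥ a = Pi.single 0 √(a ⬝ᵥ a) := by
  obtain ⟨e, he, hae⟩ : ∃ e : EuclideanSpace ℝ (Fin (m + 1)), ‖e‖ = 1 ∧
      WithLp.toLp 2 a = ‖WithLp.toLp 2 a‖ • e := by
    by_cases h : WithLp.toLp 2 a = 0
    · exact ⟨EuclideanSpace.single 0 1, by simp, by simp [h]⟩
    · exact ⟨‖WithLp.toLp 2 a‖⁻¹ • WithLp.toLp 2 a, by simp [norm_smul, h],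
        by rw [smul_smul, mul_inv_cancel₀ (norm_ne_zero_iff.2 h), one_smul]⟩
  obtain ⟨b, hb⟩ := exists_orthonormalBasis_zero_eq he
  have hinner (x y : EuclideanSpace ℝ (Fin (m + 1))) : inner ℝ x y = x.ofLp ⬝ᵥ y.ofLp := by
    simp [PiLp.inner_apply, dotProduct, mul_comm]
  have hnorm : ‖WithLp.toLp 2 a‖ = √(a ⬝ᵥ a) := by
    rw [← Real.sqrt_sq (norm_nonneg _), ← real_inner_self_eq_norm_sq, hinner]
  refine ⟨Matrix.of fun i => (b i).ofLp, ?_, ?_⟩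
  · ext i j
    rw [Matrix.one_apply, ← orthonormal_iff_ite.1 b.orthonormal i j, hinner]
    rfl
  · funext i
    change (b i).ofLp ⬝ᵥ (WithLp.toLp 2 a).ofLp = _
    rw [← hinner, hae, inner_smul_right, ← hb, orthonormal_iff_ite.1 b.orthonormal, hnorm,
      Pi.single_apply, mul_ite, mul_one, mul_zero]

theorem abs_det_of_mul_transpose_eq_one {ι : Type*} [Fintype ι] [DecidableEq ι]
    {R : Matrix ι ι ℝ} (hR : R * Rᵀ = 1) : |R.det| = 1 := by
  have h := congrArg Matrix.det hR
  rw [Matrix.det_mul, Matrix.det_transpose, Matrix.det_one] at h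
  rcases mul_self_eq_one_iff.1 h with h | h <;> simp [h]

/-- The precision matrix `1 + a aᵀ` is the Gram matrix of the lift `x ↦ (⟨a, x⟩, x)` to the
hyperplane of slope `a`; a whitening is a change of basis that turns it into the identity. -/
def IsWhitening {ι : Type*} [Fintype ι] [DecidableEq ι] (a : ι → ℝ) (M : Matrix ι ι ℝ) : Prop :=
  M * (1 + Matrix.vecMulVec a a) * Mᵀ = 1

theorem exists_isWhitening (a : Fin (m + 1) → ℝ) :
    ∃ M, IsWhitening a M ∧ M *ᵥ a = Pi.single 0 (√(a ⬝ᵥ a) / √(1 + a ⬝ᵥ a)) := by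
  obtain ⟨R, hR, hRa⟩ := exists_rotation a
  have hpos : 0 < 1 + a ⬝ᵥ a := by linarith [dotProduct_self_nonneg a]
  let D : Matrix (Fin (m + 1)) (Fin (m + 1)) ℝ :=
    Matrix.diagonal (Fin.cons (√(1 + a ⬝ᵥ a))⁻¹ fun _ => 1)
  have hconj : R * (1 + Matrix.vecMulVec a a) * Rᵀ =
      Matrix.diagonal (Fin.cons (1 + a ⬝ᵥ a) fun _ => 1) := by
    rw [mul_add, add_mul, mul_one, hR, Matrix.mul_vecMulVec, Matrix.vecMulVec_mul,
      Matrix.vecMul_transpose, hRa]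
    ext i j
    refine Fin.cases ?_ (fun i => ?_) i <;> refine Fin.cases ?_ (fun j => ?_) j <;>
      simp [Matrix.vecMulVec_apply, Matrix.one_apply, Matrix.diagonal_apply,
        Real.mul_self_sqrt (dotProduct_self_nonneg a), Fin.succ_ne_zero, Ne.symm]
  refine ⟨D * R, ?_, ?_⟩
  · have hassoc : D * R * (1 + Matrix.vecMulVec a a) * (D * R)ᵀ =
        D * (R * (1 + Matrix.vecMulVec a a) * Rᵀ) * D := by
      simp only [Matrix.transpose_mul, D, Matrix.diagonal_transpose, Matrix.mul_assoc]
    rw [IsWhitening, hassoc, hconj, Matrix.diagonal_mul_diagonal, Matrix.diagonal_mul_diagonal,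
      ← Matrix.diagonal_one]
    congr 1
    funext i
    refine Fin.cases ?_ (fun i => by simp) i
    simp only [Fin.cons_zero]
    rw [mul_right_comm, ← mul_inv, Real.mul_self_sqrt hpos.le, inv_mul_cancel₀ hpos.ne']
  · rw [← Matrix.mulVec_mulVec, hRa]
    funext i
    refine Fin.cases ?_ (fun i => ?_) i <;>
      simp [D, Matrix.mulVec_diagonal, div_eq_inv_mul, Fin.succ_ne_zero]

namespace IsWhitening

variable {ι : Type*} [Fintype ι] [DecidableEq ι] {a : ι → ℝ} {M : Matrix ι ι ℝ}

theorem det_sq_mul (h : IsWhitening a M) : M.det ^ 2 * (1 + a ⬝ᵥ a) = 1 := by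
  have hdet := congrArg Matrix.det h
  rw [Matrix.det_mul, Matrix.det_mul, Matrix.vecMulVec_eq Unit,
    Matrix.det_one_add_replicateCol_mul_replicateRow, Matrix.det_transpose, Matrix.det_one] at hdet
  linear_combination hdet

theorem det_ne_zero (h : IsWhitening a M) : M.det ≠ 0 := fun h0 => by
  simpa [h0] using h.det_sq_mul

theorem abs_det (h : IsWhitening a M) : |M.det| = (√(1 + a ⬝ᵥ a))⁻¹ := by
  refine eq_inv_of_mul_eq_one_left ?_
  rw [← Real.sqrt_sq_eq_abs, ← Real.sqrt_mul (sq_nonneg _), h.det_sq_mul, Real.sqrt_one]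

theorem dotProduct_add_mul (h : IsWhitening a M) (x y : ι → ℝ) :
    Mᵀ *ᵥ x ⬝ᵥ Mᵀ *ᵥ y + (a ⬝ᵥ Mᵀ *ᵥ x) * (a ⬝ᵥ Mᵀ *ᵥ y) = x ⬝ᵥ y := by
  have hy : M *ᵥ (1 + Matrix.vecMulVec a a) *ᵥ Mᵀ *ᵥ y = y := by
    rw [Matrix.mulVec_mulVec, Matrix.mulVec_mulVec]
    exact (congrArg (· *ᵥ y) h).trans (Matrix.one_mulVec y)
  conv_rhs => rw [← hy, ← Matrix.dotProduct_transpose_mulVec, dotProduct_comm]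
  rw [Matrix.add_mulVec, Matrix.one_mulVec,
    Matrix.vecMulVec_mulVec, dotProduct_add, op_smul_eq_smul, dotProduct_smul, smul_eq_mul,
    dotProduct_comm a (Mᵀ *ᵥ x), mul_comm (a ⬝ᵥ _)]

end IsWhitening

end Whitening

section GaussianMoments

theorem integrable_pow_mul_gaussian (k : ℕ) :
    Integrable fun x : ℝ => x ^ k * Real.exp (-(x * x) / 2) := by
  have h := integrable_rpow_mul_exp_neg_mul_sq (b := 1 / 2) (by norm_num) (s := k)
    (neg_one_lt_zero.trans_le k.cast_nonneg)
  simp only [Real.rpow_natCast] at h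
  exact h.congr (.of_forall fun x => by ring_nf)

theorem integral_gaussian_weight : ∫ x : ℝ, Real.exp (-(x * x) / 2) = √(2 * π) := by
  rw [show 2 * π = π / (1 / 2) by ring, ← integral_gaussian]
  exact integral_congr_ae (.of_forall fun x => by ring_nf)

theorem lintegral_gaussian_weight :
    ∫⁻ x : ℝ, ENNReal.ofReal (Real.exp (-(x * x) / 2)) = ENNReal.ofReal √(2 * π) := by
  rw [← integral_gaussian_weight, ofReal_integral_eq_lintegral_ofReal
    (by simpa using integrable_pow_mul_gaussian 0) (.of_forall fun _ => Real.exp_nonneg _)]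

theorem integral_id_mul_gaussian : ∫ x : ℝ, x * Real.exp (-(x * x) / 2) = 0 := by
  have h := integral_neg_eq_self (fun x : ℝ => x * Real.exp (-(x * x) / 2)) volume
  simp only [neg_mul_neg, neg_mul _ (Real.exp _), integral_neg] at h
  linarith

theorem integral_sq_mul_gaussian :
    ∫ x : ℝ, x * x * Real.exp (-(x * x) / 2) = √(2 * π) := by
  have h := variance_id_gaussianReal (μ := 0) (v := 1)
  simp only [variance_eq_integral aemeasurable_id, id, integral_id_gaussianReal] at h
  simp only [integral_gaussianReal_eq_integral_smul one_ne_zero, gaussianPDFReal, NNReal.coe_one,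
    mul_one, sub_zero, smul_eq_mul, mul_assoc, integral_const_mul] at h
  rw [inv_mul_eq_one₀ (by positivity)] at h
  rw [h]
  exact integral_congr_ae (.of_forall fun x => by ring_nf)

theorem mul_mul_gaussian_eq_prod {n : ℕ} (i j : Fin n) (x : Fin n → ℝ) :
    x i * x j * Real.exp (-(x ⬝ᵥ x) / 2) =
      ∏ l, (if i = l then x l else 1) * (if j = l then x l else 1) *
        Real.exp (-(x l * x l) / 2) := by
  simp only [Finset.prod_mul_distrib, Finset.prod_ite_eq, Finset.mem_univ, if_true]
  rw [← Real.exp_sum, ← Finset.sum_div, Finset.sum_neg_distrib]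
  rfl

theorem integrable_mul_mul_gaussian {n : ℕ} (i j : Fin n) :
    Integrable fun x : Fin n → ℝ => x i * x j * Real.exp (-(x ⬝ᵥ x) / 2) := by
  simp_rw [mul_mul_gaussian_eq_prod]
  have h0 := integrable_pow_mul_gaussian 0
  have h1 := integrable_pow_mul_gaussian 1
  have h2 := integrable_pow_mul_gaussian 2
  simp only [pow_zero, one_mul, pow_one, sq] at h0 h1 h2
  refine Integrable.fintype_prod_dep (f := fun l t => (if i = l then t else 1) *
    (if j = l then t else 1) * Real.exp (-(t * t) / 2)) fun l => ?_
  by_cases hi : i = l <;> by_cases hj : j = l <;> simpa [hi, hj]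

theorem integral_mul_mul_gaussian {n : ℕ} (i j : Fin n) :
    ∫ x : Fin n → ℝ, x i * x j * Real.exp (-(x ⬝ᵥ x) / 2) =
      if i = j then √(2 * π) ^ n else 0 := by
  simp_rw [mul_mul_gaussian_eq_prod]
  rw [integral_fintype_prod_volume_eq_prod (f := fun l t => (if i = l then t else 1) *
    (if j = l then t else 1) * Real.exp (-(t * t) / 2))]
  split_ifs with hij
  · subst hij
    rw [Finset.prod_congr rfl (g := fun _ => √(2 * π)), Finset.prod_const, Finset.card_univ,
      Fintype.card_fin]
    intro l _
    by_cases hi : i = l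
    · simpa [hi] using integral_sq_mul_gaussian
    · simpa [hi] using integral_gaussian_weight
  · refine Finset.prod_eq_zero (Finset.mem_univ i) ?_
    simpa [Ne.symm hij] using integral_id_mul_gaussian

end GaussianMoments

section GaussianDeterminant

variable {m : ℕ}

theorem det_cons (r : Fin (m + 1) → ℝ) (S : Fin m → Fin (m + 1) → ℝ) :
    (Matrix.of (Fin.cons r S)).det = ∑ σ : Equiv.Perm (Fin (m + 1)),
      ((Equiv.Perm.sign σ : ℤ) : ℝ) * (r (σ 0) * ∏ k, S k (σ k.succ)) := by
  rw [← Matrix.det_transpose, Matrix.det_apply']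
  simp only [Matrix.transpose_apply, Matrix.of_apply, Fin.prod_univ_succ, Fin.cons_zero,
    Fin.cons_succ]

theorem det_cons_sq_mul_exp (r : Fin (m + 1) → ℝ) (S : Fin m → Fin (m + 1) → ℝ) :
    (Matrix.of (Fin.cons r S)).det ^ 2 * Real.exp (-(∑ k, S k ⬝ᵥ S k) / 2) =
      ∑ σ : Equiv.Perm (Fin (m + 1)), ∑ τ : Equiv.Perm (Fin (m + 1)),
        ((Equiv.Perm.sign σ * Equiv.Perm.sign τ : ℤ) : ℝ) * (r (σ 0) * r (τ 0)) *
        ∏ k, (S k (σ k.succ) * S k (τ k.succ) * Real.exp (-(S k ⬝ᵥ S k) / 2)) := by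
  have hexp : Real.exp (-(∑ k, S k ⬝ᵥ S k) / 2) = ∏ k, Real.exp (-(S k ⬝ᵥ S k) / 2) := by
    rw [← Real.exp_sum, ← Finset.sum_div, ← Finset.sum_neg_distrib]
  rw [det_cons, sq, Finset.sum_mul_sum, Finset.sum_mul, hexp]
  refine Finset.sum_congr rfl fun σ _ => ?_
  rw [Finset.sum_mul]
  refine Finset.sum_congr rfl fun τ _ => ?_
  rw [Finset.prod_mul_distrib, Finset.prod_mul_distrib, Int.cast_mul]
  ring

theorem perm_ext_of_succ {σ τ : Equiv.Perm (Fin (m + 1))} (h : ∀ k : Fin m, σ k.succ = τ k.succ) :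
    σ = τ := by
  refine Equiv.ext fun i => Fin.cases ?_ h i
  rcases Fin.eq_zero_or_eq_succ (τ.symm (σ 0)) with h0 | ⟨k, hk⟩
  · exact (τ.symm_apply_eq.1 h0)
  · rw [τ.symm_apply_eq, ← h k] at hk
    exact absurd (σ.injective hk).symm (Fin.succ_ne_zero k)

theorem integrable_prod_perm_gaussian (σ τ : Equiv.Perm (Fin (m + 1))) :
    Integrable fun S : Fin m → Fin (m + 1) → ℝ =>
      ∏ k, (S k (σ k.succ) * S k (τ k.succ) * Real.exp (-(S k ⬝ᵥ S k) / 2)) :=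
  Integrable.fintype_prod_dep (f := fun (k : Fin m) (x : Fin (m + 1) → ℝ) =>
    x (σ k.succ) * x (τ k.succ) * Real.exp (-(x ⬝ᵥ x) / 2))
    fun _ => integrable_mul_mul_gaussian _ _

theorem integral_prod_perm_gaussian (σ τ : Equiv.Perm (Fin (m + 1))) :
    ∫ S : Fin m → Fin (m + 1) → ℝ,
      ∏ k, (S k (σ k.succ) * S k (τ k.succ) * Real.exp (-(S k ⬝ᵥ S k) / 2)) =
      if σ = τ then √(2 * π) ^ (m * (m + 1)) else 0 := by
  rw [integral_fintype_prod_volume_eq_prod (f := fun (k : Fin m) (x : Fin (m + 1) → ℝ) =>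
    x (σ k.succ) * x (τ k.succ) * Real.exp (-(x ⬝ᵥ x) / 2))]
  simp_rw [integral_mul_mul_gaussian]
  split_ifs with h
  · simp [h, ← pow_mul, mul_comm]
  · obtain ⟨k, hk⟩ := not_forall.1 (mt perm_ext_of_succ h)
    exact Finset.prod_eq_zero (Finset.mem_univ k) (if_neg hk)

theorem sum_perm_apply_zero (f : Fin (m + 1) → ℝ) :
    ∑ σ : Equiv.Perm (Fin (m + 1)), f (σ 0) = m.factorial * ∑ j, f j := by
  rw [← Equiv.sum_comp Equiv.Perm.decomposeFin.symm, Fintype.sum_prod_type, Finset.mul_sum]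
  simp [Fintype.card_perm]

theorem lintegral_det_cons_sq_gaussian (r : Fin (m + 1) → ℝ) :
    ∫⁻ S : Fin m → Fin (m + 1) → ℝ, ENNReal.ofReal
      ((Matrix.of (Fin.cons r S)).det ^ 2 * Real.exp (-(∑ k, S k ⬝ᵥ S k) / 2)) =
      ENNReal.ofReal (m.factorial * (r ⬝ᵥ r) * √(2 * π) ^ (m * (m + 1))) := by
  have hterm (σ τ : Equiv.Perm (Fin (m + 1))) := (integrable_prod_perm_gaussian σ τ).const_mul
    (((Equiv.Perm.sign σ * Equiv.Perm.sign τ : ℤ) : ℝ) * (r (σ 0) * r (τ 0)))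
  have hsum (σ : Equiv.Perm (Fin (m + 1))) := integrable_finsetSum Finset.univ fun τ _ => hterm σ τ
  rw [← ofReal_integral_eq_lintegral_ofReal _ (.of_forall fun S => by positivity)]
  · congr 1
    simp_rw [det_cons_sq_mul_exp]
    rw [integral_finsetSum _ fun σ _ => hsum σ]
    simp_rw [integral_finsetSum _ fun τ _ => hterm _ τ, integral_const_mul,
      integral_prod_perm_gaussian, mul_ite, mul_zero, Finset.sum_ite_eq, Finset.mem_univ, if_true,
      Int.units_coe_mul_self, Int.cast_one, one_mul]
    rw [← Finset.sum_mul, sum_perm_apply_zero fun j => r j * r j]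
    rfl
  · simp_rw [det_cons_sq_mul_exp]
    exact integrable_finsetSum _ fun σ _ => hsum σ

end GaussianDeterminant

section OneDimensionalIntegrals

theorem lintegral_Ioi_of_hasDerivAt {g g' : ℝ → ℝ} {a l : ℝ}
    (hd : ∀ x ∈ Ici a, HasDerivAt g (g' x) x) (hg : ∀ x ∈ Ioi a, 0 ≤ g' x)
    (hl : Tendsto g atTop (𝓝 l)) :
    ∫⁻ x in Ioi a, ENNReal.ofReal (g' x) = ENNReal.ofReal (l - g a) := by
  rw [← integral_Ioi_of_hasDerivAt_of_nonneg' hd hg hl, ofReal_integral_eq_lintegral_ofReal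
    (integrableOn_Ioi_deriv_of_nonneg' hd hg hl)]
  exact (ae_restrict_iff' measurableSet_Ioi).2 (.of_forall hg)

/-- The radial Gaussian integral `∫₀^∞ s ^ k exp (-s² / 2) ds`, the normalising constant of polar
coordinates in dimension `k + 1`. -/
noncomputable def radialMoment (k : ℕ) : ℝ :=
  ∫ s in Ioi (0 : ℝ), s ^ k * Real.exp (-s ^ 2 / 2)

theorem radialMoment_eq_Gamma (k : ℕ) :
    radialMoment k =
      (1 / 2 : ℝ) ^ (-((k : ℝ) + 1) / 2) * (1 / 2) * Real.Gamma (((k : ℝ) + 1) / 2) := by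
  rw [← integral_rpow_mul_exp_neg_mul_rpow two_pos (by linarith [k.cast_nonneg (α := ℝ)])
    one_half_pos, radialMoment]
  simp_rw [Real.rpow_natCast, Real.rpow_two, neg_mul, one_div_mul_eq_div, neg_div]

theorem radialMoment_pos (k : ℕ) : 0 < radialMoment k := by
  have : 0 < Real.Gamma (((k : ℝ) + 1) / 2) := Real.Gamma_pos_of_pos (by positivity)
  rw [radialMoment_eq_Gamma]
  positivity

theorem lintegral_pow_mul_exp (k : ℕ) :
    ∫⁻ s in Ioi (0 : ℝ), ENNReal.ofReal (s ^ k * Real.exp (-s ^ 2 / 2)) =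
      ENNReal.ofReal (radialMoment k) := by
  have hint : IntegrableOn (fun s : ℝ => s ^ k * Real.exp (-s ^ 2 / 2)) (Ioi 0) :=
    .of_integral_ne_zero (radialMoment_pos k).ne'
  refine (ofReal_integral_eq_lintegral_ofReal hint ?_).symm
  refine (ae_restrict_iff' measurableSet_Ioi).2 (.of_forall fun s hs => ?_)
  have : 0 < s := hs
  positivity

theorem lintegral_pow_mul_exp_comp_mul (k : ℕ) {b : ℝ} (hb : 0 < b) :
    ∫⁻ s in Ioi (0 : ℝ), ENNReal.ofReal (s ^ k * Real.exp (-(b * s) ^ 2 / 2)) =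
      ENNReal.ofReal (b⁻¹ ^ (k + 1) * radialMoment k) := by
  have himage : (fun s : ℝ => b * s) '' Ioi 0 = Ioi 0 := by
    simpa using image_mul_left_Ioi hb 0
  have hchange := lintegral_image_eq_lintegral_abs_deriv_mul (measurableSet_Ioi (a := (0 : ℝ)))
    (fun s _ => by simpa using ((hasDerivAt_id s).const_mul b).hasDerivWithinAt)
    (mul_right_injective₀ hb.ne').injOn
    (fun s => ENNReal.ofReal (s ^ k * Real.exp (-s ^ 2 / 2)))
  rw [himage, lintegral_pow_mul_exp] at hchange
  rw [ENNReal.ofReal_mul (by positivity), hchange, ← lintegral_const_mul' _ _ ENNReal.ofReal_ne_top]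
  refine lintegral_congr fun s => ?_
  rw [← ENNReal.ofReal_mul (abs_nonneg b), ← ENNReal.ofReal_mul (by positivity), abs_of_pos hb]
  congr 1
  rw [inv_pow]
  field_simp
  ring

theorem radialMoment_zero : radialMoment 0 = √(π / 2) := by
  have h := integral_gaussian_Ioi (1 / 2)
  rw [radialMoment]
  convert h using 1
  · congr 1 with s
    ring_nf
  · rw [Real.sqrt_div' _ (by norm_num), Real.sqrt_div' _ (by norm_num),
      Real.sqrt_div' _ (by norm_num)]
    have := Real.mul_self_sqrt (show (0 : ℝ) ≤ 2 by norm_num)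
    field_simp
    rw [Real.sqrt_one]
    linear_combination -this

theorem radialMoment_one : radialMoment 1 = 1 := by
  norm_num [radialMoment_eq_Gamma, Real.rpow_neg_one]

theorem radialMoment_add_two (k : ℕ) : radialMoment (k + 2) = (k + 1) * radialMoment k := by
  simp only [radialMoment_eq_Gamma]
  rw [show (((k + 2 : ℕ) : ℝ) + 1) / 2 = ((k : ℝ) + 1) / 2 + 1 by push_cast; ring,
    show -(((k + 2 : ℕ) : ℝ) + 1) / 2 = -((k : ℝ) + 1) / 2 + (-1) by push_cast; ring,
    Real.Gamma_add_one (by positivity), Real.rpow_add (by norm_num), Real.rpow_neg_one]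
  ring

theorem radialMoment_mul_radialMoment_succ (m : ℕ) :
    radialMoment m * radialMoment (m + 1) = m.factorial * √(π / 2) := by
  induction m with
  | zero => simp [radialMoment_zero, radialMoment_one]
  | succ m ih =>
    rw [radialMoment_add_two, Nat.factorial_succ]
    push_cast
    linear_combination (m + 1 : ℝ) * ih

theorem sqrt_two_mul_pi : √(2 * π) = 2 * √(π / 2) := by
  rw [Real.sqrt_eq_iff_mul_self_eq (by positivity) (by positivity)]
  linear_combination (-4) * Real.mul_self_sqrt (show 0 ≤ π / 2 by positivity)

end OneDimensionalIntegrals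

section CauchySchlomilch

theorem sqrt_sq_add_four_mul {m s : ℝ} (hm : 0 < m) (hs : 0 < s) :
    √((s - m / s) ^ 2 + 4 * m) = s + m / s := by
  rw [Real.sqrt_eq_iff_mul_self_eq (by positivity) (by positivity)]
  field_simp
  ring

theorem image_sub_div {m : ℝ} (hm : 0 < m) : (fun s : ℝ => s - m / s) '' Ioi 0 = univ := by
  refine eq_univ_of_forall fun y => ?_
  have hlt : |y| < √(y ^ 2 + 4 * m) := by
    rw [← Real.sqrt_sq_eq_abs]
    exact Real.sqrt_lt_sqrt (sq_nonneg _) (by linarith)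
  have hpos : 0 < y + √(y ^ 2 + 4 * m) := by linarith [neg_abs_le y]
  refine ⟨(y + √(y ^ 2 + 4 * m)) / 2, half_pos hpos, ?_⟩
  have hsq := Real.sq_sqrt (show 0 ≤ y ^ 2 + 4 * m by positivity)
  dsimp only
  field_simp
  linear_combination hsq

theorem injOn_sub_div {m : ℝ} (hm : 0 < m) : InjOn (fun s : ℝ => s - m / s) (Ioi 0) := by
  intro x hx y hy hxy
  have hx' : 0 < x := hx
  have hy' : 0 < y := hy
  dsimp only at hxy
  have hsum : x + m / x = y + m / y := by
    rw [← sqrt_sq_add_four_mul hm hx', ← sqrt_sq_add_four_mul hm hy', hxy]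
  linarith

theorem hasDerivAt_sub_div (m : ℝ) {s : ℝ} (hs : s ≠ 0) :
    HasDerivAt (fun s => s - m / s) (1 + m / s ^ 2) s := by
  have h := (hasDerivAt_id s).sub ((hasDerivAt_inv hs).const_mul m)
  simp only [div_eq_mul_inv] at h ⊢
  exact h.congr_deriv (by ring)

theorem lintegral_Ioi_comp_div {m : ℝ} (hm : 0 < m) (g : ℝ → ℝ≥0∞) :
    ∫⁻ s in Ioi (0 : ℝ), ENNReal.ofReal (m / s ^ 2) * g (m / s) = ∫⁻ s in Ioi (0 : ℝ), g s := by
  have himage : (fun s : ℝ => m / s) '' Ioi 0 = Ioi 0 := by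
    ext y
    refine ⟨?_, fun hy => ⟨m / y, div_pos hm hy, div_div_cancel₀ hm.ne'⟩⟩
    rintro ⟨s, hs, rfl⟩
    exact div_pos hm hs
  have hderiv (s : ℝ) (hs : s ∈ Ioi (0 : ℝ)) :
      HasDerivWithinAt (fun s : ℝ => m / s) (-(m / s ^ 2)) (Ioi 0) s := by
    have h := (hasDerivAt_inv (ne_of_gt hs)).const_mul m
    simp only [div_eq_mul_inv] at h ⊢
    exact (h.congr_deriv (by ring)).hasDerivWithinAt
  have hinj : InjOn (fun s : ℝ => m / s) (Ioi 0) := by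
    intro x _ y _ hxy
    simpa [div_eq_mul_inv, hm.ne'] using hxy
  have h := lintegral_image_eq_lintegral_abs_deriv_mul measurableSet_Ioi hderiv hinj g
  simpa only [himage, abs_neg, abs_of_pos (div_pos hm (sq_pos_of_pos _)), abs_div, abs_sq,
    abs_of_pos hm] using h.symm

/-- The Cauchy–Schlömilch substitution: the involution `s ↦ m / s` turns the weight `m / s ^ 2` into
`1`, and `1 + m / s ^ 2` is the derivative of `s - m / s`. -/
theorem lintegral_comp_sub_div {m : ℝ} (hm : 0 < m) {f : ℝ → ℝ≥0∞} (hf : Measurable f)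
    (heven : f.Even) : 2 * ∫⁻ s in Ioi (0 : ℝ), f (s - m / s) = ∫⁻ y, f y := by
  have hinvolution : ∫⁻ s in Ioi (0 : ℝ), ENNReal.ofReal (m / s ^ 2) * f (s - m / s) =
      ∫⁻ s in Ioi (0 : ℝ), f (s - m / s) := by
    rw [← lintegral_Ioi_comp_div hm fun s => f (s - m / s)]
    refine setLIntegral_congr_fun measurableSet_Ioi fun s _ => ?_
    rw [div_div_cancel₀ hm.ne', ← heven, neg_sub]
  have h := lintegral_image_eq_lintegral_abs_deriv_mul measurableSet_Ioi
    (fun s hs => (hasDerivAt_sub_div m (ne_of_gt hs)).hasDerivWithinAt) (injOn_sub_div hm) f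
  rw [image_sub_div hm, Measure.restrict_univ] at h
  rw [h, two_mul]
  conv_lhs => arg 2; rw [← hinvolution]
  rw [← lintegral_add_left (by fun_prop)]
  refine setLIntegral_congr_fun measurableSet_Ioi fun s hs => ?_
  have hs' : 0 < s := hs
  rw [abs_of_pos (by positivity), ENNReal.ofReal_add zero_le_one (by positivity),
    ENNReal.ofReal_one, add_mul, one_mul]

theorem lintegral_exp_neg_sq_add_inv_sq {m : ℝ} (hm : 0 ≤ m) :
    ∫⁻ s in Ioi (0 : ℝ), ENNReal.ofReal (Real.exp (-(s ^ 2 + m ^ 2 / s ^ 2) / 2)) =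
      ENNReal.ofReal (√(π / 2) * Real.exp (-m)) := by
  rcases hm.eq_or_lt with rfl | hm
  · simpa [radialMoment_zero] using lintegral_pow_mul_exp 0
  let f : ℝ → ℝ≥0∞ := fun y => ENNReal.ofReal (Real.exp (-(y * y) / 2))
  have hsquare : ∀ s ∈ Ioi (0 : ℝ), ENNReal.ofReal (Real.exp (-(s ^ 2 + m ^ 2 / s ^ 2) / 2)) =
      ENNReal.ofReal (Real.exp (-m)) * f (s - m / s) := by
    intro s hs
    have hs' : s ≠ 0 := ne_of_gt hs
    rw [← ENNReal.ofReal_mul (Real.exp_nonneg _), ← Real.exp_add]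
    congr 2
    field_simp
    ring
  have hhalf : ∫⁻ s in Ioi (0 : ℝ), f (s - m / s) = ENNReal.ofReal √(π / 2) := by
    have h := lintegral_comp_sub_div (f := f) hm (by fun_prop) fun y => by simp [f]
    rw [lintegral_gaussian_weight, sqrt_two_mul_pi, ENNReal.ofReal_mul two_pos.le,
      ENNReal.ofReal_ofNat] at h
    exact (ENNReal.mul_right_inj two_ne_zero ENNReal.ofNat_ne_top).1 h
  rw [setLIntegral_congr_fun measurableSet_Ioi hsquare,
    lintegral_const_mul' _ _ ENNReal.ofReal_ne_top, hhalf, mul_comm,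
    ENNReal.ofReal_mul (Real.sqrt_nonneg _)]

end CauchySchlomilch

section PositiveOrthant

variable {ι : Type*} [Fintype ι]

theorem setLIntegral_Ici_pi_prod {n : ℕ} {f : Fin n → ℝ → ℝ≥0∞} (hf : ∀ i, Measurable (f i)) :
    ∫⁻ x in Ici (0 : Fin n → ℝ), ∏ i, f i (x i) = ∏ i, ∫⁻ y in Ici (0 : ℝ), f i y := by
  rw [← lintegral_indicator measurableSet_Ici]
  simp_rw [← lintegral_indicator (measurableSet_Ici (a := (0 : ℝ)))]
  rw [← lintegral_pi_prod volume fun i => (hf i).indicator measurableSet_Ici]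
  refine lintegral_congr fun x => ?_
  rw [← pi_univ_Ici]
  exact indicator_univ_pi_prod _ _ _

theorem setLIntegral_Ici_comp_add {f : ℝ → ℝ≥0∞} (x : ℝ) :
    ∫⁻ y in Ici (0 : ℝ), f (x + y) = ∫⁻ u in Ici x, f u := by
  rw [← lintegral_indicator measurableSet_Ici, ← lintegral_indicator measurableSet_Ici,
    ← lintegral_add_left_eq_self ((Ici x).indicator f) x]
  refine lintegral_congr fun y => ?_
  simp [indicator]

theorem setLIntegral_Ici_setLIntegral_Ici {f : ℝ → ℝ≥0∞} (hf : Measurable f) :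
    ∫⁻ x in Ici (0 : ℝ), ∫⁻ u in Ici x, f u = ∫⁻ u in Ioi (0 : ℝ), ENNReal.ofReal u * f u := by
  have hmeas : Measurable fun p : ℝ × ℝ => (Ici p.1).indicator f p.2 :=
    (hf.comp measurable_snd).indicator (measurableSet_le measurable_fst measurable_snd)
  simp_rw [← lintegral_indicator (measurableSet_Ici (a := (_ : ℝ))) f]
  rw [lintegral_lintegral_swap hmeas.aemeasurable, ← lintegral_indicator measurableSet_Ioi]
  refine lintegral_congr fun u => ?_
  have hslice : ∀ x, (Ici x).indicator f u = (Iic u).indicator (fun _ => f u) x := fun x => by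
    simp [indicator]
  simp_rw [hslice]
  rw [lintegral_indicator_const measurableSet_Iic, Measure.restrict_apply measurableSet_Iic,
    Iic_inter_Ici, Real.volume_Icc, sub_zero, mul_comm]
  by_cases hu : 0 < u <;> simp_all

theorem setLIntegral_Ici_exp_neg_add_sq :
    ∫⁻ x in Ici (0 : ℝ), ∫⁻ y in Ici (0 : ℝ), ENNReal.ofReal (Real.exp (-(x + y) ^ 2 / 2)) = 1 := by
  simp_rw [setLIntegral_Ici_comp_add (f := fun u => ENNReal.ofReal (Real.exp (-u ^ 2 / 2)))]
  rw [setLIntegral_Ici_setLIntegral_Ici (by fun_prop), ← ENNReal.ofReal_one, ← radialMoment_one,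
    ← lintegral_pow_mul_exp]
  refine setLIntegral_congr_fun measurableSet_Ioi fun u hu => ?_
  rw [← ENNReal.ofReal_mul (le_of_lt hu), pow_one]

theorem setLIntegral_orthants_exp_neg_add_sq (n : ℕ) :
    ∫⁻ r in Ici (0 : Fin n → ℝ), ∫⁻ b in Ici (0 : Fin n → ℝ),
      ENNReal.ofReal (Real.exp (-((r + b) ⬝ᵥ (r + b)) / 2)) = 1 := by
  have hprod : ∀ r b : Fin n → ℝ, ENNReal.ofReal (Real.exp (-((r + b) ⬝ᵥ (r + b)) / 2)) =
      ∏ i, ENNReal.ofReal (Real.exp (-(r i + b i) ^ 2 / 2)) := by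
    intro r b
    rw [← ENNReal.ofReal_prod_of_nonneg fun _ _ => Real.exp_nonneg _, ← Real.exp_sum,
      ← Finset.sum_div, Finset.sum_neg_distrib]
    simp only [dotProduct, Pi.add_apply, sq]
  simp_rw [hprod]
  have hinner : ∀ r : Fin n → ℝ, ∫⁻ b in Ici (0 : Fin n → ℝ),
      ∏ i, ENNReal.ofReal (Real.exp (-(r i + b i) ^ 2 / 2)) =
      ∏ i, ∫⁻ y in Ici (0 : ℝ), ENNReal.ofReal (Real.exp (-(r i + y) ^ 2 / 2)) := fun r =>
    setLIntegral_Ici_pi_prod (f := fun i y => ENNReal.ofReal (Real.exp (-(r i + y) ^ 2 / 2)))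
      fun i => by fun_prop
  have hmeas : Measurable fun x : ℝ =>
      ∫⁻ y in Ici (0 : ℝ), ENNReal.ofReal (Real.exp (-(x + y) ^ 2 / 2)) :=
    Measurable.lintegral_prod_right' (f := fun p : ℝ × ℝ =>
      ENNReal.ofReal (Real.exp (-(p.1 + p.2) ^ 2 / 2))) (by fun_prop)
  simp_rw [hinner]
  rw [setLIntegral_Ici_pi_prod fun _ => hmeas, setLIntegral_Ici_exp_neg_add_sq,
    Finset.prod_const_one]

theorem lintegral_Ioi_one_mul_exp {q : ℝ} (hq : 0 < q) :
    ∫⁻ u in Ioi (1 : ℝ), ENNReal.ofReal (u * q * Real.exp (-(u ^ 2 * q) / 2)) =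
      ENNReal.ofReal (Real.exp (-q / 2)) := by
  have hderiv : ∀ u ∈ Ici (1 : ℝ), HasDerivAt (fun u : ℝ => -Real.exp (-(u ^ 2 * q) / 2))
      (u * q * Real.exp (-(u ^ 2 * q) / 2)) u := by
    intro u _
    have h := (((((hasDerivAt_id u).pow 2).mul_const q).neg.div_const 2).exp).neg
    refine h.congr_deriv ?_
    simp only [Pi.pow_apply, id_eq, Pi.neg_apply, Nat.cast_ofNat, Nat.add_one_sub_one, pow_one,
      mul_one]
    ring
  have hlim : Tendsto (fun u : ℝ => -Real.exp (-(u ^ 2 * q) / 2)) atTop (𝓝 (-0)) := by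
    refine (Real.tendsto_exp_atBot.comp ?_).neg
    exact (tendsto_neg_atTop_atBot.comp ((tendsto_pow_atTop two_ne_zero).atTop_mul_const
      hq)).atBot_div_const two_pos
  rw [lintegral_Ioi_of_hasDerivAt hderiv (fun u hu => ?_) hlim]
  · simp
  · have : (0 : ℝ) < u := zero_lt_one.trans hu
    positivity

theorem lintegral_Ioi_one_inv_pow {n : ℕ} (hn : n ≠ 0) :
    ∫⁻ u in Ioi (1 : ℝ), ENNReal.ofReal (u⁻¹ ^ (n + 1)) = ENNReal.ofReal (n : ℝ)⁻¹ := by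
  have hderiv : ∀ u ∈ Ici (1 : ℝ), HasDerivAt (fun u : ℝ => -((n : ℝ)⁻¹ * u⁻¹ ^ n))
      (u⁻¹ ^ (n + 1)) u := by
    intro u hu
    have hu0 : u ≠ 0 := (zero_lt_one.trans_le hu).ne'
    refine ((((hasDerivAt_inv hu0).fun_pow n).const_mul (n : ℝ)⁻¹).neg).congr_deriv ?_
    obtain ⟨k, rfl⟩ := Nat.exists_eq_succ_of_ne_zero hn
    simp only [Nat.succ_eq_add_one, Nat.add_sub_cancel, inv_pow]
    field_simp
    ring
  have hlim : Tendsto (fun u : ℝ => -((n : ℝ)⁻¹ * u⁻¹ ^ n)) atTop (𝓝 (-((n : ℝ)⁻¹ * 0 ^ n))) :=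
    ((tendsto_inv_atTop_zero.pow n).const_mul _).neg
  rw [lintegral_Ioi_of_hasDerivAt hderiv (fun u hu => ?_) hlim]
  · simp [hn]
  · have : (0 : ℝ) < u := zero_lt_one.trans hu
    positivity

/-- Scaling `x` by `u` and integrating over `u > 1` in the identity
`exp (-q / 2) = ∫₁^∞ u q exp (-u² q / 2) du` expresses one side by the other. -/
theorem setLIntegral_Ici_quadratic_mul_exp [Nonempty ι] {q : (ι → ℝ) → ℝ} (hq : Measurable q)
    (hpos : ∀ x ≠ 0, 0 < q x) (hhom : ∀ (s : ℝ) x, q (s • x) = s ^ 2 * q x) :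
    ∫⁻ x in Ici 0, ENNReal.ofReal (q x * Real.exp (-q x / 2)) =
      Fintype.card ι * ∫⁻ x in Ici 0, ENNReal.ofReal (Real.exp (-q x / 2)) := by
  set Q := ∫⁻ x in Ici 0, ENNReal.ofReal (q x * Real.exp (-q x / 2)) with hQ
  have hscale : ∀ u ∈ Ioi (1 : ℝ), ∫⁻ x in Ici (0 : ι → ℝ),
      ENNReal.ofReal (u * q x * Real.exp (-(u ^ 2 * q x) / 2)) =
      ENNReal.ofReal (u⁻¹ ^ (Fintype.card ι + 1)) * Q := by
    intro u hu
    have hu0 : 0 < u := zero_lt_one.trans hu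
    have hpt : ∀ x, ENNReal.ofReal (u * q (u⁻¹ • x) * Real.exp (-(u ^ 2 * q (u⁻¹ • x)) / 2)) =
        ENNReal.ofReal u⁻¹ * ENNReal.ofReal (q x * Real.exp (-q x / 2)) := by
      intro x
      rw [← ENNReal.ofReal_mul (inv_pos.2 hu0).le, hhom]
      congr 1
      field_simp
    rw [setLIntegral_Ici_comp_smul (inv_pos.2 hu0) (by fun_prop), hQ]
    simp_rw [hpt]
    rw [lintegral_const_mul' _ _ ENNReal.ofReal_ne_top, ← mul_assoc,
      ← ENNReal.ofReal_mul (by positivity), pow_succ]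
  have hlayer : ∫⁻ x in Ici (0 : ι → ℝ), ENNReal.ofReal (Real.exp (-q x / 2)) =
      ∫⁻ x in Ici (0 : ι → ℝ), ∫⁻ u in Ioi (1 : ℝ),
        ENNReal.ofReal (u * q x * Real.exp (-(u ^ 2 * q x) / 2)) :=
    lintegral_congr_ae ((ae_restrict_of_ae (Measure.ae_ne volume 0)).mono fun x hx =>
      (lintegral_Ioi_one_mul_exp (hpos x hx)).symm)
  have hcard : (Fintype.card ι : ℝ) ≠ 0 := by simp
  rw [hlayer, lintegral_lintegral_swap (by fun_prop),
    setLIntegral_congr_fun measurableSet_Ioi hscale, lintegral_mul_const _ (by fun_prop),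
    lintegral_Ioi_one_inv_pow Fintype.card_ne_zero, ← mul_assoc, ← ENNReal.ofReal_natCast,
    ← ENNReal.ofReal_mul (Nat.cast_nonneg _), mul_inv_cancel₀ hcard, ENNReal.ofReal_one, one_mul]

end PositiveOrthant

section SlopeForm

variable {ι : Type*} [Fintype ι]

/-- The squared length of the lift `(⟨a, x⟩, x)` of `x` to the hyperplane of slope `a`, the graph
of `x ↦ ⟨a, x⟩`. -/
def slopeForm (a x : ι → ℝ) : ℝ := x ⬝ᵥ x + (a ⬝ᵥ x) ^ 2

@[fun_prop]
theorem measurable_slopeForm {α : Type*} [MeasurableSpace α] {f g : α → ι → ℝ}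
    (hf : Measurable f) (hg : Measurable g) : Measurable fun x => slopeForm (f x) (g x) := by
  unfold slopeForm
  fun_prop

theorem slopeForm_smul (a : ι → ℝ) (s : ℝ) (x : ι → ℝ) :
    slopeForm a (s • x) = s ^ 2 * slopeForm a x := by
  simp only [slopeForm, smul_dotProduct, dotProduct_smul, smul_eq_mul]
  ring

theorem slopeForm_pos (a : ι → ℝ) {x : ι → ℝ} (hx : x ≠ 0) : 0 < slopeForm a x := by
  have : 0 < x ⬝ᵥ x := (dotProduct_self_nonneg x).lt_of_ne'
    (mt dotProduct_self_eq_zero.1 hx)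
  rw [slopeForm]
  positivity

theorem IsWhitening.slopeForm_mulVec [DecidableEq ι] {a : ι → ℝ} {M : Matrix ι ι ℝ}
    (h : IsWhitening a M) (x : ι → ℝ) : slopeForm a (Mᵀ *ᵥ x) = x ⬝ᵥ x := by
  rw [slopeForm, sq, h.dotProduct_add_mul]

theorem det_of_mulVec [DecidableEq ι] (M : Matrix ι ι ℝ) (Z : ι → ι → ℝ) :
    (Matrix.of fun i => M *ᵥ Z i).det = (Matrix.of Z).det * M.det := by
  rw [← Matrix.det_transpose M, ← Matrix.det_mul]
  congr 1
  ext i j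
  simp [Matrix.mulVec, Matrix.mul_apply, dotProduct, mul_comm]

@[fun_prop]
theorem measurable_det [DecidableEq ι] {α : Type*} [MeasurableSpace α] {f : α → ι → ι → ℝ}
    (hf : Measurable f) : Measurable fun x => (Matrix.of (f x)).det :=
  (Continuous.matrix_det (by fun_prop : Continuous fun Z : ι → ι → ℝ =>
    Matrix.of Z)).measurable.comp hf

theorem radialMoment_mul_weight_mul_exp {n : ℕ} (c r : Fin n → ℝ) :
    ENNReal.ofReal (radialMoment n) *
        ENNReal.ofReal ((√(1 + c ⬝ᵥ c))⁻¹ ^ (n + 1) * Real.exp (-slopeForm c r / 2)) =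
      ∫⁻ s in Ioi (0 : ℝ), ENNReal.ofReal
        (s ^ n * Real.exp (-((1 + c ⬝ᵥ c) * s ^ 2 + slopeForm c r) / 2)) := by
  have hpos : 0 < 1 + c ⬝ᵥ c := by linarith [dotProduct_self_nonneg c]
  rw [← ENNReal.ofReal_mul (radialMoment_pos n).le, ← mul_assoc, mul_comm (radialMoment n),
    ENNReal.ofReal_mul' (Real.exp_nonneg _),
    ← lintegral_pow_mul_exp_comp_mul n (Real.sqrt_pos.2 hpos),
    ← lintegral_mul_const' _ _ ENNReal.ofReal_ne_top]
  refine lintegral_congr fun s => ?_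
  rw [← ENNReal.ofReal_mul' (Real.exp_nonneg _), mul_assoc, ← Real.exp_add, mul_pow,
    Real.sq_sqrt hpos.le]
  ring_nf

theorem setLIntegral_Ici_pow_mul_exp_slopeForm {n : ℕ} (r : Fin n → ℝ) {s : ℝ} (hs : 0 < s) :
    ∫⁻ c in Ici (0 : Fin n → ℝ), ENNReal.ofReal
        (s ^ n * Real.exp (-((1 + c ⬝ᵥ c) * s ^ 2 + slopeForm c r) / 2)) =
      ∫⁻ b in Ici (0 : Fin n → ℝ), ENNReal.ofReal (Real.exp (-(r ⬝ᵥ r + b ⬝ᵥ b) / 2)) *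
        ENNReal.ofReal (Real.exp (-(s ^ 2 + (b ⬝ᵥ r) ^ 2 / s ^ 2) / 2)) := by
  rw [setLIntegral_Ici_comp_smul (inv_pos.2 hs) (by fun_prop), Fintype.card_fin,
    ← lintegral_const_mul' _ _ ENNReal.ofReal_ne_top]
  refine lintegral_congr fun b => ?_
  rw [← ENNReal.ofReal_mul (by positivity), ← ENNReal.ofReal_mul (by positivity), ← mul_assoc,
    ← mul_pow, inv_mul_cancel₀ hs.ne', one_pow, one_mul, ← Real.exp_add]
  congr 2
  simp only [slopeForm, smul_dotProduct, dotProduct_smul, smul_eq_mul]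
  field_simp
  ring

/-- Inserting the radial integral for the weight, scaling `c` by it and integrating it out again by
the Cauchy–Schlömilch substitution makes the exponent linear in `r`. -/
theorem setLIntegral_Ici_weight_mul_exp {n : ℕ} {r : Fin n → ℝ} (hr : 0 ≤ r) :
    ENNReal.ofReal (radialMoment n) * ∫⁻ c in Ici (0 : Fin n → ℝ),
      ENNReal.ofReal ((√(1 + c ⬝ᵥ c))⁻¹ ^ (n + 1) * Real.exp (-slopeForm c r / 2)) =
    ENNReal.ofReal √(π / 2) * ∫⁻ b in Ici (0 : Fin n → ℝ),
      ENNReal.ofReal (Real.exp (-((r + b) ⬝ᵥ (r + b)) / 2)) := by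
  have hremove : ∀ b ∈ Ici (0 : Fin n → ℝ), ∫⁻ s in Ioi (0 : ℝ),
      ENNReal.ofReal (Real.exp (-(r ⬝ᵥ r + b ⬝ᵥ b) / 2)) *
        ENNReal.ofReal (Real.exp (-(s ^ 2 + (b ⬝ᵥ r) ^ 2 / s ^ 2) / 2)) =
      ENNReal.ofReal √(π / 2) * ENNReal.ofReal (Real.exp (-((r + b) ⬝ᵥ (r + b)) / 2)) := by
    intro b hb
    rw [lintegral_const_mul' _ _ ENNReal.ofReal_ne_top,
      lintegral_exp_neg_sq_add_inv_sq (dotProduct_nonneg_of_nonneg hb hr),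
      ← ENNReal.ofReal_mul (Real.exp_nonneg _), mul_left_comm, ← Real.exp_add,
      ENNReal.ofReal_mul (Real.sqrt_nonneg _)]
    congr 3
    rw [dotProduct_add, add_dotProduct, add_dotProduct, dotProduct_comm r b]
    ring
  rw [← lintegral_const_mul' _ _ ENNReal.ofReal_ne_top,
    lintegral_congr fun c => radialMoment_mul_weight_mul_exp c r,
    lintegral_lintegral_swap (by fun_prop), setLIntegral_congr_fun measurableSet_Ioi
      fun s hs => setLIntegral_Ici_pow_mul_exp_slopeForm r hs,
    lintegral_lintegral_swap (by fun_prop), setLIntegral_congr_fun measurableSet_Ici hremove,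
    lintegral_const_mul' _ _ ENNReal.ofReal_ne_top]

theorem setLIntegral_orthants_weight_mul_exp (n : ℕ) :
    ∫⁻ c in Ici (0 : Fin n → ℝ), ∫⁻ r in Ici (0 : Fin n → ℝ),
      ENNReal.ofReal ((√(1 + c ⬝ᵥ c))⁻¹ ^ (n + 1) * Real.exp (-slopeForm c r / 2)) =
      ENNReal.ofReal (√(π / 2) / radialMoment n) := by
  have hradial : ENNReal.ofReal (radialMoment n) ≠ 0 := by simpa using radialMoment_pos n
  rw [lintegral_lintegral_swap (by fun_prop), ENNReal.ofReal_div_of_pos (radialMoment_pos n),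
    ENNReal.eq_div_iff hradial ENNReal.ofReal_ne_top,
    ← lintegral_const_mul' _ _ ENNReal.ofReal_ne_top,
    setLIntegral_congr_fun measurableSet_Ici fun r hr => setLIntegral_Ici_weight_mul_exp hr,
    lintegral_const_mul' _ _ ENNReal.ofReal_ne_top, setLIntegral_orthants_exp_neg_add_sq, mul_one]

end SlopeForm

section RandomSimplex

variable {m : ℕ}

theorem lintegral_det_cons_sq_slopeForm (a r : Fin (m + 1) → ℝ) :
    ∫⁻ S : Fin m → Fin (m + 1) → ℝ, ENNReal.ofReal
        ((Matrix.of (Fin.cons r S)).det ^ 2 * Real.exp (-(∑ k, slopeForm a (S k)) / 2)) =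
      ENNReal.ofReal (m.factorial * √(2 * π) ^ (m * (m + 1)) *
        (√(1 + a ⬝ᵥ a))⁻¹ ^ (m + 2) * slopeForm a r) := by
  obtain ⟨M, hM, -⟩ := exists_isWhitening a
  have hdet : Mᵀ.det ≠ 0 := by simpa using hM.det_ne_zero
  obtain ⟨r, rfl⟩ : ∃ r', Mᵀ *ᵥ r' = r :=
    ⟨Mᵀ⁻¹ *ᵥ r, by
      rw [Matrix.mulVec_mulVec, Matrix.mul_nonsing_inv _ hdet.isUnit, Matrix.one_mulVec]⟩
  have hcons : ∀ S : Fin m → Fin (m + 1) → ℝ,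
      (Matrix.of (Fin.cons (Mᵀ *ᵥ r) fun i => Mᵀ *ᵥ S i)).det =
        (Matrix.of (Fin.cons r S)).det * M.det := by
    intro S
    rw [← Matrix.det_transpose M, ← det_of_mulVec]
    congr 2 with i : 1
    exact Fin.cases rfl (fun _ => rfl) i
  have hmeas : Measurable fun S : Fin m → Fin (m + 1) → ℝ =>
      (Fin.cons (Mᵀ *ᵥ r) S : Fin (m + 1) → Fin (m + 1) → ℝ) :=
    measurable_pi_iff.2 (Fin.cases measurable_const measurable_pi_apply)
  rw [lintegral_comp_mulVec_pi hdet (by fun_prop)]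
  simp_rw [hM.slopeForm_mulVec, hcons, mul_pow, mul_right_comm _ (M.det ^ 2),
    ENNReal.ofReal_mul' (sq_nonneg M.det)]
  rw [lintegral_mul_const' _ _ ENNReal.ofReal_ne_top, lintegral_det_cons_sq_gaussian,
    ← ENNReal.ofReal_mul' (sq_nonneg _), ← ENNReal.ofReal_pow (abs_nonneg _),
    ← ENNReal.ofReal_mul (by positivity), Matrix.det_transpose, ← sq_abs M.det, hM.abs_det,
    Fintype.card_fin]
  congr 1
  ring

theorem setLIntegral_det_sq_slopeForm (a : Fin (m + 1) → ℝ) :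
    ∫⁻ U in {U : Fin (m + 1) → Fin (m + 1) → ℝ | U 0 ∈ Ici 0}, ENNReal.ofReal
        ((Matrix.of U).det ^ 2 * Real.exp (-(∑ k, slopeForm a (U k)) / 2)) =
      ENNReal.ofReal (m.factorial * √(2 * π) ^ (m * (m + 1)) * (m + 1)) *
        ∫⁻ r in Ici (0 : Fin (m + 1) → ℝ), ENNReal.ofReal
          ((√(1 + a ⬝ᵥ a))⁻¹ ^ (m + 2) * Real.exp (-slopeForm a r / 2)) := by
  have hinner : ∀ r : Fin (m + 1) → ℝ, ∫⁻ S : Fin m → Fin (m + 1) → ℝ, ENNReal.ofReal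
        ((Matrix.of (Fin.cons r S)).det ^ 2 *
          Real.exp (-(∑ k, slopeForm a ((Fin.cons r S : Fin (m + 1) → Fin (m + 1) → ℝ) k)) / 2)) =
      ENNReal.ofReal (m.factorial * √(2 * π) ^ (m * (m + 1)) * (√(1 + a ⬝ᵥ a))⁻¹ ^ (m + 2)) *
        ENNReal.ofReal (slopeForm a r * Real.exp (-slopeForm a r / 2)) := by
    intro r
    simp_rw [Fin.sum_univ_succ, Fin.cons_zero, Fin.cons_succ, neg_add, add_div, Real.exp_add,
      mul_left_comm _ (Real.exp (-slopeForm a r / 2)), ENNReal.ofReal_mul (Real.exp_nonneg _)]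
    rw [lintegral_const_mul' _ _ ENNReal.ofReal_ne_top, lintegral_det_cons_sq_slopeForm,
      ← ENNReal.ofReal_mul (Real.exp_nonneg _), ← ENNReal.ofReal_mul (by positivity)]
    congr 1
    ring
  rw [volume_pi, setLIntegral_pi_cons volume (by fun_prop) measurableSet_Ici]
  simp_rw [← volume_pi, hinner, ENNReal.ofReal_mul (pow_nonneg (inv_nonneg.2
    (Real.sqrt_nonneg (1 + a ⬝ᵥ a))) (m + 2))]
  rw [lintegral_const_mul' _ _ ENNReal.ofReal_ne_top, lintegral_const_mul' _ _
    ENNReal.ofReal_ne_top, setLIntegral_Ici_quadratic_mul_exp (by fun_prop)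
    (fun x => slopeForm_pos a) (slopeForm_smul a), Fintype.card_fin, ← mul_assoc, ← mul_assoc,
    ← ENNReal.ofReal_natCast, ← ENNReal.ofReal_mul (by positivity),
    ← ENNReal.ofReal_mul (by positivity)]
  congr 2
  push_cast
  ring

theorem lintegral_slope_det_sq (m : ℕ) :
    ∫⁻ a in Ici (0 : Fin (m + 1) → ℝ),
      ∫⁻ U in {U : Fin (m + 1) → Fin (m + 1) → ℝ | U 0 ∈ Ici 0}, ENNReal.ofReal
        ((Matrix.of U).det ^ 2 * Real.exp (-(∑ k, slopeForm a (U k)) / 2)) =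
      ENNReal.ofReal ((m + 1) * radialMoment m * √(2 * π) ^ (m * (m + 1))) := by
  simp_rw [setLIntegral_det_sq_slopeForm]
  rw [lintegral_const_mul' _ _ ENNReal.ofReal_ne_top, setLIntegral_orthants_weight_mul_exp,
    ← ENNReal.ofReal_mul (by positivity), eq_div_of_mul_eq (radialMoment_pos (m + 1)).ne'
      (radialMoment_mul_radialMoment_succ m)]
  congr 1
  ring

end RandomSimplex

section AlmostEverywhereIndependent

theorem ae_ne_zero_of_countable_lines {E : Type*} [AddCommGroup E] [Module ℝ E]
    [MeasurableSpace E] [MeasurableAdd₂ E] (μ : Measure E) [SFinite μ] [μ.IsAddLeftInvariant]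
    {D : E → ℝ} (hD : Measurable D) (w : E) (hw : Measurable fun t : ℝ => t • w)
    (h : ∀ p, {t : ℝ | D (t • w + p) = 0}.Countable) : ∀ᵐ p ∂μ, D p ≠ 0 := by
  have hzero : MeasurableSet {z : E × ℝ | D (z.2 • w + z.1) = 0} :=
    (by fun_prop : Measurable fun z : E × ℝ => D (z.2 • w + z.1)) (measurableSet_singleton 0)
  have hnull : (μ.prod volume) {z : E × ℝ | D (z.2 • w + z.1) = 0} = 0 :=
    Measure.measure_prod_null_of_ae_null hzero (.of_forall fun p => (h p).measure_zero volume)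
  rw [Measure.prod_apply_symm hzero,
    lintegral_eq_zero_iff (measurable_measure_prodMk_right hzero)] at hnull
  obtain ⟨t, ht⟩ := hnull.exists
  have htranslate : μ ((fun p => t • w + p) ⁻¹' {p | D p = 0}) = 0 := ht
  rw [measure_preimage_add] at htranslate
  simpa [ae_iff] using htranslate

variable {ι κ : Type*} [Fintype ι] [DecidableEq ι] [Fintype κ]

theorem finite_det_add_smul_one_eq_zero (A : Matrix ι ι ℝ) :
    {t : ℝ | (A + t • (1 : Matrix ι ι ℝ)).det = 0}.Finite := by
  refine (Polynomial.finite_setOfPred_isRoot (-A).charpoly_monic.ne_zero).subset fun t ht => ?_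
  change (-A).charpoly.eval t = 0
  rwa [Matrix.eval_charpoly, sub_neg_eq_add, add_comm, Matrix.scalar_apply,
    ← Matrix.smul_one_eq_diagonal]

theorem ae_det_ne_zero {E : Type*} [AddCommGroup E] [Module ℝ E] [MeasurableSpace E]
    [MeasurableAdd₂ E] [MeasurableSMul₂ ℝ E] (μ : Measure E) [SigmaFinite μ]
    [μ.IsAddLeftInvariant] (σ : ι ↪ κ) (L : E →ₗ[ℝ] ι → ℝ) (hLm : Measurable L)
    (hL : Function.Surjective L) :
    ∀ᵐ p ∂(Measure.pi fun _ : κ => μ), (Matrix.of fun i => L (p (σ i))).det ≠ 0 := by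
  choose s hs using fun i : ι => hL (Pi.single i 1)
  refine ae_ne_zero_of_countable_lines _ (by fun_prop) (Function.extend σ s 0)
    (by fun_prop) fun p => ?_
  refine (finite_det_add_smul_one_eq_zero
    (Matrix.of fun i => L (p (σ i)))).countable.mono fun t ht => ?_
  have hdet : (Matrix.of fun i => L ((t • Function.extend σ s 0 + p) (σ i))).det = 0 := ht
  rw [mem_ofPred_eq, ← hdet]
  congr 1
  ext i j
  simp only [Matrix.add_apply, Matrix.of_apply, Matrix.smul_apply, Pi.add_apply, Pi.smul_apply,
    σ.injective.extend_apply, map_add, map_smul, hs, Matrix.one_apply, Pi.single_apply,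
    eq_comm (a := i), add_comm]

end AlmostEverywhereIndependent

section HyperplaneSlope

variable {ι : Type*} [Fintype ι] [DecidableEq ι]

/-- The slope `a` of the hyperplane `{(h, z) | h = ⟨a, z⟩}` of `ℝ × ℝ^d` through the origin and `d`
points; a junk value if the points do not determine such a hyperplane. -/
noncomputable def slope (p : ι → ℝ × (ι → ℝ)) : ι → ℝ :=
  (Matrix.of fun i => (p i).2)⁻¹ *ᵥ fun i => (p i).1

/-- The Gaussian integral over the cone generated by the lifts `(⟨a, Z i⟩, Z i)` of `d` points to
the hyperplane of slope `a`, with respect to Lebesgue measure of that hyperplane, written in the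
coordinates provided by the generators. -/
noncomputable def coneGaussian (a : ι → ℝ) (Z : ι → ι → ℝ) : ℝ≥0∞ :=
  ENNReal.ofReal (√(1 + a ⬝ᵥ a) * |(Matrix.of Z).det|) *
    ∫⁻ c in Ici (0 : ι → ℝ), ENNReal.ofReal (Real.exp (-slopeForm a (∑ i, c i • Z i) / 2))

@[fun_prop]
theorem measurable_slope : Measurable (slope (ι := ι)) := by
  have h : slope (ι := ι) = fun p => ((Matrix.of fun i => (p i).2).det)⁻¹ •
      ((Matrix.of fun i => (p i).2).adjugate *ᵥ fun i => (p i).1) := by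
    funext p
    rw [slope, Matrix.inv_def, Ring.inverse_eq_inv', Matrix.smul_mulVec]
  have hadj : Measurable fun p : ι → ℝ × (ι → ℝ) =>
      (Matrix.of fun i => (p i).2).adjugate *ᵥ fun i => (p i).1 :=
    ((Continuous.matrix_adjugate (by fun_prop : Continuous fun p : ι → ℝ × (ι → ℝ) =>
      Matrix.of fun i => (p i).2)).matrix_mulVec (by fun_prop)).measurable
  rw [h]
  exact (by fun_prop : Measurable fun p : ι → ℝ × (ι → ℝ) =>
    (Matrix.of fun i => (p i).2).det).inv.smul hadj

@[fun_prop]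
theorem measurable_coneGaussian {α : Type*} [MeasurableSpace α] {f : α → ι → ℝ}
    {g : α → ι → ι → ℝ} (hf : Measurable f) (hg : Measurable g) :
    Measurable fun x => coneGaussian (f x) (g x) := by
  unfold coneGaussian
  exact .mul (by fun_prop) (.lintegral_prod_right' (f := fun q : α × (ι → ℝ) => ENNReal.ofReal
    (Real.exp (-slopeForm (f q.1) (∑ i, q.2 i • g q.1 i) / 2))) (by fun_prop))

theorem slope_lift {Z : ι → ι → ℝ} (hZ : (Matrix.of Z).det ≠ 0) (a : ι → ℝ) :
    slope (fun i => (a ⬝ᵥ Z i, Z i)) = a := by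
  have h : (fun i => a ⬝ᵥ Z i) = Matrix.of Z *ᵥ a := funext fun i => dotProduct_comm _ _
  change (Matrix.of Z)⁻¹ *ᵥ (fun i => a ⬝ᵥ Z i) = a
  rw [h, Matrix.mulVec_mulVec, Matrix.nonsing_inv_mul _ hZ.isUnit, Matrix.one_mulVec]

theorem slope_dotProduct {p : ι → ℝ × (ι → ℝ)} (hp : (Matrix.of fun i => (p i).2).det ≠ 0)
    (i : ι) : slope p ⬝ᵥ (p i).2 = (p i).1 := by
  rw [dotProduct_comm]
  change (Matrix.of (fun i => (p i).2) *ᵥ slope p) i = _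
  rw [slope, Matrix.mulVec_mulVec, Matrix.mul_nonsing_inv _ hp.isUnit, Matrix.one_mulVec]

/-- The linear Blaschke–Petkantschin formula in slope coordinates: for fixed second coordinates
`Z`, the first coordinates of the points are the image of the slope under `Z`. -/
theorem lintegral_eq_lintegral_slope {F : (ι → ℝ × (ι → ℝ)) → ℝ≥0∞} (hF : Measurable F) :
    ∫⁻ p, F p = ∫⁻ a : ι → ℝ, ∫⁻ Z : ι → ι → ℝ,
      ENNReal.ofReal |(Matrix.of Z).det| * F fun i => (a ⬝ᵥ Z i, Z i) := by
  have hpair : Measurable fun q : (ι → ℝ) × (ι → ι → ℝ) => F fun i => (q.1 i, q.2 i) := by fun_prop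
  rw [← (volume_measurePreserving_arrowProdEquivProdArrow ℝ (ι → ℝ) ι).symm.lintegral_comp hF,
    Measure.volume_eq_prod]
  refine (lintegral_prod_symm _ hpair.aemeasurable).trans ?_
  conv_rhs => rw [lintegral_lintegral_swap (by fun_prop)]
  have hdet : ∀ᵐ Z : ι → ι → ℝ, (Matrix.of Z).det ≠ 0 :=
    ae_det_ne_zero volume (.refl ι) LinearMap.id measurable_id Function.surjective_id
  refine lintegral_congr_ae (hdet.mono fun Z hZ => ?_)
  have hlift (a : ι → ℝ) : (fun i => ((Matrix.of Z *ᵥ a) i, Z i)) = fun i => (a ⬝ᵥ Z i, Z i) :=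
    funext fun i => congrArg (·, Z i) (dotProduct_comm _ _)
  beta_reduce
  rw [lintegral_comp_mulVec (M := Matrix.of Z) hZ (by fun_prop),
    ← lintegral_const_mul' _ _ ENNReal.ofReal_ne_top]
  simp_rw [hlift]

end HyperplaneSlope

section GaussianCone

theorem measurableSet_forall_nonneg {α ι : Type*} [MeasurableSpace α] [Countable ι] {f : α → ι → ℝ}
    (hf : Measurable f) : MeasurableSet {x | ∀ i, 0 ≤ f x i} :=
  measurableSet_Ici.preimage hf

theorem slopeForm_zero {ι : Type*} [Fintype ι] (x : ι → ℝ) : slopeForm 0 x = x ⬝ᵥ x := by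
  simp [slopeForm]

theorem IsWhitening.coneGaussian_mulVec {ι : Type*} [Fintype ι] [DecidableEq ι] {a : ι → ℝ}
    {M : Matrix ι ι ℝ} (h : IsWhitening a M) (Z : ι → ι → ℝ) :
    coneGaussian a (fun i => Mᵀ *ᵥ Z i) = coneGaussian 0 Z := by
  have hpos : √(1 + a ⬝ᵥ a) ≠ 0 := by
    have := dotProduct_self_nonneg a
    positivity
  simp_rw [coneGaussian, ← Matrix.mulVec_smul, ← Matrix.mulVec_sum, h.slopeForm_mulVec,
    slopeForm_zero, det_of_mulVec, Matrix.det_transpose, abs_mul, h.abs_det]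
  rw [mul_left_comm, mul_inv_cancel₀ hpos]
  simp

variable {m : ℕ}

theorem ofReal_mul_coneGaussian_zero_transpose (U : Fin (m + 1) → Fin (m + 1) → ℝ) :
    ENNReal.ofReal (|(Matrix.of fun i j => U j i).det| *
        Real.exp (-(∑ i, (fun j => U j i) ⬝ᵥ (fun j => U j i)) / 2)) *
      coneGaussian 0 (fun i j => U j i) =
    ∫⁻ c in Ici (0 : Fin (m + 1) → ℝ), ENNReal.ofReal
      ((Matrix.of U).det ^ 2 * Real.exp (-(∑ k, slopeForm c (U k)) / 2)) := by
  have hdet : (Matrix.of fun i j => U j i).det = (Matrix.of U).det := Matrix.det_transpose _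
  have hsum (c : Fin (m + 1) → ℝ) : ∑ i, c i • (fun j => U j i) = fun j => c ⬝ᵥ U j := by
    funext j
    simp [dotProduct]
  have hcol : ∑ i, (fun j => U j i) ⬝ᵥ (fun j => U j i) = ∑ k, U k ⬝ᵥ U k :=
    Finset.sum_comm
  have hform (c : Fin (m + 1) → ℝ) : ∑ k, slopeForm c (U k) =
      ∑ k, U k ⬝ᵥ U k + (fun j => c ⬝ᵥ U j) ⬝ᵥ (fun j => c ⬝ᵥ U j) := by
    simp only [slopeForm, Finset.sum_add_distrib, dotProduct, sq]
  rw [coneGaussian, ← mul_assoc, ← ENNReal.ofReal_mul (by positivity),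
    ← lintegral_const_mul' _ _ ENNReal.ofReal_ne_top]
  refine lintegral_congr fun c => ?_
  rw [← ENNReal.ofReal_mul (by positivity), hdet, hsum, hcol, slopeForm_zero, hform, ← sq_abs,
    neg_add, add_div, Real.exp_add]
  simp only [zero_dotProduct, add_zero, Real.sqrt_one, one_mul]
  ring_nf

theorem setLIntegral_coneGaussian_zero (m : ℕ) :
    ∫⁻ Z in {Z : Fin (m + 1) → Fin (m + 1) → ℝ | ∀ i, 0 ≤ Z i 0},
      ENNReal.ofReal (|(Matrix.of Z).det| * Real.exp (-(∑ i, Z i ⬝ᵥ Z i) / 2)) *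
        coneGaussian 0 Z =
      ENNReal.ofReal ((m + 1) * radialMoment m * √(2 * π) ^ (m * (m + 1))) := by
  classical
  have hset : MeasurableSet {Z : Fin (m + 1) → Fin (m + 1) → ℝ | ∀ i, 0 ≤ Z i 0} :=
    measurableSet_forall_nonneg (by fun_prop)
  have hset₀ : MeasurableSet {U : Fin (m + 1) → Fin (m + 1) → ℝ | U 0 ∈ Ici 0} :=
    measurableSet_Ici.preimage (measurable_pi_apply 0)
  rw [← lintegral_indicator hset, lintegral_comp_transpose (.indicator (by fun_prop) hset),
    ← lintegral_slope_det_sq, ← lintegral_lintegral_swap (by fun_prop),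
    ← lintegral_indicator hset₀]
  refine lintegral_congr fun U => ?_
  rw [indicator_apply, indicator_apply, ofReal_mul_coneGaussian_zero_transpose]
  exact if_congr .rfl rfl rfl

theorem setLIntegral_coneGaussian {a : Fin (m + 1) → ℝ} (ha : a ≠ 0) :
    ∫⁻ Z in {Z : Fin (m + 1) → Fin (m + 1) → ℝ | ∀ i, 0 ≤ a ⬝ᵥ Z i},
      ENNReal.ofReal (|(Matrix.of Z).det| * Real.exp (-(∑ i, slopeForm a (Z i)) / 2)) *
        coneGaussian a Z =
      ENNReal.ofReal ((√(1 + a ⬝ᵥ a))⁻¹ ^ (m + 2) *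
        ((m + 1) * radialMoment m * √(2 * π) ^ (m * (m + 1)))) := by
  classical
  have hset : MeasurableSet {Z : Fin (m + 1) → Fin (m + 1) → ℝ | ∀ i, 0 ≤ a ⬝ᵥ Z i} :=
    measurableSet_forall_nonneg (by fun_prop)
  have hset₀ : MeasurableSet {Z : Fin (m + 1) → Fin (m + 1) → ℝ | ∀ i, 0 ≤ Z i 0} :=
    measurableSet_forall_nonneg (by fun_prop)
  obtain ⟨M, hM, hMa⟩ := exists_isWhitening a
  have hdet : Mᵀ.det ≠ 0 := by simpa using hM.det_ne_zero
  have hpos : 0 < √(a ⬝ᵥ a) / √(1 + a ⬝ᵥ a) := by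
    have := (dotProduct_self_nonneg a).lt_of_ne' (mt dotProduct_self_eq_zero.1 ha)
    positivity
  have hside (z : Fin (m + 1) → ℝ) : 0 ≤ a ⬝ᵥ Mᵀ *ᵥ z ↔ 0 ≤ z 0 := by
    rw [Matrix.dotProduct_transpose_mulVec, hMa, dotProduct_single,
      mul_nonneg_iff_of_pos_right hpos]
  have hwhiten (Z : Fin (m + 1) → Fin (m + 1) → ℝ) :
      {Z : Fin (m + 1) → Fin (m + 1) → ℝ | ∀ i, 0 ≤ a ⬝ᵥ Z i}.indicator (fun Z => ENNReal.ofReal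
        (|(Matrix.of Z).det| * Real.exp (-(∑ i, slopeForm a (Z i)) / 2)) * coneGaussian a Z)
        (fun i => Mᵀ *ᵥ Z i) =
      ENNReal.ofReal (√(1 + a ⬝ᵥ a))⁻¹ *
        {Z : Fin (m + 1) → Fin (m + 1) → ℝ | ∀ i, 0 ≤ Z i 0}.indicator (fun Z =>
          ENNReal.ofReal (|(Matrix.of Z).det| * Real.exp (-(∑ i, Z i ⬝ᵥ Z i) / 2)) *
            coneGaussian 0 Z) Z := by
    simp_rw [indicator_apply, mem_ofPred_eq, hside, mul_ite, mul_zero, hM.slopeForm_mulVec,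
      hM.coneGaussian_mulVec, det_of_mulVec, Matrix.det_transpose, abs_mul, hM.abs_det]
    rw [← mul_assoc, ← ENNReal.ofReal_mul (by positivity), mul_right_comm, mul_comm _ (√_)⁻¹]
  rw [← lintegral_indicator hset,
    lintegral_comp_mulVec_pi hdet (.indicator (by fun_prop) hset), lintegral_congr hwhiten,
    lintegral_const_mul' _ _ ENNReal.ofReal_ne_top, lintegral_indicator hset₀,
    setLIntegral_coneGaussian_zero, Matrix.det_transpose, hM.abs_det,
    ← ENNReal.ofReal_mul (by positivity), ← ENNReal.ofReal_pow (by positivity),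
    ← ENNReal.ofReal_mul (by positivity), Fintype.card_fin]
  congr 1
  ring

end GaussianCone

section HalfGaussian

/-- The normalised half-Gaussian density on `ℝ × ℝ^d`, supported by the closed half-space of points
with nonnegative first coordinate. -/
noncomputable def halfGaussianDensity (d : ℕ) (p : ℝ × (Fin d → ℝ)) : ℝ≥0∞ :=
  (Ici (0 : ℝ)).indicator (fun h => ENNReal.ofReal
    (2 * (√(2 * π))⁻¹ ^ (d + 1) * Real.exp (-(p.2 ⬝ᵥ p.2 + h ^ 2) / 2))) p.1

/-- The distribution of a standard Gaussian point of `ℝ × ℝ^d` conditioned to lie in the closed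
half-space of points with nonnegative first coordinate. -/
noncomputable def halfGaussian (d : ℕ) : Measure (ℝ × (Fin d → ℝ)) :=
  volume.withDensity (halfGaussianDensity d)

@[fun_prop]
theorem measurable_halfGaussianDensity (d : ℕ) : Measurable (halfGaussianDensity d) :=
  Measurable.indicator (f := fun p : ℝ × (Fin d → ℝ) => ENNReal.ofReal
    (2 * (√(2 * π))⁻¹ ^ (d + 1) * Real.exp (-(p.2 ⬝ᵥ p.2 + p.1 ^ 2) / 2)))
    (by fun_prop) (measurableSet_Ici.preimage measurable_fst)

theorem lintegral_gaussian (n : ℕ) :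
    ∫⁻ x : Fin n → ℝ, ENNReal.ofReal (Real.exp (-(x ⬝ᵥ x) / 2)) =
      ENNReal.ofReal (√(2 * π) ^ n) := by
  have h := lintegral_pi_prod (k := n) volume
    (f := fun _ x => ENNReal.ofReal (Real.exp (-(x * x) / 2))) (fun _ => by fun_prop)
  simp only [lintegral_gaussian_weight, Finset.prod_const, Finset.card_univ,
    Fintype.card_fin] at h
  rw [ENNReal.ofReal_pow (Real.sqrt_nonneg _), ← h, volume_pi]
  refine lintegral_congr fun x => ?_
  rw [← ENNReal.ofReal_prod_of_nonneg fun i _ => Real.exp_nonneg _, ← Real.exp_sum,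
    ← Finset.sum_div, Finset.sum_neg_distrib]
  rfl

theorem setLIntegral_Ici_exp_neg_sq :
    ∫⁻ h in Ici (0 : ℝ), ENNReal.ofReal (Real.exp (-h ^ 2 / 2)) =
      ENNReal.ofReal (√(2 * π) / 2) := by
  have h := lintegral_pow_mul_exp 0
  simp only [pow_zero, one_mul, radialMoment_zero] at h
  rw [setLIntegral_congr Ioi_ae_eq_Ici.symm, h, sqrt_two_mul_pi, mul_div_cancel_left₀ _ two_ne_zero]

theorem halfGaussianDensity_eq_mul {d : ℕ} (p : ℝ × (Fin d → ℝ)) :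
    halfGaussianDensity d p = (Ici (0 : ℝ)).indicator (fun h =>
      ENNReal.ofReal (2 * (√(2 * π))⁻¹ ^ (d + 1)) *
        ENNReal.ofReal (Real.exp (-h ^ 2 / 2))) p.1 *
      ENNReal.ofReal (Real.exp (-(p.2 ⬝ᵥ p.2) / 2)) := by
  rw [halfGaussianDensity, ← indicator_mul_const]
  congr 1
  funext h
  rw [← ENNReal.ofReal_mul (by positivity), ← ENNReal.ofReal_mul (by positivity), mul_assoc _
    (Real.exp (-h ^ 2 / 2)), ← Real.exp_add]
  ring_nf

instance isProbabilityMeasure_halfGaussian (d : ℕ) : IsProbabilityMeasure (halfGaussian d) := by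
  refine ⟨?_⟩
  rw [halfGaussian, withDensity_apply _ .univ, setLIntegral_univ, Measure.volume_eq_prod]
  simp_rw [halfGaussianDensity_eq_mul]
  rw [lintegral_prod_mul (f := (Ici (0 : ℝ)).indicator fun h =>
      ENNReal.ofReal (2 * (√(2 * π))⁻¹ ^ (d + 1)) * ENNReal.ofReal (Real.exp (-h ^ 2 / 2)))
      (g := fun z => ENNReal.ofReal (Real.exp (-(z ⬝ᵥ z) / 2)))
      (Measurable.indicator (by fun_prop) measurableSet_Ici).aemeasurable (by fun_prop),
    lintegral_indicator measurableSet_Ici,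
    lintegral_const_mul' _ _ ENNReal.ofReal_ne_top, setLIntegral_Ici_exp_neg_sq,
    lintegral_gaussian, ← ENNReal.ofReal_mul (by positivity), ← ENNReal.ofReal_mul (by positivity),
    ENNReal.ofReal_eq_one, pow_succ, inv_pow]
  field_simp

theorem halfGaussian_absolutelyContinuous (d : ℕ) : halfGaussian d ≪ volume :=
  withDensity_absolutelyContinuous _ _

theorem prod_halfGaussianDensity {d : ℕ} (p : Fin d → ℝ × (Fin d → ℝ)) :
    ∏ i, halfGaussianDensity d (p i) =
      {p : Fin d → ℝ × (Fin d → ℝ) | ∀ i, 0 ≤ (p i).1}.indicator (fun p => ENNReal.ofReal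
        ((2 * (√(2 * π))⁻¹ ^ (d + 1)) ^ d *
          Real.exp (-(∑ i, ((p i).2 ⬝ᵥ (p i).2 + (p i).1 ^ 2)) / 2))) p := by
  by_cases hp : ∀ i, 0 ≤ (p i).1
  · have hdens (i : Fin d) : halfGaussianDensity d (p i) = ENNReal.ofReal
        (2 * (√(2 * π))⁻¹ ^ (d + 1) *
          Real.exp (-((p i).2 ⬝ᵥ (p i).2 + (p i).1 ^ 2) / 2)) :=
      indicator_of_mem (mem_Ici.2 (hp i)) _
    rw [indicator_of_mem (by exact hp), Finset.prod_congr rfl fun i _ => hdens i,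
      ← ENNReal.ofReal_prod_of_nonneg fun i _ => by positivity, Finset.prod_mul_distrib,
      Finset.prod_const, Finset.card_univ, Fintype.card_fin, ← Real.exp_sum, ← Finset.sum_div,
      Finset.sum_neg_distrib]
  · rw [indicator_of_notMem (by exact hp)]
    obtain ⟨i, hi⟩ := not_forall.1 hp
    exact Finset.prod_eq_zero (Finset.mem_univ i) (indicator_of_notMem hi _)

theorem two_mul_inv_pow_mul_pow (m : ℕ) :
    2 * (√(2 * π))⁻¹ ^ (m + 2) * √(2 * π) ^ m = π⁻¹ := by
  have : √(2 * π) ≠ 0 := by positivity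
  rw [pow_add, inv_pow, inv_pow, Real.sq_sqrt (by positivity)]
  field_simp

theorem lintegral_prod_halfGaussianDensity_mul_coneGaussian {m : ℕ}
    {Φ : (Fin (m + 1) → ℝ) → ℝ≥0∞} (hΦ : Measurable Φ) :
    ∫⁻ p : Fin (m + 1) → ℝ × (Fin (m + 1) → ℝ), (∏ i, halfGaussianDensity (m + 1) (p i)) *
      (coneGaussian (slope p) (fun i => (p i).2) * Φ (slope p)) =
    ∫⁻ a, ENNReal.ofReal (radialMoment m * ((m + 1) / π ^ (m + 1)) *
      (√(1 + a ⬝ᵥ a))⁻¹ ^ (m + 2)) * Φ a := by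
  set k : ℝ := (2 * (√(2 * π))⁻¹ ^ (m + 1 + 1)) ^ (m + 1) with hk
  have hpoint (a : Fin (m + 1) → ℝ) (Z : Fin (m + 1) → Fin (m + 1) → ℝ) :
      ENNReal.ofReal |(Matrix.of Z).det| * ((∏ i, halfGaussianDensity (m + 1) (a ⬝ᵥ Z i, Z i)) *
        (coneGaussian (slope fun i => (a ⬝ᵥ Z i, Z i)) Z *
          Φ (slope fun i => (a ⬝ᵥ Z i, Z i)))) =
      ENNReal.ofReal k * Φ a * {Z : Fin (m + 1) → Fin (m + 1) → ℝ | ∀ i, 0 ≤ a ⬝ᵥ Z i}.indicator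
        (fun Z => ENNReal.ofReal (|(Matrix.of Z).det| *
          Real.exp (-(∑ i, slopeForm a (Z i)) / 2)) * coneGaussian a Z) Z := by
    by_cases hZ : (Matrix.of Z).det = 0
    · rw [indicator_apply_eq_zero.2 fun _ => by simp [hZ]]
      simp [hZ]
    rw [slope_lift hZ, prod_halfGaussianDensity]
    by_cases ha : ∀ i, 0 ≤ a ⬝ᵥ Z i
    · rw [indicator_of_mem (by exact ha), indicator_of_mem (by exact ha), ← hk,
        ENNReal.ofReal_mul (abs_nonneg _), ENNReal.ofReal_mul (by positivity)]
      simp only [slopeForm]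
      ring
    · rw [indicator_of_notMem (by exact ha), indicator_of_notMem (by exact ha)]
      simp
  have hconst : k * ((m + 1) * radialMoment m * √(2 * π) ^ (m * (m + 1))) =
      radialMoment m * ((m + 1) / π ^ (m + 1)) := by
    rw [pow_mul, hk, mul_comm, mul_assoc, ← mul_pow, mul_comm (_ ^ m), two_mul_inv_pow_mul_pow]
    ring
  rw [lintegral_eq_lintegral_slope (by fun_prop)]
  refine lintegral_congr_ae ((Measure.ae_ne volume (0 : Fin (m + 1) → ℝ)).mono fun a ha => ?_)
  have hset : MeasurableSet {Z : Fin (m + 1) → Fin (m + 1) → ℝ | ∀ i, 0 ≤ a ⬝ᵥ Z i} :=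
    measurableSet_forall_nonneg (by fun_prop)
  beta_reduce
  rw [lintegral_congr (hpoint a), lintegral_const_mul _ (.indicator (by fun_prop) hset),
    lintegral_indicator hset, setLIntegral_coneGaussian ha, mul_right_comm,
    ← ENNReal.ofReal_mul (by positivity), mul_left_comm k, hconst,
    mul_comm ((√(1 + a ⬝ᵥ a))⁻¹ ^ (m + 2))]

end HalfGaussian

section HalfSpaces

theorem setLIntegral_Ico_zero_mul {b t : ℝ} (ht : 0 < t) (f : ℝ → ℝ≥0∞) :
    ∫⁻ h in Ico 0 (b * t), f h = ENNReal.ofReal t * ∫⁻ s in Ico 0 b, f (t * s) := by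
  have himage : (fun s : ℝ => t * s) '' Ico 0 b = Ico 0 (b * t) := by
    rw [image_mul_left_Ico ht, mul_zero, mul_comm t]
  rw [← himage, lintegral_image_eq_lintegral_abs_deriv_mul measurableSet_Ico
    (fun s _ => by simpa using ((hasDerivAt_id s).const_mul t).hasDerivWithinAt)
    (fun x _ y _ hxy => mul_left_cancel₀ ht.ne' hxy), lintegral_const_mul' _ _
    ENNReal.ofReal_ne_top, abs_of_pos ht]

theorem setLIntegral_Ico_inv_one_add_sq {b : ℝ} (hb : 0 ≤ b) :
    ∫⁻ s in Ico 0 b, ENNReal.ofReal (1 + s ^ 2)⁻¹ = ENNReal.ofReal (Real.arctan b) := by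
  rw [setLIntegral_congr Ico_ae_eq_Ioc, ← ofReal_integral_eq_lintegral_ofReal
    integrable_inv_one_add_sq.integrableOn (.of_forall fun s => by positivity),
    ← intervalIntegral.integral_of_le hb, integral_inv_one_add_sq, Real.arctan_zero, sub_zero]

theorem lintegral_gaussian_wedge {b : ℝ} (hb : 0 ≤ b) :
    ∫⁻ t : ℝ, ENNReal.ofReal (Real.exp (-t ^ 2 / 2)) *
      ∫⁻ h in Ico 0 (b * t), ENNReal.ofReal (Real.exp (-h ^ 2 / 2)) =
    ENNReal.ofReal (Real.arctan b) := by
  have hpolar (t : ℝ) : ENNReal.ofReal (Real.exp (-t ^ 2 / 2)) *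
      ∫⁻ h in Ico 0 (b * t), ENNReal.ofReal (Real.exp (-h ^ 2 / 2)) =
      (Ioi (0 : ℝ)).indicator (fun t => ∫⁻ s in Ico 0 b,
        ENNReal.ofReal (t ^ 1 * Real.exp (-(√(1 + s ^ 2) * t) ^ 2 / 2))) t := by
    rcases lt_or_ge 0 t with ht | ht
    · rw [indicator_of_mem (mem_Ioi.2 ht), setLIntegral_Ico_zero_mul ht, ← mul_assoc,
        ← ENNReal.ofReal_mul (Real.exp_nonneg _), ← lintegral_const_mul' _ _ ENNReal.ofReal_ne_top]
      refine lintegral_congr fun s => ?_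
      rw [← ENNReal.ofReal_mul (by positivity), mul_pow √_, Real.sq_sqrt (by positivity),
        mul_right_comm, ← Real.exp_add]
      ring_nf
    · rw [indicator_of_notMem (notMem_Ioi.2 ht),
        Ico_eq_empty (mul_nonpos_of_nonneg_of_nonpos hb ht).not_gt]
      simp
  have hradial (s : ℝ) : ∫⁻ t in Ioi (0 : ℝ),
      ENNReal.ofReal (t ^ 1 * Real.exp (-(√(1 + s ^ 2) * t) ^ 2 / 2)) =
      ENNReal.ofReal (1 + s ^ 2)⁻¹ := by
    rw [lintegral_pow_mul_exp_comp_mul 1 (by positivity), radialMoment_one, mul_one, inv_pow,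
      Real.sq_sqrt (by positivity)]
  rw [lintegral_congr hpolar, lintegral_indicator measurableSet_Ioi,
    lintegral_lintegral_swap (by fun_prop), lintegral_congr hradial,
    setLIntegral_Ico_inv_one_add_sq hb]

theorem lintegral_gaussian_mul_comp_dotProduct {m : ℕ} (a : Fin (m + 1) → ℝ) {W : ℝ → ℝ≥0∞}
    (hW : Measurable W) :
    ∫⁻ z, ENNReal.ofReal (Real.exp (-(z ⬝ᵥ z) / 2)) * W (a ⬝ᵥ z) =
      ENNReal.ofReal (√(2 * π) ^ m) *
        ∫⁻ t, ENNReal.ofReal (Real.exp (-t ^ 2 / 2)) * W (√(a ⬝ᵥ a) * t) := by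
  obtain ⟨R, hR, hRa⟩ := exists_rotation a
  have hdet : |Rᵀ.det| = 1 := by rw [Matrix.det_transpose, abs_det_of_mul_transpose_eq_one hR]
  have hnorm (w : Fin (m + 1) → ℝ) : Rᵀ *ᵥ w ⬝ᵥ Rᵀ *ᵥ w = w ⬝ᵥ w := by
    rw [Matrix.dotProduct_transpose_mulVec, Matrix.mulVec_mulVec, hR, Matrix.one_mulVec]
  have ha (w : Fin (m + 1) → ℝ) : a ⬝ᵥ Rᵀ *ᵥ w = √(a ⬝ᵥ a) * w 0 := by
    rw [Matrix.dotProduct_transpose_mulVec, hRa, dotProduct_single, mul_comm]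
  have hcons (t : ℝ) (w : Fin m → ℝ) : ENNReal.ofReal (Real.exp (-((Fin.cons t w :
      Fin (m + 1) → ℝ) ⬝ᵥ (Fin.cons t w : Fin (m + 1) → ℝ)) / 2)) =
      ENNReal.ofReal (Real.exp (-(w ⬝ᵥ w) / 2)) * ENNReal.ofReal (Real.exp (-t ^ 2 / 2)) := by
    rw [← ENNReal.ofReal_mul (by positivity), ← Real.exp_add]
    congr 2
    simp only [dotProduct, Fin.sum_univ_succ, Fin.cons_zero, Fin.cons_succ]
    ring
  rw [lintegral_comp_mulVec (M := Rᵀ) (fun h => by simp [h] at hdet) (by fun_prop), hdet,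
    ENNReal.ofReal_one, one_mul]
  simp_rw [hnorm, ha]
  rw [volume_pi, lintegral_pi_cons volume (by fun_prop), ← volume_pi,
    ← lintegral_const_mul' _ _ ENNReal.ofReal_ne_top]
  refine lintegral_congr fun t => ?_
  simp_rw [hcons, Fin.cons_zero, mul_assoc]
  rw [lintegral_mul_const _ (by fun_prop), lintegral_gaussian]

theorem halfGaussian_setOf_lt {m : ℕ} (a : Fin (m + 1) → ℝ) :
    halfGaussian (m + 1) {p | p.1 < a ⬝ᵥ p.2} =
      ENNReal.ofReal (Real.arctan √(a ⬝ᵥ a) / π) := by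
  have hs : MeasurableSet {p : ℝ × (Fin (m + 1) → ℝ) | p.1 < a ⬝ᵥ p.2} :=
    measurableSet_lt (by fun_prop) (by fun_prop)
  set k : ℝ := 2 * (√(2 * π))⁻¹ ^ (m + 1 + 1)
  let W : ℝ → ℝ≥0∞ := fun u => ∫⁻ h in Ico 0 u, ENNReal.ofReal (Real.exp (-h ^ 2 / 2))
  have hW : Measurable W :=
    Monotone.measurable fun _ _ huv => lintegral_mono_set (Ico_subset_Ico_right huv)
  have hfiber (z : Fin (m + 1) → ℝ) : ∫⁻ h, {p : ℝ × (Fin (m + 1) → ℝ) | p.1 < a ⬝ᵥ p.2}.indicator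
      (halfGaussianDensity (m + 1)) (h, z) = ENNReal.ofReal k *
        (ENNReal.ofReal (Real.exp (-(z ⬝ᵥ z) / 2)) * W (a ⬝ᵥ z)) := by
    rw [← lintegral_const_mul' _ _ ENNReal.ofReal_ne_top,
      ← lintegral_const_mul' _ _ ENNReal.ofReal_ne_top, ← lintegral_indicator measurableSet_Ico]
    refine lintegral_congr fun h => ?_
    by_cases h₀ : 0 ≤ h <;> by_cases h₁ : h < a ⬝ᵥ z <;>
      simp [indicator, halfGaussianDensity_eq_mul, h₀, h₁, k, mul_assoc, mul_left_comm, mul_comm]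
  rw [halfGaussian, withDensity_apply _ hs, ← lintegral_indicator hs, Measure.volume_eq_prod,
    lintegral_prod_symm _ (Measurable.indicator (by fun_prop) hs).aemeasurable,
    lintegral_congr hfiber,
    lintegral_const_mul' _ _ ENNReal.ofReal_ne_top, lintegral_gaussian_mul_comp_dotProduct a hW,
    lintegral_gaussian_wedge (Real.sqrt_nonneg _), ← mul_assoc,
    ← ENNReal.ofReal_mul (by positivity), two_mul_inv_pow_mul_pow,
    ← ENNReal.ofReal_mul (by positivity), inv_mul_eq_div]

theorem halfGaussian_setOf_gt {m : ℕ} (a : Fin (m + 1) → ℝ) :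
    halfGaussian (m + 1) {p | a ⬝ᵥ p.2 < p.1} =
      ENNReal.ofReal (1 - Real.arctan √(a ⬝ᵥ a) / π) := by
  have hlt : MeasurableSet {p : ℝ × (Fin (m + 1) → ℝ) | p.1 < a ⬝ᵥ p.2} :=
    measurableSet_lt (by fun_prop) (by fun_prop)
  have heq : MeasurableSet {p : ℝ × (Fin (m + 1) → ℝ) | p.1 = a ⬝ᵥ p.2} :=
    measurableSet_eq_fun (by fun_prop) (by fun_prop)
  have hnull : halfGaussian (m + 1) {p | p.1 = a ⬝ᵥ p.2} = 0 := by
    refine halfGaussian_absolutelyContinuous _ ?_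
    rw [Measure.volume_eq_prod, Measure.prod_apply_symm heq]
    simp
  have hcompl : {p : ℝ × (Fin (m + 1) → ℝ) | a ⬝ᵥ p.2 < p.1} =ᵐ[halfGaussian (m + 1)]
      ({p | p.1 < a ⬝ᵥ p.2}ᶜ : Set _) := by
    filter_upwards [measure_eq_zero_iff_ae_notMem.1 hnull] with p hp
    exact propext (lt_iff_le_and_ne.trans
      ⟨fun h => h.1.not_gt, fun h => ⟨not_lt.1 h, fun h' => hp h'.symm⟩⟩)
  have hangle : 0 ≤ Real.arctan √(a ⬝ᵥ a) / π :=
    div_nonneg (Real.arctan_nonneg.2 (Real.sqrt_nonneg _)) Real.pi_nonneg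
  rw [measure_congr hcompl, prob_compl_eq_one_sub hlt, halfGaussian_setOf_lt,
    ENNReal.ofReal_sub _ hangle, ENNReal.ofReal_one]

end HalfSpaces

section PolarCoordinates

variable {E : Type*} [NormedAddCommGroup E] [NormedSpace ℝ E] [MeasurableSpace E] [BorelSpace E]
  [FiniteDimensional ℝ E] [Nontrivial E] (μ : Measure E) [μ.IsAddHaarMeasure]

theorem lintegral_eq_lintegral_sphere_Ioi {f : E → ℝ≥0∞} (hf : Measurable f) :
    ∫⁻ x, f x ∂μ = ∫⁻ θ : Metric.sphere (0 : E) 1, (∫⁻ r in Ioi (0 : ℝ),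
      ENNReal.ofReal (r ^ (Module.finrank ℝ E - 1)) * f (r • (θ : E))) ∂μ.toSphere := by
  have hne : ({0}ᶜ : Set E) =ᵐ[μ] univ :=
    eventuallyEq_univ.2 (compl_mem_ae_iff.2 (measure_singleton 0))
  have hpolar (x : ({0}ᶜ : Set E)) : f x =
      (fun p : Metric.sphere (0 : E) 1 × Ioi (0 : ℝ) => f ((p.2 : ℝ) • (p.1 : E)))
        (homeomorphUnitSphereProd E x) :=
    congrArg (fun y : ({0}ᶜ : Set E) => f y) ((homeomorphUnitSphereProd E).symm_apply_apply x).symm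
  have hmeas : Measurable fun p : Metric.sphere (0 : E) 1 × Ioi (0 : ℝ) =>
      f ((p.2 : ℝ) • (p.1 : E)) := by fun_prop
  rw [← setLIntegral_univ f, ← setLIntegral_congr hne,
    ← lintegral_subtype_comap (measurableSet_singleton (0 : E)).compl, lintegral_congr hpolar,
    μ.measurePreserving_homeomorphUnitSphereProd.lintegral_comp hmeas,
    lintegral_prod _ hmeas.aemeasurable]
  refine lintegral_congr fun θ => ?_
  rw [Measure.volumeIoiPow, lintegral_withDensity_eq_lintegral_mul _ (by fun_prop) (by fun_prop)]
  exact lintegral_subtype_comap measurableSet_Ioi fun r : ℝ =>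
    ENNReal.ofReal (r ^ (Module.finrank ℝ E - 1)) * f (r • (θ : E))

theorem setLIntegral_comp_norm_of_smul_mem_iff {K : Set E} (hK : MeasurableSet K)
    (hcone : ∀ r : ℝ, 0 < r → ∀ x, r • x ∈ K ↔ x ∈ K) {g : ℝ → ℝ≥0∞} (hg : Measurable g) :
    ∫⁻ x in K, g ‖x‖ ∂μ = μ.toSphere ((↑) ⁻¹' K) *
      ∫⁻ r in Ioi (0 : ℝ), ENNReal.ofReal (r ^ (Module.finrank ℝ E - 1)) * g r := by
  rw [← lintegral_indicator hK,
    lintegral_eq_lintegral_sphere_Ioi μ (Measurable.indicator (by fun_prop) hK), mul_comm,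
    ← lintegral_indicator_const (measurable_subtype_coe hK)]
  refine lintegral_congr fun θ => ?_
  have hray (r : ℝ) (hr : r ∈ Ioi 0) : ENNReal.ofReal (r ^ (Module.finrank ℝ E - 1)) *
      K.indicator (fun x => g ‖x‖) (r • (θ : E)) =
      K.indicator (fun _ => ENNReal.ofReal (r ^ (Module.finrank ℝ E - 1)) * g r) θ := by
    classical
    simp only [indicator_apply, hcone r hr, norm_smul, norm_eq_of_mem_sphere θ,
      Real.norm_of_nonneg (mem_Ioi.1 hr).le, mul_one, mul_ite, mul_zero]
  rw [setLIntegral_congr_fun measurableSet_Ioi hray]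
  by_cases hθ : (θ : E) ∈ K <;> simp [hθ]

end PolarCoordinates

section SlopeDistribution

theorem toSphere_univ_eq_ofReal_omega {d : ℕ} (hd : 0 < d) :
    (volume : Measure (EuclideanSpace ℝ (Fin d))).toSphere univ = ENNReal.ofReal (omega d) := by
  have : Nonempty (Fin d) := ⟨⟨0, hd⟩⟩
  have : 0 < Real.Gamma ((d : ℝ) / 2) := Real.Gamma_pos_of_pos (by positivity)
  have hπ : √π ^ d = π ^ ((d : ℝ) / 2) := by
    rw [Real.sqrt_eq_rpow, ← Real.rpow_natCast, ← Real.rpow_mul Real.pi_nonneg,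
      one_div_mul_eq_div]
  rw [Measure.toSphere_apply_univ, EuclideanSpace.volume_ball, finrank_euclideanSpace,
    Fintype.card_fin, ENNReal.ofReal_one, one_pow, one_mul, ← ENNReal.ofReal_natCast,
    ← ENNReal.ofReal_mul (by positivity), omega, hπ, Real.Gamma_add_one (by positivity)]
  congr 1
  field_simp

theorem omega_pos {d : ℕ} (hd : 0 < d) : 0 < omega d := by
  have : 0 < Real.Gamma ((d : ℝ) / 2) := Real.Gamma_pos_of_pos (by positivity)
  rw [omega]
  positivity

theorem lintegral_comp_sqrt_dotProduct {m : ℕ} {g : ℝ → ℝ≥0∞} (hg : Measurable g) :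
    ∫⁻ a : Fin (m + 1) → ℝ, g √(a ⬝ᵥ a) =
      ENNReal.ofReal (omega (m + 1)) * ∫⁻ r in Ioi (0 : ℝ), ENNReal.ofReal (r ^ m) * g r := by
  have hmp := EuclideanSpace.volume_preserving_symm_measurableEquiv_toLp (Fin (m + 1))
  have hnorm (x : EuclideanSpace ℝ (Fin (m + 1))) :
      √((MeasurableEquiv.toLp 2 (Fin (m + 1) → ℝ)).symm x ⬝ᵥ
        (MeasurableEquiv.toLp 2 (Fin (m + 1) → ℝ)).symm x) = ‖x‖ := by
    rw [EuclideanSpace.norm_eq]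
    simp [dotProduct, sq]
  have hpolar := setLIntegral_comp_norm_of_smul_mem_iff
    (volume : Measure (EuclideanSpace ℝ (Fin (m + 1)))) .univ (by simp) hg
  rw [setLIntegral_univ, preimage_univ, toSphere_univ_eq_ofReal_omega m.succ_pos,
    finrank_euclideanSpace, Fintype.card_fin, Nat.add_sub_cancel] at hpolar
  rw [← hmp.lintegral_comp (by fun_prop), ← hpolar]
  simp_rw [hnorm]

theorem setLIntegral_Ioi_comp_arctan (m : ℕ) (Ψ : ℝ → ℝ≥0∞) :
    ∫⁻ r in Ioi (0 : ℝ), ENNReal.ofReal (r ^ m) *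
      (ENNReal.ofReal ((√(1 + r ^ 2))⁻¹ ^ (m + 2)) * Ψ (Real.arctan r)) =
    ∫⁻ x in Ioo 0 (π / 2), ENNReal.ofReal (Real.sin x ^ m) * Ψ x := by
  have hsub : Ioo 0 (π / 2) ⊆ Ioo (-(π / 2)) (π / 2) :=
    Ioo_subset_Ioo_left (neg_nonpos.2 Real.pi_div_two_pos.le)
  have himage : Real.tan '' Ioo 0 (π / 2) = Ioi 0 := by
    refine Subset.antisymm ?_ fun y hy => ⟨Real.arctan y,
      ⟨Real.arctan_pos.2 hy, Real.arctan_lt_pi_div_two y⟩, Real.tan_arctan y⟩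
    rintro _ ⟨x, hx, rfl⟩
    exact Real.tan_pos_of_pos_of_lt_pi_div_two hx.1 hx.2
  have hcos {x : ℝ} (hx : x ∈ Ioo 0 (π / 2)) : 0 < Real.cos x := Real.cos_pos_of_mem_Ioo (hsub hx)
  rw [← himage, lintegral_image_eq_lintegral_abs_deriv_mul measurableSet_Ioo
    (fun x hx => (Real.hasDerivAt_tan (hcos hx).ne').hasDerivWithinAt)
    (Real.injOn_tan.mono hsub)]
  refine setLIntegral_congr_fun measurableSet_Ioo fun x hx => ?_
  have hc := hcos hx
  have hs : 0 < Real.sin x := Real.sin_pos_of_pos_of_lt_pi hx.1 (by linarith [hx.2, Real.pi_pos])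
  rw [Real.arctan_tan (hsub hx).1 hx.2, Real.inv_sqrt_one_add_tan_sq hc, Real.tan_eq_sin_div_cos,
    abs_of_pos (by positivity), ← mul_assoc, ← mul_assoc, ← ENNReal.ofReal_mul (by positivity),
    ← ENNReal.ofReal_mul (by positivity), div_pow, pow_add]
  congr 2
  field_simp

theorem lintegral_comp_arctan_sqrt_dotProduct {m : ℕ} {Ψ : ℝ → ℝ≥0∞} (hΨ : Measurable Ψ) :
    ∫⁻ a : Fin (m + 1) → ℝ, ENNReal.ofReal ((√(1 + a ⬝ᵥ a))⁻¹ ^ (m + 2)) *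
      Ψ (Real.arctan √(a ⬝ᵥ a)) =
    ENNReal.ofReal (omega (m + 1)) *
      ∫⁻ x in Ioo 0 (π / 2), ENNReal.ofReal (Real.sin x ^ m) * Ψ x := by
  rw [← setLIntegral_Ioi_comp_arctan, ← lintegral_comp_sqrt_dotProduct (by fun_prop)]
  simp_rw [Real.sq_sqrt (dotProduct_self_nonneg _)]

theorem integral_eq_integral_half_add_reflect {f : ℝ → ℝ} (hf : Continuous f) (b : ℝ) :
    ∫ x in (0)..b, f x = ∫ x in (0)..(b / 2), (f x + f (b - x)) := by
  have hreflect : Continuous fun x => f (b - x) := by fun_prop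
  rw [intervalIntegral.integral_add (hf.intervalIntegrable _ _) (hreflect.intervalIntegrable _ _),
    intervalIntegral.integral_comp_sub_left f b, sub_zero, sub_half,
    intervalIntegral.integral_add_adjacent_intervals (hf.intervalIntegrable _ _)
      (hf.intervalIntegrable _ _)]

theorem setLIntegral_sin_pow_mul_add_pow (m k : ℕ) :
    ∫⁻ x in Ioo 0 (π / 2), ENNReal.ofReal (Real.sin x ^ m) *
      (ENNReal.ofReal (1 - x / π) ^ k + ENNReal.ofReal (x / π) ^ k) =
    ENNReal.ofReal (∫ x in (0)..π, (1 - x / π) ^ k * Real.sin x ^ m) := by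
  set f : ℝ → ℝ := fun x => (1 - x / π) ^ k * Real.sin x ^ m with hf
  have hreflect (x : ℝ) : f x + f (π - x) =
      Real.sin x ^ m * ((1 - x / π) ^ k + (x / π) ^ k) := by
    simp only [hf, Real.sin_pi_sub, sub_div, div_self Real.pi_ne_zero, sub_sub_cancel]
    ring
  have hnonneg {x : ℝ} (hx : x ∈ Ioo 0 (π / 2)) :
      0 ≤ Real.sin x ^ m ∧ 0 ≤ 1 - x / π ∧ 0 ≤ x / π := by
    have hπ : x ≤ π := by linarith [hx.2, Real.pi_pos]
    exact ⟨pow_nonneg (Real.sin_nonneg_of_nonneg_of_le_pi hx.1.le hπ) m,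
      sub_nonneg.2 ((div_le_one Real.pi_pos).2 hπ), div_nonneg hx.1.le Real.pi_nonneg⟩
  have hcont : Continuous fun x => Real.sin x ^ m * ((1 - x / π) ^ k + (x / π) ^ k) := by fun_prop
  rw [integral_eq_integral_half_add_reflect (f := f) (by fun_prop),
    intervalIntegral.integral_congr fun x _ => hreflect x,
    intervalIntegral.integral_of_le Real.pi_div_two_pos.le, integral_Ioc_eq_integral_Ioo,
    ofReal_integral_eq_lintegral_ofReal
    (hcont.integrableOn_Ioc.mono_set Ioo_subset_Ioc_self)
    (ae_restrict_of_forall_mem measurableSet_Ioo fun x hx => ?_)]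
  · refine setLIntegral_congr_fun measurableSet_Ioo fun x hx => ?_
    obtain ⟨hs, h₁, h₂⟩ := hnonneg hx
    rw [ENNReal.ofReal_mul hs, ENNReal.ofReal_add (by positivity) (by positivity),
      ENNReal.ofReal_pow h₁, ENNReal.ofReal_pow h₂]
  · obtain ⟨hs, h₁, h₂⟩ := hnonneg hx
    exact mul_nonneg hs (by positivity)

end SlopeDistribution

section ExpectedFacetContent

variable {ι κ : Type*} [Fintype ι]

/-- All the points of the family `w` lie strictly on the same side of the hyperplane of slope `a`
through the origin of `ℝ × ℝ^ι`. -/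
def OneSided (a : ι → ℝ) (w : κ → ℝ × (ι → ℝ)) : Prop :=
  (∀ j, a ⬝ᵥ (w j).2 < (w j).1) ∨ ∀ j, (w j).1 < a ⬝ᵥ (w j).2

open Classical in
/-- The Gaussian content of the cone spanned by the points `u` if that cone is a facet of the cone
spanned by the points `u` and `w` together, and `0` otherwise. -/
noncomputable def facetContent [DecidableEq ι] (u : ι → ℝ × (ι → ℝ)) (w : κ → ℝ × (ι → ℝ)) : ℝ≥0∞ :=
  if OneSided (slope u) w then coneGaussian (slope u) (fun i => (u i).2) else 0

theorem measurableSet_oneSided [Countable κ] :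
    MeasurableSet {x : (ι → ℝ) × (κ → ℝ × (ι → ℝ)) | OneSided x.1 x.2} := by
  simp only [OneSided, ofPred_or, ofPred_forall]
  exact (MeasurableSet.iInter fun j => measurableSet_lt (by fun_prop) (by fun_prop)).union
    (MeasurableSet.iInter fun j => measurableSet_lt (by fun_prop) (by fun_prop))

theorem measurable_facetContent [DecidableEq ι] [Countable κ] :
    Measurable fun x : (ι → ℝ × (ι → ℝ)) × (κ → ℝ × (ι → ℝ)) => facetContent x.1 x.2 := by
  have hslope : Measurable fun x : (ι → ℝ × (ι → ℝ)) × (κ → ℝ × (ι → ℝ)) => (slope x.1, x.2) := by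
    fun_prop
  exact Measurable.ite (hslope measurableSet_oneSided) (by fun_prop) measurable_const

theorem pi_halfGaussian_oneSided {m : ℕ} [Fintype κ] [Nonempty κ] (a : Fin (m + 1) → ℝ) :
    (Measure.pi fun _ : κ => halfGaussian (m + 1)) {w | OneSided a w} =
      ENNReal.ofReal (1 - Real.arctan √(a ⬝ᵥ a) / π) ^ Fintype.card κ +
        ENNReal.ofReal (Real.arctan √(a ⬝ᵥ a) / π) ^ Fintype.card κ := by
  have hmeas : MeasurableSet {p : ℝ × (Fin (m + 1) → ℝ) | p.1 < a ⬝ᵥ p.2} :=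
    measurableSet_lt (by fun_prop) (by fun_prop)
  have hunion : {w : κ → ℝ × (Fin (m + 1) → ℝ) | OneSided a w} =
      (univ.pi fun _ => {p | a ⬝ᵥ p.2 < p.1}) ∪ univ.pi fun _ => {p | p.1 < a ⬝ᵥ p.2} := by
    ext w
    simp [OneSided]
  have hdisj : Disjoint (univ.pi fun _ : κ => {p : ℝ × (Fin (m + 1) → ℝ) | a ⬝ᵥ p.2 < p.1})
      (univ.pi fun _ : κ => {p | p.1 < a ⬝ᵥ p.2}) :=
    disjoint_left.2 fun w hgt hlt =>
      lt_asymm (mem_ofPred.1 (hgt (Classical.arbitrary κ) trivial))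
        (mem_ofPred.1 (hlt (Classical.arbitrary κ) trivial))
  rw [hunion, measure_union hdisj (.univ_pi fun _ => hmeas), Measure.pi_pi, Measure.pi_pi]
  simp only [halfGaussian_setOf_gt, halfGaussian_setOf_lt, Finset.prod_const, Finset.card_univ]

theorem lintegral_pi_halfGaussian_coneGaussian {m : ℕ} {Φ : (Fin (m + 1) → ℝ) → ℝ≥0∞}
    (hΦ : Measurable Φ) :
    ∫⁻ u : Fin (m + 1) → ℝ × (Fin (m + 1) → ℝ), coneGaussian (slope u) (fun i => (u i).2) *
      Φ (slope u) ∂(Measure.pi fun _ => halfGaussian (m + 1)) =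
    ∫⁻ a, ENNReal.ofReal (radialMoment m * ((m + 1) / π ^ (m + 1)) *
      (√(1 + a ⬝ᵥ a))⁻¹ ^ (m + 2)) * Φ a := by
  have : SigmaFinite (volume.withDensity (halfGaussianDensity (m + 1))) :=
    inferInstanceAs (SigmaFinite (halfGaussian (m + 1)))
  unfold halfGaussian
  rw [← lintegral_prod_halfGaussianDensity_mul_coneGaussian hΦ,
    pi_withDensity _ (measurable_halfGaussianDensity (m + 1)),
    lintegral_withDensity_eq_lintegral_mul _ (by fun_prop) (by fun_prop)]
  rfl

theorem lintegral_facetContent {m : ℕ} [Fintype κ] [Nonempty κ] :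
    ∫⁻ u : Fin (m + 1) → ℝ × (Fin (m + 1) → ℝ), ∫⁻ w : κ → ℝ × (Fin (m + 1) → ℝ),
      facetContent u w ∂(Measure.pi fun _ => halfGaussian (m + 1))
        ∂(Measure.pi fun _ => halfGaussian (m + 1)) =
      ENNReal.ofReal (radialMoment m * ((m + 1) / π ^ (m + 1) * omega (m + 1) *
        ∫ x in (0)..π, (1 - x / π) ^ Fintype.card κ * Real.sin x ^ m)) := by
  have hconst : 0 ≤ radialMoment m * ((m + 1) / π ^ (m + 1)) :=
    mul_nonneg (radialMoment_pos m).le (by positivity)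
  have hinner (u : Fin (m + 1) → ℝ × (Fin (m + 1) → ℝ)) :
      ∫⁻ w : κ → ℝ × (Fin (m + 1) → ℝ), facetContent u w
        ∂(Measure.pi fun _ => halfGaussian (m + 1)) =
      coneGaussian (slope u) (fun i => (u i).2) *
        (ENNReal.ofReal (1 - Real.arctan √(slope u ⬝ᵥ slope u) / π) ^ Fintype.card κ +
          ENNReal.ofReal (Real.arctan √(slope u ⬝ᵥ slope u) / π) ^ Fintype.card κ) := by
    have hms : MeasurableSet {w : κ → ℝ × (Fin (m + 1) → ℝ) | OneSided (slope u) w} :=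
      measurable_prodMk_left measurableSet_oneSided
    rw [← pi_halfGaussian_oneSided, ← lintegral_indicator_const hms]
    classical
    exact lintegral_congr fun w => by simp [facetContent, indicator_apply]
  rw [lintegral_congr hinner, lintegral_pi_halfGaussian_coneGaussian
    (Φ := fun a => ENNReal.ofReal (1 - Real.arctan √(a ⬝ᵥ a) / π) ^ Fintype.card κ +
      ENNReal.ofReal (Real.arctan √(a ⬝ᵥ a) / π) ^ Fintype.card κ) (by fun_prop)]
  simp_rw [ENNReal.ofReal_mul hconst, mul_assoc (ENNReal.ofReal (_ * _))]
  rw [lintegral_const_mul' _ _ ENNReal.ofReal_ne_top, lintegral_comp_arctan_sqrt_dotProduct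
    (Ψ := fun x => ENNReal.ofReal (1 - x / π) ^ Fintype.card κ +
      ENNReal.ofReal (x / π) ^ Fintype.card κ) (by fun_prop),
    setLIntegral_sin_pow_mul_add_pow, ← ENNReal.ofReal_mul (omega_pos m.succ_pos).le,
    ← ENNReal.ofReal_mul hconst]
  congr 1
  ring

theorem measurePreserving_comp_prod_restrict {α : Type*} [MeasurableSpace α] [Fintype κ]
    (ν : Measure α) [SigmaFinite ν] {P : κ → Prop} [DecidablePred P] (e : ι ≃ {j // P j}) :
    MeasurePreserving (fun p : κ → α => (fun i => p (e i), fun j : {j // ¬P j} => p j))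
      (Measure.pi fun _ => ν) ((Measure.pi fun _ => ν).prod (Measure.pi fun _ => ν)) :=
  ((measurePreserving_piCongrLeft (fun _ : {j // P j} => ν) e).symm.prod
    (.id (Measure.pi fun _ : {j // ¬P j} => ν))).comp
      (measurePreserving_piEquivPiSubtypeProd (fun _ : κ => ν) P)

end ExpectedFacetContent

section Cones

section Module

variable {E ι : Type*} [AddCommGroup E] [Module ℝ E]

theorem smul_mem_hull {s : Set E} {r : ℝ} (hr : 0 ≤ r) {x : E} (hx : x ∈ PointedCone.hull ℝ s) :
    r • x ∈ PointedCone.hull ℝ s :=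
  Submodule.smul_mem _ (⟨r, hr⟩ : {c : ℝ // 0 ≤ c}) hx

theorem smul_mem_hull_iff {s : Set E} {r : ℝ} (hr : 0 < r) {x : E} :
    r • x ∈ PointedCone.hull ℝ s ↔ x ∈ PointedCone.hull ℝ s :=
  ⟨fun h => inv_smul_smul₀ hr.ne' x ▸ smul_mem_hull (inv_pos.2 hr).le h, smul_mem_hull hr.le⟩

theorem hull_range_smul {v : ι → E} {r : ι → ℝ} (hr : ∀ i, 0 < r i) :
    PointedCone.hull ℝ (range fun i => r i • v i) = PointedCone.hull ℝ (range v) := by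
  apply le_antisymm <;> refine Submodule.span_le.2 (range_subset_iff.2 fun i => ?_)
  · exact smul_mem_hull (hr i).le (Submodule.subset_span ⟨i, rfl⟩)
  · exact (smul_mem_hull_iff (hr i)).1 (Submodule.subset_span ⟨i, rfl⟩)

theorem sum_smul_mem_hull_iff [Fintype ι] {w : ι → E} (hw : LinearIndependent ℝ w) (c : ι → ℝ) :
    ∑ i, c i • w i ∈ PointedCone.hull ℝ (range w) ↔ 0 ≤ c := by
  rw [PointedCone.hull, Submodule.mem_span_range_iff_exists_fun]
  constructor
  · rintro ⟨c', h⟩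
    have hc : (fun i => (c' i : ℝ)) = c :=
      hw.fintypeLinearCombination_injective (by simpa [Fintype.linearCombination_apply] using h)
    exact hc ▸ fun i => (c' i).2
  · exact fun h => ⟨fun i => ⟨c i, h i⟩, rfl⟩

end Module

section Inner

variable {E : Type*} [NormedAddCommGroup E] [InnerProductSpace ℝ E] {u : E} {s : Set E}

theorem inner_nonpos_of_mem_hull (h : ∀ y ∈ s, inner ℝ u y ≤ 0) {x : E}
    (hx : x ∈ PointedCone.hull ℝ s) : inner ℝ u x ≤ 0 := by
  induction hx using Submodule.span_induction with
  | mem y hy => exact h y hy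
  | zero => simp
  | add y z _ _ hy hz => rw [inner_add_right]; linarith
  | smul c y _ hy =>
    change inner ℝ u ((c : ℝ) • y) ≤ 0
    rw [real_inner_smul_right]
    exact mul_nonpos_of_nonneg_of_nonpos c.2 hy

theorem inner_eq_zero_of_mem_hull (h : ∀ y ∈ s, inner ℝ u y = 0) {x : E}
    (hx : x ∈ PointedCone.hull ℝ s) : inner ℝ u x = 0 := by
  have hneg := inner_nonpos_of_mem_hull (u := -u) (fun y hy => by simp [h y hy]) hx
  rw [inner_neg_left] at hneg
  exact le_antisymm (inner_nonpos_of_mem_hull (fun y hy => (h y hy).le) hx) (by linarith)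

theorem mem_hull_face_iff (h : ∀ y ∈ s, inner ℝ u y ≤ 0) {x : E} :
    x ∈ PointedCone.hull ℝ {y ∈ s | inner ℝ u y = 0} ↔
      x ∈ PointedCone.hull ℝ s ∧ inner ℝ u x = 0 := by
  refine ⟨fun hx => ⟨Submodule.span_mono (sep_subset _ _) hx,
    inner_eq_zero_of_mem_hull (fun y hy => hy.2) hx⟩, ?_⟩
  rintro ⟨hx, h0⟩
  induction hx using Submodule.span_induction with
  | mem y hy => exact Submodule.subset_span ⟨hy, h0⟩
  | zero => exact zero_mem _
  | add y z hy hz ihy ihz =>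
    rw [inner_add_right] at h0
    have hy' := inner_nonpos_of_mem_hull h hy
    have hz' := inner_nonpos_of_mem_hull h hz
    exact add_mem (ihy (by linarith)) (ihz (by linarith))
  | smul c y _ ihy =>
    change inner ℝ u ((c : ℝ) • y) = 0 at h0
    change (c : ℝ) • y ∈ _
    rcases mul_eq_zero.1 (real_inner_smul_right u y c ▸ h0) with hc | hy
    · rw [hc, zero_smul]
      exact zero_mem _
    · exact smul_mem_hull c.2 (ihy hy)

end Inner

end Cones

section Facets

variable {d : ℕ} {ι : Type*} {v : ι → Ambient d}

/-- The vectors with index in `I` span a facet of the cone generated by the family `v`: some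
hyperplane through the origin contains them and has all the other vectors strictly on one side. -/
def Supports (v : ι → Ambient d) (I : Finset ι) : Prop :=
  ∃ u : Ambient d, (∀ i ∈ I, inner ℝ u (v i) = 0) ∧ ∀ j ∉ I, inner ℝ u (v j) < 0

/-- General position with respect to hyperplanes through the origin: at most `d + 1` of the vectors
of `ℝ^{d+1}` are always linearly independent. -/
def GeneralPosition (v : ι → Ambient d) : Prop :=
  ∀ J : Finset ι, J.card ≤ d + 1 → LinearIndepOn ℝ v (J : Set ι)

theorem inv_norm_smul_mem_sphere {x : Ambient d} (hx : x ≠ 0) : ‖x‖⁻¹ • x ∈ Sph d := by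
  rw [mem_sphere_zero_iff_norm, norm_smul, norm_inv, norm_norm,
    inv_mul_cancel₀ (norm_ne_zero_iff.2 hx)]

theorem inv_norm_smul_mem_sphericalHull {s : Set (Ambient d)} {x : Ambient d} (hx : x ∈ s)
    (h0 : x ≠ 0) : ‖x‖⁻¹ • x ∈ sphericalHull s :=
  ⟨inv_norm_smul_mem_sphere h0, smul_mem_hull (by positivity) (Submodule.subset_span hx)⟩

theorem span_sphericalHull {s : Set (Ambient d)} (hs : (0 : Ambient d) ∉ s) :
    Submodule.span ℝ (sphericalHull s) = Submodule.span ℝ s := by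
  refine le_antisymm (Submodule.span_le.2 fun x hx => PointedCone.hull_le_span (R := ℝ) s hx.2)
    (Submodule.span_le.2 fun x hx => ?_)
  have h0 : x ≠ 0 := fun h => hs (h ▸ hx)
  have hmem := Submodule.smul_mem _ ‖x‖
    (Submodule.subset_span (R := ℝ) (inv_norm_smul_mem_sphericalHull hx h0))
  rwa [smul_inv_smul₀ (norm_ne_zero_iff.2 h0)] at hmem

theorem sphericalHull_face {u : Ambient d} {I : Finset ι} (hI : ∀ i ∈ I, inner ℝ u (v i) = 0)
    (hJ : ∀ j ∉ I, inner ℝ u (v j) < 0) :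
    {x ∈ sphericalHull (range v) | inner ℝ u x = 0} = sphericalHull (v '' I) := by
  have hle : ∀ y ∈ range v, inner ℝ u y ≤ 0 := by
    rintro _ ⟨i, rfl⟩
    by_cases hi : i ∈ I
    exacts [(hI i hi).le, (hJ i hi).le]
  have himage : v '' I = {y ∈ range v | inner ℝ u y = 0} := by
    ext y
    constructor
    · rintro ⟨i, hi, rfl⟩
      exact ⟨⟨i, rfl⟩, hI i hi⟩
    · rintro ⟨⟨i, rfl⟩, hi⟩
      exact ⟨i, by_contra fun h => (hJ i h).ne hi, rfl⟩
  ext x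
  simp only [sphericalHull, himage, mem_inter_iff, SetLike.mem_coe, mem_hull_face_iff hle,
    mem_ofPred_eq, and_assoc]

namespace GeneralPosition

theorem ne_zero (hv : GeneralPosition v) (i : ι) : v i ≠ 0 :=
  (hv {i} (by simp)).ne_zero (by simp)

theorem zero_notMem_image (hv : GeneralPosition v) (s : Set ι) : (0 : Ambient d) ∉ v '' s := by
  rintro ⟨i, -, hi⟩
  exact hv.ne_zero i hi

theorem finrank_span (hv : GeneralPosition v) {J : Finset ι} (hJ : J.card ≤ d + 1) :
    Module.finrank ℝ (Submodule.span ℝ (v '' J)) = J.card := by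
  rw [image_eq_range]
  simpa using finrank_span_eq_card (hv J hJ)

theorem card_eq_of_finrank_span_eq (hv : GeneralPosition v) {I : Finset ι}
    (hI : Module.finrank ℝ (Submodule.span ℝ (v '' I)) = d) : I.card = d := by
  rcases le_or_gt I.card (d + 1) with hcard | hcard
  · rw [← hv.finrank_span hcard, hI]
  · obtain ⟨J, hJI, hJ⟩ := Finset.exists_subset_card_eq hcard.le
    have hmono : Module.finrank ℝ (Submodule.span ℝ (v '' J)) ≤
        Module.finrank ℝ (Submodule.span ℝ (v '' I)) :=
      Submodule.finrank_mono (Submodule.span_mono (image_mono (by exact_mod_cast hJI)))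
    have := hv.finrank_span hJ.le
    omega

theorem isFacet (hv : GeneralPosition v) {I : Finset ι} (hI : I.card = d) (hs : Supports v I) :
    IsFacet (sphericalHull (range v)) (sphericalHull (v '' I)) := by
  obtain ⟨u, h_zero, h_neg⟩ := hs
  refine ⟨⟨u, fun x hx => inner_nonpos_of_mem_hull ?_ hx.2,
    (sphericalHull_face h_zero h_neg).symm⟩, ?_⟩
  · rintro _ ⟨i, rfl⟩
    by_cases hi : i ∈ I
    exacts [(h_zero i hi).le, (h_neg i hi).le]
  · rw [span_sphericalHull (hv.zero_notMem_image _), hv.finrank_span (by omega), hI]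

theorem exists_of_isFacet [Finite ι] (hv : GeneralPosition v) {F : Set (Ambient d)}
    (hF : IsFacet (sphericalHull (range v)) F) :
    ∃ I : Finset ι, I.card = d ∧ Supports v I ∧ sphericalHull (v '' I) = F := by
  have := Fintype.ofFinite ι
  obtain ⟨⟨u, hu, rfl⟩, hdim⟩ := hF
  have hle (i : ι) : inner ℝ u (v i) ≤ 0 := by
    have hi := hu _ (inv_norm_smul_mem_sphericalHull ⟨i, rfl⟩ (hv.ne_zero i))
    rw [real_inner_smul_right] at hi
    exact nonpos_of_mul_nonpos_right hi (inv_pos.2 (norm_pos_iff.2 (hv.ne_zero i)))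
  let I : Finset ι := {i | inner ℝ u (v i) = 0}
  have h_zero : ∀ i ∈ I, inner ℝ u (v i) = 0 := fun i hi => (Finset.mem_filter.1 hi).2
  have h_neg : ∀ j ∉ I, inner ℝ u (v j) < 0 := fun j hj =>
    (hle j).lt_of_ne fun h => hj (Finset.mem_filter.2 ⟨Finset.mem_univ j, h⟩)
  have hface := sphericalHull_face h_zero h_neg
  rw [hface, span_sphericalHull (hv.zero_notMem_image _)] at hdim
  exact ⟨I, hv.card_eq_of_finrank_span_eq hdim, ⟨u, h_zero, h_neg⟩, hface.symm⟩

theorem subset_of_sphericalHull_eq (hv : GeneralPosition v) {I J : Finset ι} (hI : Supports v I)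
    (h : sphericalHull (v '' I) = sphericalHull (v '' J)) : J ⊆ I := by
  obtain ⟨u, h_zero, h_neg⟩ := hI
  intro i hi
  by_contra hiI
  have hmem := inv_norm_smul_mem_sphericalHull (s := v '' J) ⟨i, hi, rfl⟩ (hv.ne_zero i)
  rw [← h, ← sphericalHull_face h_zero h_neg] at hmem
  have hzero := hmem.2
  rw [real_inner_smul_right, mul_eq_zero, inv_eq_zero, norm_eq_zero] at hzero
  exact hzero.elim (hv.ne_zero i) (h_neg i hiI).ne

open Classical in
theorem surfaceArea_eq [Fintype ι] (hv : GeneralPosition v) :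
    surfaceArea (sphericalHull (range v)) =
      ∑ I ∈ Finset.powersetCard d Finset.univ, if Supports v I then
        greatSubsphereMeasure (Submodule.span ℝ (v '' I)) (sphericalHull (v '' I)) else 0 := by
  let φ : {I : Finset ι // I.card = d ∧ Supports v I} →
      {F : Set (Ambient d) // IsFacet (sphericalHull (range v)) F} :=
    fun I => ⟨sphericalHull (v '' I.1), hv.isFacet I.2.1 I.2.2⟩
  have hφ : Function.Bijective φ := by
    constructor
    · intro I J h
      have h' : sphericalHull (v '' I.1) = sphericalHull (v '' J.1) := congrArg Subtype.val h
      exact Subtype.ext (Finset.Subset.antisymm (hv.subset_of_sphericalHull_eq J.2.2 h'.symm)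
        (hv.subset_of_sphericalHull_eq I.2.2 h'))
    · rintro ⟨F, hF⟩
      obtain ⟨I, hcard, hsupp, rfl⟩ := hv.exists_of_isFacet hF
      exact ⟨⟨I, hcard, hsupp⟩, rfl⟩
  rw [surfaceArea, ← (Equiv.ofBijective φ hφ).tsum_eq, tsum_fintype, ← Finset.sum_filter,
    Finset.sum_subtype (p := fun I => I.card = d ∧ Supports v I) _ fun I => by
      simp [Finset.mem_powersetCard]]
  refine Finset.sum_congr rfl fun I _ => ?_
  simp only [Equiv.ofBijective_apply, φ, span_sphericalHull (hv.zero_notMem_image _)]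

end GeneralPosition

end Facets

section Coordinates

variable {d : ℕ} {E : Type*} [NormedAddCommGroup E] [InnerProductSpace ℝ E]
  (b : OrthonormalBasis (Fin (d + 1)) ℝ E)

/-- The vector with coordinates `p` in an orthonormal basis, where the first coordinate, the height
over the hyperplane orthogonal to `b 0`, is separated from the others. -/
noncomputable def vec : (ℝ × (Fin d → ℝ)) ≃ₗ[ℝ] E :=
  Fin.consLinearEquiv ℝ (fun _ => ℝ) ≪≫ₗ (WithLp.linearEquiv 2 ℝ (Fin (d + 1) → ℝ)).symm ≪≫ₗ
    b.repr.symm.toLinearEquiv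

theorem inner_vec (p q : ℝ × (Fin d → ℝ)) :
    inner ℝ (vec b p) (vec b q) = p.1 * q.1 + p.2 ⬝ᵥ q.2 := by
  change inner ℝ (b.repr.symm _) (b.repr.symm _) = _
  rw [LinearIsometryEquiv.inner_map_map, PiLp.inner_apply, Fin.sum_univ_succ]
  simp [dotProduct, mul_comm]

theorem norm_vec_sq (p : ℝ × (Fin d → ℝ)) : ‖vec b p‖ ^ 2 = p.1 ^ 2 + p.2 ⬝ᵥ p.2 := by
  rw [← real_inner_self_eq_norm_sq, inner_vec, sq]

theorem vec_one_zero : vec b (1, 0) = b 0 := by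
  change b.repr.symm _ = _
  rw [LinearIsometryEquiv.symm_apply_eq, OrthonormalBasis.repr_self]
  ext i
  refine Fin.cases ?_ (fun j => ?_) i <;> simp

theorem inner_vec_zero (p : ℝ × (Fin d → ℝ)) : inner ℝ (vec b p) (b 0) = p.1 := by
  rw [← vec_one_zero, inner_vec]
  simp

theorem measurePreserving_vec [FiniteDimensional ℝ E] [MeasurableSpace E] [BorelSpace E] :
    MeasurePreserving (vec b) volume volume := by
  have h := b.measurePreserving_repr_symm.comp
    ((EuclideanSpace.volume_preserving_symm_measurableEquiv_toLp (Fin (d + 1))).symm.comp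
      (volume_preserving_piFinSuccAbove (fun _ : Fin (d + 1) => ℝ) 0).symm)
  refine (congrArg (MeasurePreserving · volume volume) (funext fun p => ?_)).mpr h
  exact congrArg (fun x => b.repr.symm (WithLp.toLp 2 x)) (Fin.insertNth_zero' p.1 p.2).symm

theorem measurable_vec_symm [FiniteDimensional ℝ E] [MeasurableSpace E] [BorelSpace E] :
    Measurable (vec b).symm :=
  (LinearMap.continuous_of_finiteDimensional (vec b).symm.toLinearMap).measurable

theorem linearIndependent_vec {q : Fin d → ℝ × (Fin d → ℝ)}
    (hq : (Matrix.of fun i => (q i).2).det ≠ 0) : LinearIndependent ℝ fun i => vec b (q i) :=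
  ((Matrix.linearIndependent_rows_of_det_ne_zero hq).of_comp
    (LinearMap.snd ℝ ℝ (Fin d → ℝ))).map' (vec b).toLinearMap (vec b).ker

end Coordinates

section SupportingHyperplane

theorem forall_add_dotProduct_eq_zero_iff {ι : Type*} [Fintype ι] [DecidableEq ι]
    {q : ι → ℝ × (ι → ℝ)} (hq : (Matrix.of fun i => (q i).2).det ≠ 0) {s : ℝ} {y : ι → ℝ} :
    (∀ i, s * (q i).1 + y ⬝ᵥ (q i).2 = 0) ↔ y = -(s • slope q) := by
  have hinj := Matrix.mulVec_injective_iff_isUnit.2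
    ((Matrix.isUnit_iff_isUnit_det _).2 hq.isUnit)
  have hval (i : ι) : ((Matrix.of fun i => (q i).2) *ᵥ -(s • slope q)) i = -(s * (q i).1) := by
    rw [← slope_dotProduct hq i]
    simp [Matrix.mulVec, dotProduct_comm]
  rw [← hinj.eq_iff, funext_iff]
  refine forall_congr' fun i => ?_
  change _ ↔ (q i).2 ⬝ᵥ y = _
  rw [hval, dotProduct_comm, ← add_eq_zero_iff_eq_neg, add_comm]

theorem exists_forall_mul_neg_iff {κ : Type*} [Nonempty κ] (f : κ → ℝ) :
    (∃ s : ℝ, ∀ j, s * f j < 0) ↔ (∀ j, f j < 0) ∨ ∀ j, 0 < f j := by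
  constructor
  · rintro ⟨s, hs⟩
    rcases lt_trichotomy s 0 with h | rfl | h
    · exact .inr fun j => pos_of_mul_neg_right (hs j) h.le
    · exact absurd (hs (Classical.arbitrary κ)) (by simp)
    · exact .inl fun j => neg_of_mul_neg_right (hs j) h.le
  · rintro (h | h)
    · exact ⟨1, fun j => by simpa using h j⟩
    · exact ⟨-1, fun j => by simpa using h j⟩

variable {d : ℕ} {ι : Type*} (b : OrthonormalBasis (Fin (d + 1)) ℝ (Ambient d))
  {p : ι → ℝ × (Fin d → ℝ)} {I : Finset ι}

theorem supports_vec_iff_exists (e : Fin d ≃ {i // i ∈ I})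
    (hdet : (Matrix.of fun k => (p (e k)).2).det ≠ 0) :
    Supports (fun i => vec b (p i)) I ↔
      ∃ s : ℝ, ∀ j : {j // j ∉ I}, s * ((p j).1 - (slope fun k => p (e k)) ⬝ᵥ (p j).2) < 0 := by
  have hzero (s : ℝ) (y : Fin d → ℝ) :
      (∀ i ∈ I, inner ℝ (vec b (s, y)) (vec b (p i)) = 0) ↔ y = -(s • slope fun k => p (e k)) := by
    rw [← forall_add_dotProduct_eq_zero_iff hdet]
    simp only [inner_vec, e.forall_congr_left, Subtype.forall, Equiv.apply_symm_apply]
  have hval (s : ℝ) (j : ι) : inner ℝ (vec b (s, -(s • slope fun k => p (e k)))) (vec b (p j)) =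
      s * ((p j).1 - (slope fun k => p (e k)) ⬝ᵥ (p j).2) := by
    rw [inner_vec, neg_dotProduct, smul_dotProduct, smul_eq_mul]
    ring
  simp only [Supports, (vec b).surjective.exists, Prod.exists, hzero, exists_eq_left, hval,
    Subtype.forall]

theorem supports_vec_iff_oneSided [Nonempty {j // j ∉ I}] (e : Fin d ≃ {i // i ∈ I})
    (hdet : (Matrix.of fun k => (p (e k)).2).det ≠ 0) :
    Supports (fun i => vec b (p i)) I ↔
      OneSided (slope fun k => p (e k)) fun j : {j // j ∉ I} => p j := by
  rw [supports_vec_iff_exists b e hdet, exists_forall_mul_neg_iff, or_comm]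
  simp only [OneSided, sub_pos, sub_neg]

end SupportingHyperplane

section GramDeterminant

variable {E ι : Type*} [NormedAddCommGroup E] [InnerProductSpace ℝ E] [FiniteDimensional ℝ E]
  [MeasurableSpace E] [BorelSpace E]

theorem measurableSet_hull_basis [Finite ι] (B : Module.Basis ι ℝ E) :
    MeasurableSet (PointedCone.hull ℝ (range B) : Set E) := by
  have := Fintype.ofFinite ι
  have hcoord : (PointedCone.hull ℝ (range B) : Set E) = ⋂ i, B.coord i ⁻¹' Ici 0 := by
    ext x
    rw [SetLike.mem_coe, mem_iInter]
    conv_lhs => rw [← B.sum_repr x]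
    exact sum_smul_mem_hull_iff B.linearIndependent _
  exact hcoord ▸ .iInter fun i =>
    (LinearMap.continuous_of_finiteDimensional (B.coord i)).measurable measurableSet_Ici

variable [Fintype ι]

theorem lintegral_eq_sqrt_det_gram_mul [DecidableEq ι] (B : Module.Basis ι ℝ E) {F : E → ℝ≥0∞}
    (hF : Measurable F) :
    ∫⁻ x, F x = ENNReal.ofReal √(Matrix.gram ℝ B).det * ∫⁻ c : ι → ℝ, F (∑ i, c i • B i) := by
  let f : OrthonormalBasis ι ℝ E := (stdOrthonormalBasis ℝ E).reindex
    (Fintype.equivOfCardEq (by simp [Module.finrank_eq_card_basis B]))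
  set A := f.toBasis.toMatrix B
  have hdet : √(Matrix.gram ℝ B).det = |A.det| := by
    have hgram : Matrix.gram ℝ B = Aᵀ * A := Matrix.gram_eq_conjTranspose_mul f B
    rw [hgram, Matrix.det_mul, Matrix.det_transpose, Real.sqrt_mul_self_eq_abs]
  have hA : A.det ≠ 0 := by
    rw [← Module.Basis.det_apply]
    exact (f.toBasis.isUnit_det B).ne_zero
  have hcomb (c : ι → ℝ) : f.repr.symm (WithLp.toLp 2 (A *ᵥ c)) = ∑ i, c i • B i := by
    rw [LinearIsometryEquiv.symm_apply_eq, ← B.equivFun_symm_apply]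
    ext k
    have hc : B.repr (B.equivFun.symm c) = c := B.equivFun.apply_symm_apply c
    exact congrFun ((congrArg (A *ᵥ ·) hc.symm).trans
      (B.toMatrix_mulVec_repr f.toBasis (B.equivFun.symm c))) k
  have hmp := f.measurePreserving_repr_symm.comp
    (EuclideanSpace.volume_preserving_symm_measurableEquiv_toLp ι).symm
  rw [← hmp.lintegral_comp hF, hdet]
  exact (lintegral_comp_mulVec hA (hF.comp hmp.measurable)).trans
    (congrArg _ (lintegral_congr fun c => congrArg F (hcomb c)))

theorem toSphere_hull_basis_mul [DecidableEq ι] [Nonempty ι] (B : Module.Basis ι ℝ E) :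
    (volume : Measure E).toSphere ((↑) ⁻¹' (PointedCone.hull ℝ (range B) : Set E)) *
        ENNReal.ofReal (radialMoment (Fintype.card ι - 1)) =
      ENNReal.ofReal √(Matrix.gram ℝ B).det *
        ∫⁻ c in Ici (0 : ι → ℝ), ENNReal.ofReal (Real.exp (-‖∑ i, c i • B i‖ ^ 2 / 2)) := by
  have : Nontrivial E := ⟨⟨B (Classical.arbitrary ι), 0, B.ne_zero _⟩⟩
  have hK := measurableSet_hull_basis B
  have hpolar := setLIntegral_comp_norm_of_smul_mem_iff (volume : Measure E) hK
    (fun r hr _ => smul_mem_hull_iff hr)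
    (by fun_prop : Measurable fun r => ENNReal.ofReal (Real.exp (-r ^ 2 / 2)))
  simp_rw [← ENNReal.ofReal_mul' (Real.exp_pos _).le, lintegral_pow_mul_exp,
    Module.finrank_eq_card_basis B] at hpolar
  rw [← hpolar, ← lintegral_indicator hK,
    lintegral_eq_sqrt_det_gram_mul B (.indicator (by fun_prop) hK),
    ← lintegral_indicator measurableSet_Ici]
  classical
  simp only [indicator_apply, SetLike.mem_coe, sum_smul_mem_hull_iff B.linearIndependent, mem_Ici]

end GramDeterminant

section GreatSubspheres

variable {d : ℕ}

theorem greatSubsphereMeasure_sphericalHull (L : Submodule ℝ (Ambient d)) (s : Set (Ambient d)) :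
    greatSubsphereMeasure L (sphericalHull s) =
      (volume : Measure L).toSphere ((↑) ⁻¹' {x : L | (x : Ambient d) ∈ PointedCone.hull ℝ s}) := by
  have hL : MeasurableEmbedding ((↑) : L → Ambient d) :=
    .subtype_coe L.closed_of_finiteDimensional.measurableSet
  have hS : MeasurableEmbedding ((↑) : Metric.sphere (0 : L) 1 → L) :=
    .subtype_coe Metric.isClosed_sphere.measurableSet
  refine ((hL.comp hS).map_apply (volume : Measure L).toSphere _).trans (congrArg _ ?_)
  ext x
  have hx : ((x : L) : Ambient d) ∈ Sph d :=
    mem_sphere_zero_iff_norm.2 (norm_eq_of_mem_sphere x : ‖((x : L) : Ambient d)‖ = 1)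
  exact and_iff_right hx

theorem greatSubsphereMeasure_span_range_mul {ι : Type*} [Fintype ι] [DecidableEq ι] [Nonempty ι]
    {w : ι → Ambient d} (hw : LinearIndependent ℝ w) :
    greatSubsphereMeasure (Submodule.span ℝ (range w)) (sphericalHull (range w)) *
        ENNReal.ofReal (radialMoment (Fintype.card ι - 1)) =
      ENNReal.ofReal √(Matrix.gram ℝ w).det *
        ∫⁻ c in Ici (0 : ι → ℝ), ENNReal.ofReal (Real.exp (-‖∑ i, c i • w i‖ ^ 2 / 2)) := by
  let B := Module.Basis.span hw
  have hB (i : ι) : (B i : Ambient d) = w i :=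
    congrArg Subtype.val (Module.Basis.span_apply hw i)
  have hsum (c : ι → ℝ) : ((∑ i, c i • B i : Submodule.span ℝ (range w)) : Ambient d) =
      ∑ i, c i • w i := by
    simp [hB]
  have hhull : {x : Submodule.span ℝ (range w) | (x : Ambient d) ∈ PointedCone.hull ℝ (range w)} =
      PointedCone.hull ℝ (range B) := by
    ext x
    rw [mem_ofPred_eq, SetLike.mem_coe, ← B.sum_repr x, hsum, sum_smul_mem_hull_iff hw,
      sum_smul_mem_hull_iff B.linearIndependent]
  have hgram : Matrix.gram ℝ B = Matrix.gram ℝ w := by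
    ext i j
    simp [Matrix.gram_apply, hB]
  rw [greatSubsphereMeasure_sphericalHull, hhull, toSphere_hull_basis_mul, hgram]
  exact congrArg _ (lintegral_congr fun c => by rw [← hsum c]; rfl)

variable {m : ℕ} (b : OrthonormalBasis (Fin (d + 1)) ℝ (Ambient d))
  {q : Fin d → ℝ × (Fin d → ℝ)}

theorem norm_sum_smul_vec_sq (hq : (Matrix.of fun i => (q i).2).det ≠ 0) (c : Fin d → ℝ) :
    ‖∑ i, c i • vec b (q i)‖ ^ 2 = slopeForm (slope q) (∑ i, c i • (q i).2) := by
  have hsum : ∑ i, c i • q i = (slope q ⬝ᵥ ∑ i, c i • (q i).2, ∑ i, c i • (q i).2) := by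
    refine Prod.ext ?_ (by simp [Prod.snd_sum])
    simp [Prod.fst_sum, dotProduct_sum, slope_dotProduct hq]
  simp_rw [← map_smul, ← map_sum, norm_vec_sq, hsum, slopeForm, add_comm]

theorem det_gram_vec (hq : (Matrix.of fun i => (q i).2).det ≠ 0) :
    (Matrix.gram ℝ fun i => vec b (q i)).det =
      (1 + slope q ⬝ᵥ slope q) * (Matrix.of fun i => (q i).2).det ^ 2 := by
  set Z := Matrix.of fun i => (q i).2
  have hgram : Matrix.gram ℝ (fun i => vec b (q i)) =
      Z * (1 + Matrix.vecMulVec (slope q) (slope q)) * Zᵀ := by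
    have hZ : Z *ᵥ slope q = fun i => (q i).1 := funext fun i =>
      (dotProduct_comm _ _).trans (slope_dotProduct hq i)
    rw [Matrix.mul_add, Matrix.mul_one, Matrix.add_mul, Matrix.mul_vecMulVec, hZ,
      Matrix.vecMulVec_mul, Matrix.vecMul_transpose, hZ]
    ext i j
    rw [Matrix.gram_apply, inner_vec, add_comm]
    rfl
  rw [hgram, Matrix.det_mul, Matrix.det_mul, Matrix.det_transpose, Matrix.vecMulVec_eq Unit,
    Matrix.det_one_add_replicateCol_mul_replicateRow]
  ring

theorem greatSubsphereMeasure_hull_vec {b : OrthonormalBasis (Fin (m + 2)) ℝ (Ambient (m + 1))}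
    {q : Fin (m + 1) → ℝ × (Fin (m + 1) → ℝ)} (hq : (Matrix.of fun i => (q i).2).det ≠ 0) :
    greatSubsphereMeasure (Submodule.span ℝ (range fun i => vec b (q i)))
      (sphericalHull (range fun i => vec b (q i))) =
      (ENNReal.ofReal (radialMoment m))⁻¹ * coneGaussian (slope q) fun i => (q i).2 := by
  have h := greatSubsphereMeasure_span_range_mul (linearIndependent_vec b hq)
  have hnonneg : 0 ≤ 1 + slope q ⬝ᵥ slope q := by
    have := dotProduct_self_nonneg (slope q)
    positivity
  rw [Fintype.card_fin, Nat.add_sub_cancel, det_gram_vec b hq, Real.sqrt_mul hnonneg,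
    Real.sqrt_sq_eq_abs] at h
  simp_rw [norm_sum_smul_vec_sq b hq] at h
  rw [coneGaussian, ← h, mul_comm, mul_assoc, ENNReal.mul_inv_cancel
    (by simpa using radialMoment_pos m) ENNReal.ofReal_ne_top, mul_one]

end GreatSubspheres

section GenericPoints

variable {ι : Type*} {d : ℕ} {p : ι → ℝ × (Fin d → ℝ)}

/-- Genericity of points given by their coordinates: any `d + 1` of them are linearly independent,
and so are the second coordinates of any `d` of them. -/
def Generic (p : ι → ℝ × (Fin d → ℝ)) : Prop :=
  (∀ σ : Fin d ↪ ι, (Matrix.of fun i => (p (σ i)).2).det ≠ 0) ∧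
    ∀ σ : Fin (d + 1) ↪ ι, (Matrix.of fun i =>
      Fin.consLinearEquiv ℝ (fun _ => ℝ) (p (σ i))).det ≠ 0

theorem measurable_consLinearEquiv :
    Measurable (Fin.consLinearEquiv ℝ fun _ : Fin (d + 1) => ℝ) :=
  (LinearMap.continuous_of_finiteDimensional
    (Fin.consLinearEquiv ℝ fun _ : Fin (d + 1) => ℝ).toLinearMap).measurable

theorem measurableSet_generic [Finite ι] :
    MeasurableSet {p : ι → ℝ × (Fin d → ℝ) | Generic p} := by
  have hcons := measurable_consLinearEquiv (d := d)
  simp only [Generic, ofPred_and, ofPred_forall]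
  refine .inter (.iInter fun σ => ?_) (.iInter fun σ => ?_) <;>
    exact (measurableSet_eq_fun (by fun_prop) measurable_const).compl

theorem ae_generic (d n : ℕ) :
    ∀ᵐ p ∂(Measure.pi fun _ : Fin n => halfGaussian d), Generic p := by
  have hac : (Measure.pi fun _ : Fin n => halfGaussian d) ≪
      Measure.pi fun _ => (volume : Measure (ℝ × (Fin d → ℝ))) := by
    have : SigmaFinite (volume.withDensity (halfGaussianDensity d)) :=
      inferInstanceAs (SigmaFinite (halfGaussian d))
    unfold halfGaussian
    rw [pi_withDensity _ (measurable_halfGaussianDensity d)]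
    exact withDensity_absolutelyContinuous _ _
  have : (volume : Measure (ℝ × (Fin d → ℝ))).IsAddLeftInvariant :=
    inferInstanceAs (Measure.prod volume volume).IsAddLeftInvariant
  refine hac.ae_le (eventually_and.2 ⟨ae_all_iff.2 fun σ => ?_, ae_all_iff.2 fun σ => ?_⟩)
  · exact ae_det_ne_zero volume σ (LinearMap.snd ℝ ℝ (Fin d → ℝ)) measurable_snd
      Prod.snd_surjective
  · exact ae_det_ne_zero volume σ (Fin.consLinearEquiv ℝ fun _ => ℝ).toLinearMap
      measurable_consLinearEquiv (LinearEquiv.surjective _)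

namespace Generic

theorem smul (hp : Generic p) {r : ι → ℝ} (hr : ∀ i, 0 < r i) : Generic fun i => r i • p i := by
  have hrow {k : ℕ} {M : Fin k → Fin k → ℝ} (hM : (Matrix.of M).det ≠ 0) (σ : Fin k ↪ ι) :
      (Matrix.of fun i => r (σ i) • M i).det ≠ 0 := by
    have hdet := Matrix.det_mul_column (fun i => r (σ i)) (Matrix.of M)
    exact hdet ▸ mul_ne_zero (Finset.prod_ne_zero_iff.2 fun i _ => (hr (σ i)).ne') hM
  exact ⟨fun σ => hrow (hp.1 σ) σ, fun σ => by simpa only [map_smul] using hrow (hp.2 σ) σ⟩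

theorem linearIndependent (hp : Generic p) (σ : Fin (d + 1) ↪ ι) :
    LinearIndependent ℝ fun i => p (σ i) :=
  (Matrix.linearIndependent_rows_of_det_ne_zero (hp.2 σ)).of_comp
    (Fin.consLinearEquiv ℝ fun _ : Fin (d + 1) => ℝ).toLinearMap

theorem generalPosition [Fintype ι] (hp : Generic p) (hd : d < Fintype.card ι)
    (b : OrthonormalBasis (Fin (d + 1)) ℝ (Ambient d)) : GeneralPosition fun i => vec b (p i) := by
  intro J hJ
  obtain ⟨K, hJK, -, hK⟩ := Finset.exists_subsuperset_card_eq (Finset.subset_univ J) hJ hd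
  let σ : Fin (d + 1) ↪ ι :=
    (K.equivFinOfCardEq hK).symm.toEmbedding.trans (Function.Embedding.subtype _)
  have hind := (hp.linearIndependent σ).map' (vec b).toLinearMap (vec b).ker
  have hrange : range σ = K :=
    ((K.equivFinOfCardEq hK).symm.surjective.range_comp _).trans Subtype.range_coe
  have hK' : LinearIndepOn ℝ (fun i => vec b (p i)) (range σ) :=
    (linearIndepOn_range_iff σ.injective fun i => vec b (p i)).2 hind
  rw [hrange] at hK'
  exact hK'.mono (Finset.coe_subset.2 hJK)

end Generic

end GenericPoints

section FacetSum

variable {m n : ℕ}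

/-- The surface area of the spherical hull of generic points in terms of their coordinates. A facet
is determined by the set `I` of indices of its vertices, so this is a sum over all `I`. -/
noncomputable def facetSum (p : Fin n → ℝ × (Fin (m + 1) → ℝ)) : ℝ≥0∞ :=
  ∑ I : {I : Finset (Fin n) // I.card = m + 1}, (ENNReal.ofReal (radialMoment m))⁻¹ *
    facetContent (fun k => p ((I.1.equivFinOfCardEq I.2).symm k)) fun j : {j // j ∉ I.1} => p j

theorem measurePreserving_vertices_prod_others {I : Finset (Fin n)} (hI : I.card = m + 1) :
    MeasurePreserving (fun p : Fin n → ℝ × (Fin (m + 1) → ℝ) =>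
      (fun k => p ((I.equivFinOfCardEq hI).symm k), fun j : {j // j ∉ I} => p j))
      (Measure.pi fun _ => halfGaussian (m + 1))
      ((Measure.pi fun _ => halfGaussian (m + 1)).prod
        (Measure.pi fun _ => halfGaussian (m + 1))) :=
  have : SigmaFinite (halfGaussian (m + 1)) := inferInstance
  measurePreserving_comp_prod_restrict (halfGaussian (m + 1)) (I.equivFinOfCardEq hI).symm

theorem measurable_facetContent_of_card_eq {I : Finset (Fin n)} (hI : I.card = m + 1) :
    Measurable fun p : Fin n → ℝ × (Fin (m + 1) → ℝ) => facetContent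
      (fun k => p ((I.equivFinOfCardEq hI).symm k)) fun j : {j // j ∉ I} => p j :=
  (measurable_facetContent.comp (measurePreserving_vertices_prod_others hI).measurable :)

theorem measurable_facetSum :
    Measurable fun p : Fin n → ℝ × (Fin (m + 1) → ℝ) => facetSum p :=
  Finset.measurable_fun_sum _ fun I _ => (measurable_facetContent_of_card_eq I.2).const_mul _

theorem nonempty_notMem_of_card_lt {I : Finset (Fin n)} (h : I.card < n) :
    Nonempty {j // j ∉ I} :=
  have ⟨j, _, hj⟩ := Finset.exists_mem_notMem_of_card_lt_card
    (h.trans_eq (Finset.card_fin n).symm)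
  ⟨j, hj⟩

theorem Generic.surfaceArea_sphericalHull_vec {p : Fin n → ℝ × (Fin (m + 1) → ℝ)} (hp : Generic p)
    (hn : m + 1 < n) (b : OrthonormalBasis (Fin (m + 2)) ℝ (Ambient (m + 1))) :
    surfaceArea (sphericalHull (range fun i => vec b (p i))) = facetSum p := by
  classical
  rw [facetSum, (hp.generalPosition (by simpa) b).surfaceArea_eq,
    Finset.sum_subtype (p := fun I => I.card = m + 1) _ (by simp [Finset.mem_powersetCard])]
  refine Finset.sum_congr rfl fun ⟨I, hI⟩ _ => ?_
  let e := (I.equivFinOfCardEq hI).symm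
  have hdet : (Matrix.of fun k => (p (e k)).2).det ≠ 0 :=
    hp.1 (e.toEmbedding.trans (Function.Embedding.subtype _))
  have := nonempty_notMem_of_card_lt (hI.trans_lt hn)
  have himage : (fun i => vec b (p i)) '' I = range fun k => vec b (p (e k)) := by
    rw [← Subtype.range_coe (s := (I : Set (Fin n))), ← range_comp]
    exact (e.surjective.range_comp _).symm
  rw [if_congr (supports_vec_iff_oneSided b e hdet) rfl rfl, himage,
    greatSubsphereMeasure_hull_vec hdet, facetContent, mul_ite, mul_zero]

theorem lintegral_facetContent_of_card_eq (hn : m + 1 < n) {I : Finset (Fin n)}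
    (hI : I.card = m + 1) :
    ∫⁻ p : Fin n → ℝ × (Fin (m + 1) → ℝ), facetContent
      (fun k => p ((I.equivFinOfCardEq hI).symm k)) (fun j : {j // j ∉ I} => p j)
        ∂(Measure.pi fun _ => halfGaussian (m + 1)) =
      ENNReal.ofReal (radialMoment m * ((m + 1) / π ^ (m + 1) * omega (m + 1) *
        ∫ x in (0)..π, (1 - x / π) ^ (n - (m + 1)) * Real.sin x ^ m)) := by
  have := nonempty_notMem_of_card_lt (hI.trans_lt hn)
  have hcard : Fintype.card {j // j ∉ I} = n - (m + 1) := by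
    rw [Fintype.card_subtype_compl, Fintype.card_coe, Fintype.card_fin, hI]
  rw [← hcard, ← lintegral_facetContent,
    ← lintegral_prod _ measurable_facetContent.aemeasurable,
    ← (measurePreserving_vertices_prod_others hI).lintegral_comp measurable_facetContent]

theorem lintegral_facetSum (hn : m + 1 < n) :
    ∫⁻ p, facetSum p ∂(Measure.pi fun _ : Fin n => halfGaussian (m + 1)) =
      n.choose (m + 1) * ENNReal.ofReal ((m + 1) / π ^ (m + 1) * omega (m + 1) *
        ∫ x in (0)..π, (1 - x / π) ^ (n - (m + 1)) * Real.sin x ^ m) := by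
  have hradial : ENNReal.ofReal (radialMoment m) ≠ 0 := by simpa using radialMoment_pos m
  simp only [facetSum]
  rw [lintegral_finsetSum _ fun I _ => (measurable_facetContent_of_card_eq I.2).const_mul _]
  simp_rw [lintegral_const_mul' _ _ (ENNReal.inv_ne_top.2 hradial),
    fun I : {I : Finset (Fin n) // I.card = m + 1} => lintegral_facetContent_of_card_eq hn I.2,
    ENNReal.ofReal_mul (radialMoment_pos m).le, ← mul_assoc,
    ENNReal.inv_mul_cancel hradial ENNReal.ofReal_ne_top, one_mul]
  rw [Finset.sum_const, Finset.card_univ, Fintype.card_finset_len, Fintype.card_fin, nsmul_eq_mul]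

end FacetSum

section Direction

variable {d : ℕ} (e : Sph d)

/-- The point of the sphere in the direction of a vector. Any point `e` of the sphere may serve as
the direction of the zero vector. -/
noncomputable def direction (x : Ambient d) : Sph d :=
  ⟨open Classical in if x = 0 then e else ‖x‖⁻¹ • x, by
    split_ifs with hx
    exacts [e.2, inv_norm_smul_mem_sphere hx]⟩

theorem coe_direction {x : Ambient d} (hx : x ≠ 0) : (direction e x : Ambient d) = ‖x‖⁻¹ • x := by
  rw [direction]
  exact if_neg hx

theorem direction_smul {r : ℝ} (hr : 0 < r) (x : Ambient d) :
    direction e (r • x) = direction e x := by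
  by_cases hx : x = 0
  · rw [hx, smul_zero]
  · refine Subtype.ext ?_
    rw [coe_direction e hx, coe_direction e (smul_ne_zero hr.ne' hx), norm_smul,
      Real.norm_of_nonneg hr.le, mul_inv, smul_smul, mul_right_comm, inv_mul_cancel₀ hr.ne',
      one_mul]

theorem direction_coe (θ : Sph d) : direction e θ = θ := by
  refine Subtype.ext ?_
  rw [coe_direction e (ne_zero_of_mem_unit_sphere θ), norm_eq_of_mem_sphere, inv_one, one_smul]

theorem measurable_direction : Measurable (direction e) := by
  classical
  exact .subtype_mk (.ite (measurableSet_singleton 0) measurable_const (by fun_prop))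

theorem measurable_direction_vec (b : OrthonormalBasis (Fin (d + 1)) ℝ (Ambient d)) :
    Measurable fun p => direction e (vec b p) :=
  (measurable_direction e).comp (measurePreserving_vec b).measurable

theorem measurableSet_halfsphere : MeasurableSet (halfsphere e) :=
  measurableSet_le measurable_const (by fun_prop)

variable {e} {b : OrthonormalBasis (Fin (d + 1)) ℝ (Ambient d)}

theorem halfGaussianDensity_eq_indicator (hb : b 0 = e) (p : ℝ × (Fin d → ℝ)) :
    halfGaussianDensity d p = {x : Ambient d | 0 ≤ inner ℝ x (e : Ambient d)}.indicator
      (fun x => ENNReal.ofReal (2 * (√(2 * π))⁻¹ ^ (d + 1)) *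
        ENNReal.ofReal (Real.exp (-‖x‖ ^ 2 / 2))) (vec b p) := by
  classical
  rw [halfGaussianDensity, indicator_apply, indicator_apply, norm_vec_sq,
    ← ENNReal.ofReal_mul (by positivity), add_comm (p.1 ^ 2)]
  exact if_congr (by rw [mem_ofPred, ← hb, inner_vec_zero, mem_Ici]) rfl rfl

theorem map_direction_halfGaussian_apply (hb : b 0 = e) {s : Set (Sph d)} (hs : MeasurableSet s) :
    (halfGaussian d).map (fun p => direction e (vec b p)) s =
      sigma d (halfsphere e ∩ s) *
        (ENNReal.ofReal (2 * (√(2 * π))⁻¹ ^ (d + 1)) * ENNReal.ofReal (radialMoment d)) := by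
  let H : Set (Ambient d) := {x | 0 ≤ inner ℝ x (e : Ambient d)}
  have hH : MeasurableSet H := measurableSet_le measurable_const (by fun_prop)
  have hdir := measurable_direction e
  have hcone (r : ℝ) (hr : 0 < r) (x : Ambient d) :
      r • x ∈ direction e ⁻¹' s ∩ H ↔ x ∈ direction e ⁻¹' s ∩ H := by
    simp only [H, mem_inter_iff, mem_preimage, direction_smul e hr, mem_ofPred,
      real_inner_smul_left, mul_nonneg_iff_of_pos_left hr]
  have hsphere : ((↑) : Sph d → Ambient d) ⁻¹' (direction e ⁻¹' s ∩ H) = halfsphere e ∩ s := by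
    ext θ
    simp only [H, mem_preimage, mem_inter_iff, direction_coe, mem_ofPred, halfsphere, and_comm]
  have hvec := measurePreserving_vec b
  have hmeas := measurable_direction_vec e b
  rw [Measure.map_apply hmeas hs, halfGaussian,
    withDensity_apply _ (hmeas hs),
    lintegral_congr (halfGaussianDensity_eq_indicator hb)]
  change ∫⁻ p in vec b ⁻¹' (direction e ⁻¹' s), _ = _
  rw [hvec.setLIntegral_comp_preimage (hdir hs) (Measurable.indicator (by fun_prop) hH),
    setLIntegral_indicator hH, inter_comm,
    setLIntegral_comp_norm_of_smul_mem_iff volume ((hdir hs).inter hH) hcone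
      (g := fun r => ENNReal.ofReal (2 * (√(2 * π))⁻¹ ^ (d + 1)) *
        ENNReal.ofReal (Real.exp (-r ^ 2 / 2))) (by fun_prop), hsphere]
  simp_rw [mul_left_comm (ENNReal.ofReal (_ ^ _)), ← ENNReal.ofReal_mul' (Real.exp_nonneg _),
    lintegral_const_mul' _ _ ENNReal.ofReal_ne_top, finrank_euclideanSpace_fin,
    Nat.add_sub_cancel, lintegral_pow_mul_exp]
  rfl

theorem map_direction_halfGaussian (hb : b 0 = e) :
    (halfGaussian d).map (fun p => direction e (vec b p)) = uniformHalfsphere e := by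
  have hprob := Measure.isProbabilityMeasure_map (μ := halfGaussian d)
    (measurable_direction_vec e b).aemeasurable
  have htotal := map_direction_halfGaussian_apply hb .univ
  rw [inter_univ] at htotal
  refine Measure.ext fun s hs => ?_
  rw [map_direction_halfGaussian_apply hb hs, uniformHalfsphere,
    cond_apply (measurableSet_halfsphere e), mul_comm,
    ENNReal.eq_inv_of_mul_eq_one_left
      ((mul_comm _ _).trans (htotal.symm.trans hprob.measure_univ))]

end Direction

section ExpectedSurfaceArea

variable {m n : ℕ} {e : Sph (m + 1)}
  {b : OrthonormalBasis (Fin (m + 2)) ℝ (Ambient (m + 1))}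

theorem measurable_pi_direction (e : Sph (m + 1))
    (b : OrthonormalBasis (Fin (m + 2)) ℝ (Ambient (m + 1))) (n : ℕ) :
    Measurable fun (p : Fin n → ℝ × (Fin (m + 1) → ℝ)) i => direction e (vec b (p i)) :=
  measurable_pi_iff.2 fun i => (measurable_direction_vec e b).comp (measurable_pi_apply i)

theorem map_pi_direction_halfGaussian (n : ℕ) (hb : b 0 = e) :
    (Measure.pi fun _ : Fin n => halfGaussian (m + 1)).map
      (fun p i => direction e (vec b (p i))) = Measure.pi fun _ => uniformHalfsphere e := by
  have hdir := (measurable_direction_vec e b).aemeasurable (μ := halfGaussian (m + 1))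
  have := Measure.isProbabilityMeasure_map hdir
  have hpi := Measure.pi_map_pi (ι := Fin n) fun _ => hdir
  exact hpi.trans (congrArg (fun μ => Measure.pi fun _ => μ) (map_direction_halfGaussian hb))

theorem polytope_direction {v : Fin n → Ambient (m + 1)} (hv : ∀ i, v i ≠ 0) :
    polytope (fun i => direction e (v i)) = sphericalHull (range v) := by
  simp only [polytope, sphericalHull, coe_direction e (hv _),
    hull_range_smul fun i => inv_pos.2 (norm_pos_iff.2 (hv i))]

theorem Generic.direction {p : Fin n → ℝ × (Fin (m + 1) → ℝ)} (hp : Generic p)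
    (h0 : ∀ i, vec b (p i) ≠ 0) :
    Generic fun i => (vec b).symm (direction e (vec b (p i)) : Ambient (m + 1)) := by
  simpa only [coe_direction e (h0 _), map_smul, LinearEquiv.symm_apply_apply] using
    hp.smul fun i => inv_pos.2 (norm_pos_iff.2 (h0 i))

theorem measurable_coordinates (b : OrthonormalBasis (Fin (m + 2)) ℝ (Ambient (m + 1))) (n : ℕ) :
    Measurable fun (x : Fin n → Sph (m + 1)) i => (vec b).symm (x i : Ambient (m + 1)) :=
  measurable_pi_iff.2 fun i =>
    (measurable_vec_symm b).comp (measurable_subtype_coe.comp (measurable_pi_apply i))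

theorem ae_generic_uniformHalfsphere (hn : m + 1 < n) (hb : b 0 = e) :
    ∀ᵐ x ∂(Measure.pi fun _ : Fin n => uniformHalfsphere e),
      Generic fun i => (vec b).symm (x i : Ambient (m + 1)) := by
  rw [← map_pi_direction_halfGaussian n hb]
  refine (ae_map_iff (measurable_pi_direction e b n).aemeasurable
    (measurable_coordinates b n measurableSet_generic)).2 ?_
  filter_upwards [ae_generic (m + 1) n] with p hp
  exact hp.direction (hp.generalPosition (by simpa) b).ne_zero

theorem surfaceArea_polytope_ae_eq (hn : m + 1 < n) (hb : b 0 = e) :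
    (fun x : Fin n → Sph (m + 1) => surfaceArea (polytope x))
      =ᵐ[Measure.pi fun _ => uniformHalfsphere e]
        fun x => facetSum fun i => (vec b).symm (x i : Ambient (m + 1)) := by
  filter_upwards [ae_generic_uniformHalfsphere hn hb] with x hx
  simpa only [polytope, LinearEquiv.apply_symm_apply] using hx.surfaceArea_sphericalHull_vec hn b

theorem aemeasurable_surfaceArea_polytope (hn : m + 1 < n) (e : Sph (m + 1)) :
    AEMeasurable (fun x : Fin n → Sph (m + 1) => surfaceArea (polytope x))
      (Measure.pi fun _ => uniformHalfsphere e) := by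
  obtain ⟨b, hb⟩ := exists_orthonormalBasis_zero_eq (norm_eq_of_mem_sphere e)
  exact ⟨_, measurable_facetSum.comp (measurable_coordinates b n),
    surfaceArea_polytope_ae_eq hn hb⟩

theorem lintegral_surfaceArea_polytope (hn : m + 1 < n) (e : Sph (m + 1)) :
    ∫⁻ x : Fin n → Sph (m + 1), surfaceArea (polytope x)
      ∂(Measure.pi fun _ => uniformHalfsphere e) =
      n.choose (m + 1) * ENNReal.ofReal ((m + 1) / π ^ (m + 1) * omega (m + 1) *
        ∫ x in (0)..π, (1 - x / π) ^ (n - (m + 1)) * Real.sin x ^ m) := by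
  obtain ⟨b, hb⟩ := exists_orthonormalBasis_zero_eq (norm_eq_of_mem_sphere e)
  have hmeas := aemeasurable_surfaceArea_polytope hn e
  rw [← map_pi_direction_halfGaussian n hb] at hmeas ⊢
  rw [lintegral_map' hmeas (measurable_pi_direction e b n).aemeasurable, ← lintegral_facetSum hn]
  refine lintegral_congr_ae ?_
  filter_upwards [ae_generic (m + 1) n] with p hp
  rw [polytope_direction (hp.generalPosition (by simpa) b).ne_zero,
    hp.surfaceArea_sphericalHull_vec hn b]

end ExpectedSurfaceArea

section SineExpansion

theorem abs_sin_sub_add_le {x : ℝ} (hx : 0 ≤ x) : |Real.sin x - x + x ^ 3 / 6| ≤ x ^ 4 := by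
  rcases le_total x 1 with h | h
  · have hbound := Real.sin_bound (abs_le.2 ⟨by linarith, h⟩)
    have hpow : x ^ 5 ≤ x ^ 4 := pow_le_pow_of_le_one hx h (by norm_num)
    rw [abs_of_nonneg hx, ← sub_add] at hbound
    linarith [pow_nonneg hx 5]
  · have hlower := Real.sin_ge_sub_cube hx
    have hupper := Real.sin_le hx
    have hpow : x ^ 3 ≤ x ^ 4 := pow_le_pow_right₀ h (by norm_num)
    rw [abs_le]
    constructor <;> linarith [pow_nonneg hx 3]

theorem exists_abs_sin_pow_sub_le (m : ℕ) : ∃ K : ℝ, 0 ≤ K ∧ ∀ x ∈ Icc 0 π,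
    |Real.sin x ^ m - x ^ m + m / 6 * x ^ (m + 2)| ≤ K * x ^ (m + 3) := by
  induction m with
  | zero => exact ⟨0, le_rfl, fun x _ => by simp⟩
  | succ m ih =>
    obtain ⟨K, hK, h⟩ := ih
    refine ⟨K + 1 + m, by positivity, fun x hx => ?_⟩
    have hx0 := hx.1
    have hx4 : x ≤ 4 := hx.2.trans Real.pi_le_four
    have hcube : |x - Real.sin x| ≤ x ^ 3 / 6 :=
      (Real.abs_sub_sin_le x).trans_eq (by rw [abs_of_nonneg hx0])
    have hsin : |Real.sin x| ≤ x := by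
      rw [abs_of_nonneg (Real.sin_nonneg_of_nonneg_of_le_pi hx0 hx.2)]
      exact Real.sin_le hx0
    calc |Real.sin x ^ (m + 1) - x ^ (m + 1) + ((m + 1 : ℕ) : ℝ) / 6 * x ^ (m + 1 + 2)|
        = |Real.sin x * (Real.sin x ^ m - x ^ m + m / 6 * x ^ (m + 2)) +
            x ^ m * (Real.sin x - x + x ^ 3 / 6) + m / 6 * x ^ (m + 2) * (x - Real.sin x)| := by
          push_cast
          ring_nf
      _ ≤ x * (K * x ^ (m + 3)) + x ^ m * x ^ 4 + m / 6 * x ^ (m + 2) * (x ^ 3 / 6) := by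
          refine (abs_add_three _ _ _).trans ?_
          simp only [abs_mul, abs_of_nonneg (by positivity : 0 ≤ m / 6 * x ^ (m + 2)),
            abs_of_nonneg (pow_nonneg hx0 m)]
          gcongr
          exacts [h x hx, abs_sin_sub_add_le hx0]
      _ = x * (K * x ^ (m + 3)) + x ^ m * x ^ 4 + m * x ^ (m + 4) * (x / 36) := by ring
      _ ≤ x * (K * x ^ (m + 3)) + x ^ m * x ^ 4 + m * x ^ (m + 4) * 1 := by
          gcongr
          linarith
      _ = (K + 1 + m) * x ^ (m + 1 + 3) := by ring

end SineExpansion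

section BetaMoments

theorem integral_pow_mul_sub_pow {a : ℝ} (ha : 0 < a) (k N : ℕ) :
    ∫ x in (0)..a, x ^ k * (a - x) ^ N =
      a ^ (k + N + 1) * (k.factorial * N.factorial / (k + N + 1).factorial) := by
  have hscaled := Complex.betaIntegral_scaled (k + 1) (N + 1) ha
  have hre (j : ℕ) : 0 < ((j : ℂ) + 1).re := by
    rw [Complex.add_re, Complex.natCast_re, Complex.one_re]
    positivity
  have hgamma := Complex.Gamma_mul_Gamma_eq_betaIntegral (hre k) (hre N)
  have hsum : (k + 1 + (N + 1) : ℂ) = (k + N + 1 : ℕ) + 1 := by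
    push_cast
    ring
  rw [hsum] at hscaled hgamma
  simp only [Complex.Gamma_nat_eq_factorial, add_sub_cancel_right, Complex.cpow_natCast]
    at hscaled hgamma
  rw [eq_div_of_mul_eq (Nat.cast_ne_zero.2 (Nat.factorial_ne_zero _))
    ((mul_comm _ _).trans hgamma.symm)] at hscaled
  apply Complex.ofReal_injective
  rw [← intervalIntegral.integral_ofReal]
  push_cast
  exact hscaled

theorem choose_mul_integral_one_sub_div_pow_mul_pow (m N j : ℕ) :
    ((m + 1 : ℝ) / π ^ (m + 1) * (N + (m + 1)).choose (m + 1)) *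
      (∫ x in (0)..π, (1 - x / π) ^ N * x ^ (m + j)) =
    π ^ j * ((m + 1).ascFactorial j / (N + m + 2).ascFactorial j) := by
  have hintegral : ∫ x in (0)..π, (1 - x / π) ^ N * x ^ (m + j) =
      π ^ (m + j + 1) * ((m + j).factorial * N.factorial / (m + j + N + 1).factorial) := by
    have hscale (x : ℝ) : (1 - x / π) ^ N * x ^ (m + j) =
        (π ^ N)⁻¹ * (x ^ (m + j) * (π - x) ^ N) := by
      rw [one_sub_div Real.pi_ne_zero, div_pow]
      ring
    simp_rw [hscale]
    rw [intervalIntegral.integral_const_mul, integral_pow_mul_sub_pow Real.pi_pos]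
    field_simp
    ring
  have hnum := Nat.factorial_mul_ascFactorial m j
  have hden := Nat.factorial_mul_ascFactorial (N + m + 1) j
  rw [hintegral, ← hnum, show m + j + N + 1 = N + m + 1 + j by ring, ← hden, add_comm N (m + 1),
    Nat.cast_add_choose, Nat.factorial_succ m, show m + 1 + N = N + m + 1 by ring]
  push_cast
  field_simp
  ring

theorem cast_choose_three (m : ℕ) : ((m + 2).choose 3 : ℝ) = (m + 2) * (m + 1) * m / 6 := by
  rw [Nat.cast_choose_eq_ascPochhammer_div]
  simp only [Nat.add_one_sub_one, add_tsub_cancel_right, ascPochhammer_succ_eval,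
    ascPochhammer_one, Polynomial.eval_X, Nat.cast_one, Nat.cast_ofNat, Nat.factorial,
    Nat.succ_eq_add_one, Nat.reduceAdd, zero_add, mul_one, Nat.reduceMul, ne_eq,
    OfNat.ofNat_ne_zero, not_false_eq_true, div_left_inj']
  ring

end BetaMoments

section Asymptotics

theorem abs_integral_one_sub_div_pow_mul_sin_pow_sub_le {m : ℕ} {K : ℝ}
    (hsin : ∀ x ∈ Icc 0 π,
      |Real.sin x ^ m - x ^ m + m / 6 * x ^ (m + 2)| ≤ K * x ^ (m + 3)) (N : ℕ) :
    |(∫ x in (0)..π, (1 - x / π) ^ N * Real.sin x ^ m) -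
        (∫ x in (0)..π, (1 - x / π) ^ N * x ^ m) +
        m / 6 * ∫ x in (0)..π, (1 - x / π) ^ N * x ^ (m + 2)| ≤
      K * ∫ x in (0)..π, (1 - x / π) ^ N * x ^ (m + 3) := by
  have hint {f : ℝ → ℝ} (hf : Continuous f) : IntervalIntegrable f volume 0 π :=
    hf.intervalIntegrable _ _
  rw [← intervalIntegral.integral_const_mul, ← intervalIntegral.integral_const_mul,
    ← intervalIntegral.integral_sub (hint (by fun_prop)) (hint (by fun_prop)),
    ← intervalIntegral.integral_add (hint (by fun_prop)) (hint (by fun_prop)),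
    ← Real.norm_eq_abs]
  refine intervalIntegral.norm_integral_le_of_norm_le Real.pi_pos.le
    (.of_forall fun x hx => ?_) (hint (by fun_prop))
  have hweight : 0 ≤ (1 - x / π) ^ N :=
    pow_nonneg (sub_nonneg.2 (div_le_one_of_le₀ hx.2 Real.pi_pos.le)) N
  calc ‖(1 - x / π) ^ N * Real.sin x ^ m - (1 - x / π) ^ N * x ^ m +
          m / 6 * ((1 - x / π) ^ N * x ^ (m + 2))‖
      = ‖(1 - x / π) ^ N * (Real.sin x ^ m - x ^ m + m / 6 * x ^ (m + 2))‖ := by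
        congr 1
        ring
    _ = (1 - x / π) ^ N * |Real.sin x ^ m - x ^ m + m / 6 * x ^ (m + 2)| := by
        rw [norm_mul, Real.norm_of_nonneg hweight, Real.norm_eq_abs]
    _ ≤ (1 - x / π) ^ N * (K * x ^ (m + 3)) := by
        gcongr
        exact hsin x ⟨hx.1.le, hx.2⟩
    _ = K * ((1 - x / π) ^ N * x ^ (m + 3)) := by ring

theorem abs_inv_mul_sub_inv_sq_le {t : ℝ} (ht : 1 ≤ t) :
    |((t + 1) * (t + 2))⁻¹ - (t ^ 2)⁻¹| ≤ 5 * (t ^ 3)⁻¹ := by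
  have htpos : 0 < t := by linarith
  have hdiff : ((t + 1) * (t + 2))⁻¹ - (t ^ 2)⁻¹ =
      -((3 * t + 2) / (t ^ 2 * ((t + 1) * (t + 2)))) := by
    field_simp
    ring
  rw [hdiff, abs_neg, abs_of_nonneg (by positivity), ← div_eq_mul_inv,
    div_le_div_iff₀ (by positivity) (by positivity)]
  nlinarith [pow_pos htpos 2, pow_pos htpos 3, pow_pos htpos 4]

theorem exists_abs_choose_mul_integral_sub_le (m : ℕ) : ∃ C : ℝ, ∀ n : ℕ, m + 1 ≤ n →
    |((m + 1 : ℝ) / π ^ (m + 1) * n.choose (m + 1)) *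
        (∫ x in (0)..π, (1 - x / π) ^ (n - (m + 1)) * Real.sin x ^ m) -
        (1 - (m + 2).choose 3 * π ^ 2 * ((n : ℝ) ^ 2)⁻¹)| ≤ C * ((n : ℝ) ^ 3)⁻¹ := by
  obtain ⟨K, hK, hsin⟩ := exists_abs_sin_pow_sub_le m
  refine ⟨K * (π ^ 3 * (m + 1).ascFactorial 3) + (m + 2).choose 3 * π ^ 2 * 5, fun n hn => ?_⟩
  obtain ⟨N, rfl⟩ := Nat.exists_eq_add_of_le' hn
  rw [Nat.add_sub_cancel]
  have hmoment := choose_mul_integral_one_sub_div_pow_mul_pow m N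
  set Q : ℝ := (m + 1 : ℝ) / π ^ (m + 1) * (N + (m + 1)).choose (m + 1)
  set t : ℝ := ((N + (m + 1) : ℕ) : ℝ) with ht
  have ht1 : 1 ≤ t := Nat.one_le_cast.2 (by omega)
  have hzeroth : Q * (∫ x in (0)..π, (1 - x / π) ^ N * x ^ m) = 1 := by
    simpa using hmoment 0
  have hsecond : m / 6 * (Q * (∫ x in (0)..π, (1 - x / π) ^ N * x ^ (m + 2))) =
      (m + 2).choose 3 * π ^ 2 * ((t + 1) * (t + 2))⁻¹ := by
    rw [hmoment 2, cast_choose_three, ht]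
    simp only [Nat.ascFactorial_succ, Nat.ascFactorial_zero]
    push_cast
    field_simp
    ring
  have hthird : Q * (∫ x in (0)..π, (1 - x / π) ^ N * x ^ (m + 3)) ≤
      π ^ 3 * (m + 1).ascFactorial 3 * (t ^ 3)⁻¹ := by
    have hpow : (N + (m + 1)) ^ 3 ≤ (N + m + 2).ascFactorial 3 :=
      (Nat.pow_le_pow_left (by omega) 3).trans (Nat.pow_succ_le_ascFactorial _ 3)
    rw [hmoment 3, mul_div_assoc', div_eq_mul_inv, ht]
    gcongr
    exact_mod_cast hpow
  have hremainder := mul_le_mul_of_nonneg_left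
    (abs_integral_one_sub_div_pow_mul_sin_pow_sub_le hsin N) (by positivity : 0 ≤ Q)
  rw [← abs_of_nonneg (by positivity : 0 ≤ Q), ← abs_mul, abs_of_nonneg (by positivity : 0 ≤ Q),
    mul_add, mul_sub, hzeroth, mul_left_comm Q, hsecond, mul_left_comm Q] at hremainder
  have hsquare := mul_le_mul_of_nonneg_left (abs_inv_mul_sub_inv_sq_le ht1)
    (by positivity : 0 ≤ (m + 2).choose 3 * π ^ 2)
  have hcube := mul_le_mul_of_nonneg_left hthird hK
  rw [← abs_of_nonneg (by positivity : 0 ≤ (m + 2).choose 3 * π ^ 2), ← abs_mul,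
    abs_of_nonneg (by positivity : 0 ≤ (m + 2).choose 3 * π ^ 2), mul_sub] at hsquare
  rw [abs_le] at hremainder hsquare ⊢
  constructor <;> linarith

theorem integral_one_sub_div_pow_mul_sin_pow_nonneg (N m : ℕ) :
    0 ≤ ∫ x in (0)..π, (1 - x / π) ^ N * Real.sin x ^ m :=
  intervalIntegral.integral_nonneg Real.pi_pos.le fun _ hx =>
    mul_nonneg (pow_nonneg (sub_nonneg.2 (div_le_one_of_le₀ hx.2 Real.pi_pos.le)) _)
      (pow_nonneg (Real.sin_nonneg_of_nonneg_of_le_pi hx.1 hx.2) _)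

/-- The right-hand side of the formula for the expected surface area of the spherical convex hull
of `n` independent uniform random points in a halfsphere of `S^d`. -/
noncomputable def expectedSurfaceArea (d n : ℕ) : ℝ :=
  d * omega d / π ^ d * n.choose d * ∫ x in (0)..π, (1 - x / π) ^ (n - d) * Real.sin x ^ (d - 1)

theorem expectedSurfaceArea_nonneg {d : ℕ} (hd : 0 < d) (n : ℕ) :
    0 ≤ expectedSurfaceArea d n := by
  have homega := omega_pos hd
  have hintegral := integral_one_sub_div_pow_mul_sin_pow_nonneg (n - d) (d - 1)
  rw [expectedSurfaceArea]
  positivity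

theorem lintegral_surfaceArea_polytope_eq_expectedSurfaceArea {m n : ℕ} (hn : m + 1 < n)
    (e : Sph (m + 1)) :
    ∫⁻ x : Fin n → Sph (m + 1), surfaceArea (polytope x)
      ∂(Measure.pi fun _ => uniformHalfsphere e) =
      ENNReal.ofReal (expectedSurfaceArea (m + 1) n) := by
  rw [lintegral_surfaceArea_polytope hn, ← ENNReal.ofReal_natCast,
    ← ENNReal.ofReal_mul (Nat.cast_nonneg _), expectedSurfaceArea, Nat.add_sub_cancel]
  congr 1
  push_cast
  ring

theorem exists_abs_expectedSurfaceArea_sub_le {d : ℕ} (hd : 0 < d) : ∃ C : ℝ, ∀ n : ℕ, d ≤ n →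
    |expectedSurfaceArea d n - omega d * (1 - (d + 1).choose 3 * π ^ 2 * ((n : ℝ) ^ 2)⁻¹)| ≤
      C * ((n : ℝ) ^ 3)⁻¹ := by
  obtain ⟨m, rfl⟩ := Nat.exists_eq_add_of_le' hd
  obtain ⟨C, hC⟩ := exists_abs_choose_mul_integral_sub_le m
  have homega := (omega_pos hd).le
  refine ⟨omega (m + 1) * C, fun n hn => ?_⟩
  calc _ = |omega (m + 1) * ((m + 1 : ℝ) / π ^ (m + 1) * n.choose (m + 1) *
          (∫ x in (0)..π, (1 - x / π) ^ (n - (m + 1)) * Real.sin x ^ m) -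
          (1 - (m + 2).choose 3 * π ^ 2 * ((n : ℝ) ^ 2)⁻¹))| := by
        rw [expectedSurfaceArea, Nat.add_sub_cancel]
        push_cast
        ring_nf
    _ ≤ omega (m + 1) * (C * ((n : ℝ) ^ 3)⁻¹) := by
        rw [abs_mul, abs_of_nonneg homega]
        exact mul_le_mul_of_nonneg_left (hC n hn) homega
    _ = omega (m + 1) * C * ((n : ℝ) ^ 3)⁻¹ := (mul_assoc _ _ _).symm

end Asymptotics

end RandomSphericalPolytope

open RandomSphericalPolytope in
theorem theoremT2_general (d : ℕ) (hd : 1 ≤ d) :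
    ∃ C : ℝ, ∀ (e : Sph d) (n : ℕ), d + 1 ≤ n →
      ∀ (Ω : Type*) [MeasurableSpace Ω] (Pr : Measure Ω) [IsProbabilityMeasure Pr]
        (X : Fin n → Ω → Sph d),
        iIndepFun X Pr → (∀ i, HasLaw (X i) (uniformHalfsphere e) Pr) →
          AEMeasurable (fun ω => surfaceArea (polytope fun i => X i ω)) Pr ∧
          ∫⁻ ω, surfaceArea (polytope fun i => X i ω) ∂Pr =
            ENNReal.ofReal (d * omega d / Real.pi ^ d * (n.choose d : ℝ) *
              ∫ x in (0 : ℝ)..Real.pi, (1 - x / Real.pi) ^ (n - d) * Real.sin x ^ (d - 1)) ∧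
          |(∫⁻ ω, surfaceArea (polytope fun i => X i ω) ∂Pr).toReal -
              omega d * (1 - ((d + 1).choose 3 : ℝ) * Real.pi ^ 2 * ((n : ℝ) ^ 2)⁻¹)| ≤
            C * ((n : ℝ) ^ 3)⁻¹ := by
  obtain ⟨m, rfl⟩ := Nat.exists_eq_add_of_le' hd
  obtain ⟨C, hC⟩ := exists_abs_expectedSurfaceArea_sub_le hd
  refine ⟨C, fun e n hn Ω _ Pr _ X hindep hlaw => ?_⟩
  have hjoint := hindep.hasLaw_pi hlaw
  have hmeas := aemeasurable_surfaceArea_polytope hn e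
  have hmean := lintegral_surfaceArea_polytope_eq_expectedSurfaceArea hn e
  rw [← hjoint.map_eq] at hmeas hmean
  rw [lintegral_map' hmeas hjoint.aemeasurable] at hmean
  refine ⟨hmeas.comp_aemeasurable hjoint.aemeasurable, hmean, ?_⟩
  rw [hmean, ENNReal.toReal_ofReal (expectedSurfaceArea_nonneg hd n)]
  exact hC n (by omega)

open RandomSphericalPolytope in
/-- For the spherical convex hull `P_n` of `n ≥ d + 1` independent uniform random points of a
closed halfsphere of `S^d`: the explicit formula for the expected surface area, and its asymptotic
expansion, in which the constant of the `O(n⁻³)` term depends only on `d`. The expectation of the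
`[0, ∞]`-valued random variable `S(P_n)` is its integral `∫⁻`, which the formula shows to be
finite. -/
theorem theoremT2 (d : ℕ) (hd : 2 ≤ d) :
    ∃ C : ℝ, ∀ (e : Sph d) (n : ℕ), d + 1 ≤ n →
      ∀ (Ω : Type*) [MeasurableSpace Ω] (Pr : Measure Ω) [IsProbabilityMeasure Pr]
        (X : Fin n → Ω → Sph d),
        iIndepFun X Pr → (∀ i, HasLaw (X i) (uniformHalfsphere e) Pr) →
          AEMeasurable (fun ω => surfaceArea (polytope fun i => X i ω)) Pr ∧
          ∫⁻ ω, surfaceArea (polytope fun i => X i ω) ∂Pr =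
            ENNReal.ofReal (d * omega d / Real.pi ^ d * (n.choose d : ℝ) *
              ∫ x in (0 : ℝ)..Real.pi, (1 - x / Real.pi) ^ (n - d) * Real.sin x ^ (d - 1)) ∧
          |(∫⁻ ω, surfaceArea (polytope fun i => X i ω) ∂Pr).toReal -
              omega d * (1 - ((d + 1).choose 3 : ℝ) * Real.pi ^ 2 * ((n : ℝ) ^ 2)⁻¹)| ≤
            C * ((n : ℝ) ^ 3)⁻¹ := by
  exact theoremT2_general d (by omega)
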